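/- Let $\Gamma=\mathrm{SL}_2(\mathbb Z)$, let $\mathfrak H^+$ and $\mathfrak H^-$ be the upper and lower half-planes, let $r\ge 0$ be real and let $v:\Gamma\to\mathbb C^\ast$ be a multiplier system for the weight $r$, that is, there is a non-zero holomorphic $f:\mathfrak H^+\to\mathbb C$ with $$f(\gamma z)=v(\gamma)(cz+d)^r f(z)\qquad\text{for all }\gamma=\begin{pmatrix}a&b\\c&d\end{pmatrix}\in\Gamma,\quad \arg(cz+d)\in(-\pi,\pi].\tag{1}$$ Let $M_r(v)$ be the space of entire modular forms: the holomorphic $h$ on $\mathfrak H^+$ satisfying (1) with $h(z)=O(1)$ as $\operatorname{Im}z\to\infty$. For $f$ on $\mathfrak H^-$ put $f^-(t)=(i-t)^rf(t)$; for $h$ on $\mathfrak H^+$ put $h^+(z)=(-i-z)^rh(z)$ (principal powers). Let $\mathcal D^{\infty}$ be the space of holomorphic $f$ on $\mathfrak H^-$ for which $f^-$ extends to a $C^\infty$ function on $\mathfrak H^-\cup\mathbb P^1(\mathbb R)$, with the topology of uniform convergence on $\mathbb P^1(\mathbb R)$ of all derivatives of $f^-$ with respect to $\theta$, $t=-\cot\theta$,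 and with the right $\Gamma$-action $$(f|\gamma)(t)=v(\gamma)(ct+d)^{-r}f(\gamma t),\qquad \arg(ct+d)\in[-\pi,\pi).$$ The space of coinvariants is $(\mathcal D^\infty)_\Gamma=\mathcal D^\infty/\sum_{\gamma\in\Gamma}\mathcal D^\infty|(1-\gamma)$; write $[c]$ for the class of $c\in\mathcal D^\infty$. Let $h\in M_r(v)$. The bilinear form $[h,\cdot]_r$ is as follows. - If $r>0$ and $f\in\mathcal D^\infty$ is such that $f^-$ extends holomorphically to a neighbourhood of $\mathfrak H^-\cup\mathbb P^1(\mathbb R)$ in $\mathbb P^1(\mathbb C)$, then $$[h,f]_r=\frac1\pi\int_{C_2}h^+(z)\,(\sigma_rf^-)(z)\,\frac{dz}{(z+i)^2},$$ $$(\sigma_rf^-)(z)=\frac1\pi\,\frac{z+i}{z-i}\int_{C_1}f^-(\tau)\;{}_2F_1\!\Bigl(1,1;r;\frac{(\tau-i)(z+i)}{(\tau+i)(z-i)}\Bigr)\frac{d\tau}{\tau^2+1},$$ where $C_j$ is the positively oriented circle $\bigl|\frac{z-i}{z+i}\bigr|=\rho_j$ with $\rho_1<\rho_2<1$ so close to $1$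 that $f^-$ is holomorphic on and outside $C_1$. For general $c\in\mathcal D^\infty$, $[h,c]_r$ is given by the continuous extension of this linear form to $\mathcal D^\infty$. - If $r=0$, then $[h,c]_0$ is defined only for $c$ a polynomial function of degree at most $0$, that is, a constant $c=d$; it is given by the same integral over a circle $\bigl|\frac{z-i}{z+i}\bigr|=\rho$, $0<\rho<1$, with $(\sigma_0c^-)(z)=d\,\frac{z+i}{z-i}$. Then: 1. If $r>0$, then for every $h\in M_r(v)$ this continuous extension to $\mathcal D^\infty$ exists and is unique. 2. Let $c\in\mathcal D^\infty$. If there is an $h\in M_r(v)$ such that $[h,c]_r$ is defined (no condition if $r>0$; $c$ constant if $r=0$) and $[h,c]_r\ne0$, then the coinvariant $[c]\in(\mathcal D^\infty)_\Gamma$ is non-trivial. -/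

import Mathlib

open scoped ContDiff Manifold MatrixGroups ComplexConjugate UpperHalfPlane
open Complex Metric

noncomputable section

namespace ModularCoinvariant

/-! ### Modular forms of real weight on the upper half-plane -/

/-- The factor of automorphy `c z + d` of `γ = (a, b; c, d)` in `SL₂(ℤ)`. -/
def autFactor (γ : SL(2, ℤ)) (z : ℂ) : ℂ := (γ 1 0 : ℂ) * z + (γ 1 1 : ℂ)

/-- `f ∈ A_r(v)`: `f` is holomorphic on the upper half-plane and
`f (γ z) = v γ (c z + d)^r f z` for all `γ`. The power is the principal one, that is
`arg (c z + d) ∈ (-π, π]`. -/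
def IsModularForm (r : ℝ) (v : SL(2, ℤ) → ℂˣ) (f : ℍ → ℂ) : Prop :=
  MDifferentiable 𝓘(ℂ) 𝓘(ℂ) f ∧
    ∀ (γ : SL(2, ℤ)) (z : ℍ), f (γ • z) = (v γ : ℂ) * autFactor γ z ^ (r : ℂ) * f z

/-- `v` is a multiplier system for the weight `r`: the transformation law has a nonzero
holomorphic solution (no growth condition). -/
def IsMultiplierSystem (r : ℝ) (v : SL(2, ℤ) → ℂˣ) : Prop :=
  ∃ f : ℍ → ℂ, f ≠ 0 ∧ IsModularForm r v f

/-- `h ∈ M_r(v)`: entire modular forms, `h z = O(1)` as `im z → ∞`. -/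
def IsEntireModularForm (r : ℝ) (v : SL(2, ℤ) → ℂˣ) (h : ℍ → ℂ) : Prop :=
  IsModularForm r v h ∧ UpperHalfPlane.IsBoundedAtImInfty h

/-! ### Functions on the lower half-plane and the action of the modular group -/

/-- The lower half-plane. -/
abbrev LowerHalfPlane : Type := {t : ℂ // t.im < 0}

/-- Extension by zero, used only to speak about derivatives on the open lower half-plane. -/
def extendZero (f : LowerHalfPlane → ℂ) (t : ℂ) : ℂ :=
  open Classical in if ht : t.im < 0 then f ⟨t, ht⟩ else 0

/-- The Möbius action `t ↦ (a t + b) / (c t + d)` on the lower half-plane. -/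
def lowerMoebius (γ : SL(2, ℤ)) (t : LowerHalfPlane) : LowerHalfPlane :=
  ⟨((γ 0 0 : ℂ) * t + (γ 0 1 : ℂ)) / autFactor γ t, by
    have hz : 0 < (conj (t : ℂ)).im := by simpa using t.2
    have h := (γ • (⟨conj (t : ℂ), hz⟩ : ℍ)).im_pos
    have e : (((γ • (⟨conj (t : ℂ), hz⟩ : ℍ)) : ℍ) : ℂ) =
        conj (((γ 0 0 : ℂ) * t + (γ 0 1 : ℂ)) / autFactor γ t) := by
      rw [UpperHalfPlane.specialLinearGroup_apply]
      simp [autFactor]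
    rw [← UpperHalfPlane.coe_im, e, conj_im] at h
    linarith⟩

/-- The power `z ^ s` for the choice `arg z ∈ [-π, π)` of the argument. -/
def lowerPow (z : ℂ) (s : ℝ) : ℂ := conj (conj z ^ (s : ℂ))

/-- The right action `f ↦ f |⁻_{v⁻¹, r} γ` on functions on the lower half-plane,
`(f | γ) t = v γ (c t + d)^(-r) f (γ t)` with `arg (c t + d) ∈ [-π, π)`. -/
def lowerSlash (r : ℝ) (v : SL(2, ℤ) → ℂˣ) (γ : SL(2, ℤ)) (f : LowerHalfPlane → ℂ) :
    LowerHalfPlane → ℂ :=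
  fun t => (v γ : ℂ) * lowerPow (autFactor γ t) (-r) * f (lowerMoebius γ t)

/-! ### The module of smooth vectors -/

/-- The function `f⁻ t = (i - t)^r f t`, written in the coordinate `W = (t + i) / (t - i)`, which
identifies the lower half-plane with the open unit disc and `ℙ¹(ℝ)` with the unit circle. The
inverse is `t = i (W + 1) / (W - 1)`. -/
def discFun (r : ℝ) (f : LowerHalfPlane → ℂ) (W : ℂ) : ℂ :=
  (I - I * (W + 1) / (W - 1)) ^ (r : ℂ) * extendZero f (I * (W + 1) / (W - 1))

theorem extendZero_zero : extendZero 0 = 0 := by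
  funext t; simp [extendZero]

theorem extendZero_add (f g : LowerHalfPlane → ℂ) :
    extendZero (f + g) = extendZero f + extendZero g := by
  funext t; by_cases ht : t.im < 0 <;> simp [extendZero, ht]

theorem extendZero_smul (a : ℂ) (f : LowerHalfPlane → ℂ) :
    extendZero (a • f) = a • extendZero f := by
  funext t; by_cases ht : t.im < 0 <;> simp [extendZero, ht]

/-- The holomorphic functions `f` on the lower half-plane for which `f⁻` extends to a `C^∞`
function on the union of the lower half-plane and `ℙ¹(ℝ)`, that is on the closed unit disc
in the coordinate `W`. -/
def smoothSubmodule (r : ℝ) : Submodule ℂ (LowerHalfPlane → ℂ) where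
  carrier := {f | DifferentiableOn ℂ (extendZero f) {t | t.im < 0} ∧
    ∃ G : ℂ → ℂ, ContDiffOn ℝ ∞ G (closedBall 0 1) ∧ Set.EqOn (discFun r f) G (ball 0 1)}
  zero_mem' := by
    refine ⟨?_, 0, contDiffOn_const, fun W _ => by simp [discFun, extendZero_zero]⟩
    rw [extendZero_zero]
    exact differentiableOn_const 0
  add_mem' := by
    rintro f g ⟨hf, F, hF, hfF⟩ ⟨hg, G, hG, hgG⟩
    refine ⟨?_, F + G, hF.add hG, fun W hW => ?_⟩
    · rw [extendZero_add]
      exact hf.add hg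
    · rw [Pi.add_apply, ← hfF hW, ← hgG hW]
      simp [discFun, extendZero_add, mul_add]
  smul_mem' := by
    rintro a f ⟨hf, F, hF, hfF⟩
    refine ⟨?_, a • F, hF.const_smul a, fun W hW => ?_⟩
    · rw [extendZero_smul]
      exact hf.const_smul a
    · rw [Pi.smul_apply, ← hfF hW]
      simp [discFun, extendZero_smul, mul_left_comm]

/-- The module of smooth vectors of weight `r`, with its own topology (not the one of pointwise
convergence). The multiplier system enters only through the action. -/
def SmoothModule (r : ℝ) : Type := smoothSubmodule r

instance (r : ℝ) : AddCommGroup (SmoothModule r) :=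
  inferInstanceAs (AddCommGroup (smoothSubmodule r))

instance (r : ℝ) : Module ℂ (SmoothModule r) :=
  inferInstanceAs (Module ℂ (smoothSubmodule r))

/-- The function on the lower half-plane underlying an element of the module. -/
def SmoothModule.toFun {r : ℝ} (f : SmoothModule r) : LowerHalfPlane → ℂ := f.1

/-- The boundary values of `f⁻` on `ℙ¹(ℝ)` as a function of `θ`, where `t = -cot θ`, that is
`W = e^(-2 i θ)`. -/
def boundaryFun (r : ℝ) (f : LowerHalfPlane → ℂ) (θ : ℝ) : ℂ :=
  extendFrom (ball 0 1) (discFun r f) (exp (-2 * I * θ))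

/-- The natural topology: uniform convergence on `ℙ¹(ℝ)` of all `θ`-derivatives of `f⁻`. -/
instance (r : ℝ) : TopologicalSpace (SmoothModule r) :=
  TopologicalSpace.induced
    (fun (f : SmoothModule r) (k : ℕ) =>
      UniformFun.ofFun (iteratedDeriv k (boundaryFun r f.toFun)))
    inferInstance

/-! ### Coinvariants -/

/-- The subspace of the smooth vectors of the form `∑ f_j | (1 - γ_j)` with `f_j` smooth. -/
def coinvariantKernel (r : ℝ) (v : SL(2, ℤ) → ℂˣ) : Submodule ℂ (SmoothModule r) :=
  (Submodule.span ℂ {g : LowerHalfPlane → ℂ |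
    ∃ f ∈ smoothSubmodule r, ∃ γ : SL(2, ℤ), g = f - lowerSlash r v γ f}).comap
    (smoothSubmodule r).subtype

/-- The space of coinvariants of the smooth vectors for the action `|⁻_{v⁻¹, r}`. -/
abbrev Coinvariants (r : ℝ) (v : SL(2, ℤ) → ℂˣ) : Type :=
  SmoothModule r ⧸ coinvariantKernel r v

/-- The coinvariant `[c]` represented by `c`. -/
def coinvariantClass (r : ℝ) (v : SL(2, ℤ) → ℂˣ) (c : SmoothModule r) : Coinvariants r v :=
  Submodule.Quotient.mk c

/-! ### The duality -/

/-- The contour integral `∫ g(z) dz` over the positively oriented circle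
`|(z - i) / (z + i)| = ρ` around `i` in the upper half-plane, `0 < ρ < 1`, written with the
parameter `w = (z - i) / (z + i)`, `z = i (1 + w) / (1 - w)`, `dz = 2 i (1 - w)⁻² dw`. -/
def contourIntegral (ρ : ℝ) (g : ℂ → ℂ) : ℂ :=
  ∮ w in C(0, ρ), g (I * (1 + w) / (1 - w)) * (2 * I / (1 - w) ^ 2)

/-- The function `h⁺ z = (-i - z)^r h z` on the upper half-plane. -/
def plusFun (r : ℝ) (h : ℍ → ℂ) (z : ℂ) : ℂ :=
  (-I - z) ^ (r : ℂ) * h (UpperHalfPlane.ofComplex z)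

/-- `s ↦ (1/π) ∫_C h⁺(z) s(z) dz / (z + i)²`, over the circle of radius `ρ` in the disc
coordinate. -/
def contourPairing (r : ℝ) (h : ℍ → ℂ) (ρ : ℝ) (s : ℂ → ℂ) : ℂ :=
  1 / (Real.pi : ℂ) * contourIntegral ρ fun z => plusFun r h z * s z / (z + I) ^ 2

/-- The operator `σ_r` for `r ∉ ℤ_{≤ 0}`, applied to the function
`f⁻(τ) = G ((τ + i) / (τ - i))`:
`(σ_r f⁻)(z) = (1/π) (z + i)/(z - i) ∫_C f⁻(τ) ₂F₁(1, 1; r; (τ - i)(z + i)/((τ + i)(z - i)))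
dτ / (τ² + 1)`, for `z` outside the circle `C` of radius `ρ` in the disc coordinate, so that
the argument of the hypergeometric series has absolute value less than `1`. -/
def sigmaOp (r : ℝ) (G : ℂ → ℂ) (ρ : ℝ) (z : ℂ) : ℂ :=
  1 / (Real.pi : ℂ) * ((z + I) / (z - I)) * contourIntegral ρ fun τ =>
    G ((τ + I) / (τ - I)) *
      ordinaryHypergeometric (1 : ℂ) (1 : ℂ) (r : ℂ)
        ((τ - I) * (z + I) / ((τ + I) * (z - I))) / (τ ^ 2 + 1)

/-- The linear form `ℓ` is given by the contour integrals
`[h, f]_r = (1/π) ∫_C h⁺(z) (σ_r f⁻)(z) dz / (z + i)²` on the analytic vectors `f`: those for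
which `f⁻` extends (as `G`) to a holomorphic function on a neighbourhood of the union of the lower
half-plane and `ℙ¹(ℝ)`, that is on a disc of radius `R > 1` in the coordinate `W`. The circles
`ρ₁` (in `σ_r`) and `ρ₂ > ρ₁` lie in the domain of the extended `f⁻`. -/
def ExtendsAnalyticPairing (r : ℝ) (h : ℍ → ℂ) (ℓ : SmoothModule r → ℂ) : Prop :=
  ∀ (f : SmoothModule r) (G : ℂ → ℂ) (R ρ₁ ρ₂ : ℝ), 1 < R →
    DifferentiableOn ℂ G (ball 0 R) → Set.EqOn (discFun r f.toFun) G (ball 0 1) →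
    R⁻¹ < ρ₁ → ρ₁ < ρ₂ → ρ₂ < 1 →
    ℓ f = contourPairing r h ρ₂ (sigmaOp r G ρ₁)

/-- `x = [h, c]_r`. For `r > 0` the form `[h, ·]_r` is the continuous extension to all smooth
vectors of the form given by contour integrals on the analytic vectors. For `r = 0` it is defined
only on polynomial functions of degree at most `0`, that is for constant `c = d`; then
`σ_0 c⁻` is the function `z ↦ d ((z - i) / (z + i))⁻¹`. -/
def IsDualPairing (r : ℝ) (h : ℍ → ℂ) (c : SmoothModule r) (x : ℂ) : Prop :=
  (0 < r ∧ ∃ ℓ : SmoothModule r →L[ℂ] ℂ, ExtendsAnalyticPairing r h ℓ ∧ x = ℓ c) ∨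
  (r = 0 ∧ ∃ d : ℂ, (∀ t, c.toFun t = d) ∧ ∃ ρ : ℝ, 0 < ρ ∧ ρ < 1 ∧
    x = contourPairing r h ρ fun z => d * ((z - I) / (z + I))⁻¹)

end ModularCoinvariant

end

noncomputable section

namespace ModularCoinvariant

open Filter Topology

/-! ### Taylor coefficients -/

/-! Everything is read off from Taylor coefficients in disc coordinates. In `W = (t + i)/(t - i)`, a
smooth vector `f` becomes a holomorphic function `f⁻` on the unit disc whose coefficients `aₙ(f)`
decay faster than every power of `n` (`isRapidlyDecaying_coef`). In `w = (z - i)/(z + i)`, the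
function `h⁺` has coefficients `bₙ` of polynomial growth, because `h` grows moderately at the
boundary. The operator `σ_r` multiplies `aₙ` by `n!/(r)_n` and turns `Wⁿ` into `w⁻ⁿ⁻¹`, so the outer
contour integral extracts the diagonal: `[h, f]_r = ∑ n!/(r)_n bₙ aₙ(f)` (`contourPairing_sigmaOp`).
This series converges for every smooth `f` and is continuous in `f`. Since the Taylor polynomials of
`f⁻` converge to it in the smooth topology (`tendsto_sum_smul_monomialVec`), the continuous
extension is unique.

A non-trivial class is detected by an invariant form. A group element acts in the disc coordinate by
a Blaschke factor and a power of a linear function (`discFun_lowerSlash`). The matrix of this action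
on coefficients is temperate, so composing a form `∑ lₙ aₙ` with it gives another form `∑ dₙ aₙ`
(`exists_seqForm_lowerSlash`). It remains to compare `d` with `l`, and test vectors suffice for
that.

For `r > 0` the test vectors are `(ζ - t)^(-r)`. Their coefficients are `(r)_n/n! xⁿ` up to a factor
independent of `n`, with `x` the disc coordinate of `ζ`, so the values of a form on them are a
generating function that determines it. The form `[h, ·]_r` takes the value `(-2i)^r h(ζ)` there
(`seqForm_kernelVec`), and the action multiplies these vectors by the automorphy factor of `h`.
Hence `d = l`.

For `r = 0` those vectors are constant and carry no information. If the pairing is non-zero, `h` is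
a non-zero constant and `v = 1`, so what is needed is an invariant form that does not vanish on
constants. The test vectors are now the constant `1` and the Cauchy kernels `(ζ - t)⁻¹`. The latter
transform with weight two and a constant defect `-c(cζ + d)`. A multiple of the Eisenstein series
`E₂` has exactly this defect, so the form with value `1` at the constant and `quasiE2 ζ` at the
Cauchy kernel is invariant (`seqForm_quasiSeq_lowerSlash`). -/

/-- The `n`-th Taylor coefficient at the origin. -/
def taylorCoeff (G : ℂ → ℂ) (n : ℕ) : ℂ := (n.factorial : ℂ)⁻¹ * iteratedDeriv n G 0

theorem hasSum_taylorCoeff {G : ℂ → ℂ} {R : ℝ} (hG : DifferentiableOn ℂ G (ball 0 R)) {W : ℂ}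
    (hW : W ∈ ball 0 R) : HasSum (fun n => taylorCoeff G n * W ^ n) (G W) := by
  convert! Complex.hasSum_taylorSeries_on_ball hG hW using 2 with n
  simp only [taylorCoeff, sub_zero, smul_eq_mul]
  ring

/-- Convergence at a real point `s < R` forces `|aₙ| sⁿ → 0`, which bounds the radius of convergence
from below by `s`. -/
theorem hasFPowerSeriesOnBall_of_hasSum {G : ℂ → ℂ} {a : ℕ → ℂ} {R : ℝ} (hR : 0 < R)
    (h : ∀ W ∈ ball (0 : ℂ) R, HasSum (fun n => a n * W ^ n) (G W)) :
    HasFPowerSeriesOnBall G (FormalMultilinearSeries.ofScalars ℂ a) 0 (ENNReal.ofReal R) where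
  r_le := by
    refine ENNReal.le_of_forall_nnreal_lt fun s hs => ?_
    have hs' : (s : ℝ) < R := by
      rw [← ENNReal.ofReal_coe_nnreal] at hs
      exact (ENNReal.ofReal_lt_ofReal_iff hR).1 hs
    have h1 := (h (s : ℂ) (by simpa using hs')).summable.tendsto_atTop_zero.norm
    rw [norm_zero] at h1
    refine FormalMultilinearSeries.le_radius_of_tendsto _ (l := 0) ?_
    refine h1.congr fun n => ?_
    rw [FormalMultilinearSeries.ofScalars_norm, norm_mul, norm_pow]
    simp
  r_pos := by simpa using hR
  hasSum := by
    intro y hy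
    have hy' : y ∈ ball (0 : ℂ) R := by
      simpa [Metric.mem_eball, edist_eq_enorm_sub, ← ofReal_norm, ENNReal.ofReal_lt_ofReal_iff hR]
        using hy
    simpa [FormalMultilinearSeries.ofScalars_apply_eq, mul_comm] using h y hy'

/-- Uniqueness of power series. Coefficients of concrete vectors are computed below by exhibiting
some convergent expansion. -/
theorem taylorCoeff_eq_of_hasSum {G : ℂ → ℂ} {a : ℕ → ℂ} {R : ℝ} (hR : 0 < R)
    (h : ∀ W ∈ ball (0 : ℂ) R, HasSum (fun n => a n * W ^ n) (G W)) (n : ℕ) :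
    taylorCoeff G n = a n := by
  have h1 := (hasFPowerSeriesOnBall_of_hasSum hR h).factorial_smul 1 n
  rw [taylorCoeff, iteratedDeriv_eq_iteratedFDeriv, ← h1]
  have : (n.factorial : ℂ) ≠ 0 := by exact_mod_cast n.factorial_ne_zero
  simp [this]

theorem taylorCoeff_congr {F G : ℂ → ℂ} {R : ℝ} (hR : 0 < R)
    (h : Set.EqOn F G (ball 0 R)) (n : ℕ) : taylorCoeff F n = taylorCoeff G n := by
  rw [taylorCoeff, taylorCoeff, (h.eventuallyEq_of_mem (ball_mem_nhds _ hR)).iteratedDeriv_eq]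

theorem norm_taylorCoeff_le {G : ℂ → ℂ} {R ρ C : ℝ} (hG : DifferentiableOn ℂ G (ball 0 R))
    (hρ : 0 < ρ) (hρR : ρ < R) (hC : ∀ W : ℂ, ‖W‖ = ρ → ‖G W‖ ≤ C) (n : ℕ) :
    ‖taylorCoeff G n‖ ≤ C / ρ ^ n := by
  have h1 : DiffContOnCl ℂ G (ball 0 ρ) :=
    (hG.mono (closedBall_subset_ball hρR)).diffContOnCl_ball subset_rfl
  have h2 := Complex.norm_iteratedDeriv_le_of_forall_mem_sphere_norm_le n hρ h1
    (C := C) (fun z hz => hC z (by simpa using hz))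
  have h3 : (0 : ℝ) < n.factorial := by exact_mod_cast n.factorial_pos
  rw [taylorCoeff, norm_mul, norm_inv, Complex.norm_natCast]
  calc _ ≤ (n.factorial : ℝ)⁻¹ * (n.factorial * C / ρ ^ n) := by gcongr
    _ = C / ρ ^ n := by field_simp

/-! ### Polynomially bounded and rapidly decaying sequences -/

/-- Sequences of at most polynomial growth. -/
def IsPolyBounded (a : ℕ → ℂ) : Prop := ∃ (C : ℝ) (K : ℕ), ∀ n, ‖a n‖ ≤ C * (n + 1) ^ K

/-- Sequences that decay faster than every power. -/
def IsRapidlyDecaying (a : ℕ → ℂ) : Prop := ∀ K : ℕ, ∃ C : ℝ, ∀ n, ‖a n‖ * (n + 1) ^ K ≤ C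

theorem summable_inv_add_one_sq : Summable fun n : ℕ => (((n : ℝ) + 1) ^ 2)⁻¹ := by
  have := (summable_nat_add_iff 1).2 (Real.summable_nat_pow_inv.2 one_lt_two)
  simpa using this

theorem IsRapidlyDecaying.summable_norm_mul {a : ℕ → ℂ} (ha : IsRapidlyDecaying a) (K : ℕ) :
    Summable fun n : ℕ => ‖a n‖ * ((n : ℝ) + 1) ^ K := by
  obtain ⟨C, hC⟩ := ha (K + 2)
  refine Summable.of_nonneg_of_le (fun n => by positivity) (fun n => ?_)
    (summable_inv_add_one_sq.mul_left C)
  rw [← div_eq_mul_inv, le_div_iff₀ (by positivity), mul_assoc, ← pow_add]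
  exact hC n

theorem IsRapidlyDecaying.summable_norm {a : ℕ → ℂ} (ha : IsRapidlyDecaying a) :
    Summable fun n : ℕ => ‖a n‖ := by
  simpa using ha.summable_norm_mul 0

theorem IsPolyBounded.summable_norm_mul {l a : ℕ → ℂ} (hl : IsPolyBounded l)
    (ha : IsRapidlyDecaying a) : Summable fun n : ℕ => ‖l n * a n‖ := by
  obtain ⟨C, K, hC⟩ := hl
  refine Summable.of_nonneg_of_le (fun n => norm_nonneg _) (fun n => ?_)
    ((ha.summable_norm_mul K).mul_left C)
  rw [norm_mul]
  calc ‖l n‖ * ‖a n‖ ≤ (C * (n + 1) ^ K) * ‖a n‖ := by gcongr; exact hC n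
    _ = _ := by ring

theorem IsPolyBounded.summable_mul_pow {l : ℕ → ℂ} (hl : IsPolyBounded l) {ρ : ℝ} (h0 : 0 ≤ ρ)
    (h1 : ρ < 1) : Summable fun n : ℕ => ‖l n‖ * ρ ^ n := by
  obtain ⟨C, K, hC⟩ := hl
  have h2 : Summable fun n : ℕ => ((n + 1 : ℕ) : ℝ) ^ K * ρ ^ n := by
    rcases h0.eq_or_lt with rfl | h0
    · refine summable_of_ne_finset_zero (s := {0}) fun n hn => ?_
      rw [zero_pow (by simpa using hn), mul_zero]
    · have h3 := (summable_nat_add_iff 1).2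
        (summable_pow_mul_geometric_of_norm_lt_one K (r := ρ)
          (by rwa [Real.norm_of_nonneg h0.le]))
      refine (h3.mul_right ρ⁻¹).congr fun n => ?_
      rw [pow_succ]
      field_simp
  refine Summable.of_nonneg_of_le (fun n => by positivity) (fun n => ?_) (h2.mul_left C)
  rw [← mul_assoc]
  gcongr
  exact_mod_cast hC n

theorem IsPolyBounded.mul {l m : ℕ → ℂ} (hl : IsPolyBounded l) (hm : IsPolyBounded m) :
    IsPolyBounded fun n => l n * m n := by
  obtain ⟨C, K, hC⟩ := hl
  obtain ⟨D, L, hD⟩ := hm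
  refine ⟨C * D, K + L, fun n => ?_⟩
  rw [norm_mul, pow_add, mul_mul_mul_comm]
  exact mul_le_mul (hC n) (hD n) (norm_nonneg _) ((norm_nonneg _).trans (hC n))

/-- Taylor coefficients of a function of moderate growth on the unit disc are polynomially
bounded. -/
theorem isPolyBounded_taylorCoeff {G : ℂ → ℂ} (hG : DifferentiableOn ℂ G (ball 0 1)) {C : ℝ}
    {K : ℕ} (hC : ∀ W ∈ ball (0 : ℂ) 1, ‖G W‖ ≤ C * ((1 - ‖W‖) ^ K)⁻¹) :
    IsPolyBounded (taylorCoeff G) := by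
  have hC0 : 0 ≤ C := by simpa using (norm_nonneg _).trans (hC 0 (by simp))
  refine ⟨C * 2 ^ K * Real.exp 1, K, fun n => ?_⟩
  have hn : (0 : ℝ) < n + 1 := by positivity
  -- Cauchy's estimate on this radius costs `(n + 2)^K` from the growth of `G`, while `ρ⁻ⁿ = (1 +
  -- 1/(n+1))ⁿ` stays below `e`. The shift by `2` keeps `ρ` positive at `n = 0`.
  set ρ : ℝ := 1 - 1 / (n + 2) with hρ
  have hρ' : ρ = (1 + 1 / ((n : ℝ) + 1))⁻¹ := by rw [hρ]; field_simp; ring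
  have hρ0 : 0 < ρ := by rw [hρ']; positivity
  have hρ1 : ρ < 1 := by rw [hρ]; linarith [show (0 : ℝ) < 1 / (n + 2) by positivity]
  have h1 : ∀ W : ℂ, ‖W‖ = ρ → ‖G W‖ ≤ C * ((n : ℝ) + 2) ^ K := by
    intro W hW
    refine (hC W (by simpa [hW] using hρ1)).trans (le_of_eq ?_)
    rw [hW, hρ, sub_sub_cancel, one_div, inv_pow, inv_inv]
  refine (norm_taylorCoeff_le hG hρ0 hρ1 h1 n).trans ?_
  have h2 : (ρ ^ n)⁻¹ ≤ Real.exp 1 := by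
    rw [hρ', inv_pow, inv_inv]
    calc (1 + 1 / ((n : ℝ) + 1)) ^ n ≤ (Real.exp (1 / ((n : ℝ) + 1))) ^ n := by
          gcongr
          linarith [Real.add_one_le_exp (1 / ((n : ℝ) + 1))]
      _ = Real.exp (n * (1 / ((n : ℝ) + 1))) := by rw [← Real.exp_nat_mul]
      _ ≤ Real.exp 1 := by
          gcongr
          rw [mul_one_div, div_le_one hn]
          linarith
  have h3 : ((n : ℝ) + 2) ^ K ≤ 2 ^ K * (n + 1) ^ K := by
    rw [← mul_pow]; gcongr; linarith
  calc C * ((n : ℝ) + 2) ^ K / ρ ^ n = C * ((n : ℝ) + 2) ^ K * (ρ ^ n)⁻¹ := div_eq_mul_inv _ _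
    _ ≤ C * (2 ^ K * (n + 1) ^ K) * Real.exp 1 := by gcongr
    _ = _ := by ring

/-! ### A contour integral -/

/-- With `dθ = du/(iu)` the integrand becomes `u^(n-k-1)`, which has a residue only for `k = n`. -/
theorem integral_circleMap_pow (ρ : ℝ) (hρ : 0 < ρ) (k n : ℕ) :
    ∫ θ in (0 : ℝ)..2 * Real.pi, (circleMap 0 ρ θ)⁻¹ ^ k * circleMap 0 ρ θ ^ n =
      if k = n then 2 * (Real.pi : ℂ) else 0 := by
  have hne : ∀ θ, circleMap 0 ρ θ ≠ 0 := fun θ => circleMap_ne_center hρ.ne'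
  have h1 : ∫ θ in (0 : ℝ)..2 * Real.pi, (circleMap 0 ρ θ)⁻¹ ^ k * circleMap 0 ρ θ ^ n =
      I⁻¹ * ∮ u in C(0, ρ), (u - 0) ^ ((n : ℤ) - k - 1) := by
    rw [circleIntegral, ← intervalIntegral.integral_const_mul]
    refine intervalIntegral.integral_congr fun θ _ => ?_
    simp only [deriv_circleMap, smul_eq_mul, sub_zero]
    rw [zpow_sub₀ (hne θ), zpow_sub₀ (hne θ), zpow_natCast, zpow_natCast, zpow_one]
    have := hne θ
    have := I_ne_zero
    rw [inv_pow]
    field_simp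
  rw [h1]
  split_ifs with h
  · subst h
    simp only [sub_self, zero_sub, zpow_neg, zpow_one]
    rw [circleIntegral.integral_sub_center_inv _ hρ.ne']
    field_simp [I_ne_zero]
  · rw [circleIntegral.integral_sub_zpow_of_ne (by omega), mul_zero]

/-- The contour integral `∮ F(u) Q(u) du/u` for `F` given by a series in `u⁻¹` and `Q` by a series
in `u`. -/
theorem circleIntegral_mul_of_hasSum {p q : ℕ → ℂ} {F Q : ℂ → ℂ} {ρ : ℝ} (hρ : 0 < ρ)
    (hp : Summable fun k => ‖p k‖ * ρ⁻¹ ^ k) (hq : Summable fun n => ‖q n‖ * ρ ^ n)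
    (hF : ∀ u : ℂ, ‖u‖ = ρ → HasSum (fun k => p k * u⁻¹ ^ k) (F u))
    (hQ : ∀ u : ℂ, ‖u‖ = ρ → HasSum (fun n => q n * u ^ n) (Q u)) :
    ∮ u in C(0, ρ), F u * Q u * u⁻¹ = 2 * Real.pi * I * ∑' n, p n * q n := by
  have hn : ∀ θ, ‖circleMap 0 ρ θ‖ = ρ := fun θ => by simp [abs_of_pos hρ]
  have hne : ∀ θ, circleMap 0 ρ θ ≠ 0 := fun θ => circleMap_ne_center hρ.ne'
  have hb := hp.mul_of_nonneg hq (fun k => by positivity) (fun k => by positivity)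
  -- The double series is dominated on the circle by a convergent product of constants, so it may be
  -- integrated termwise. Orthogonality then leaves only the diagonal.
  have key : HasSum (fun x : ℕ × ℕ => ∫ θ in (0 : ℝ)..2 * Real.pi,
      (p x.1 * (circleMap 0 ρ θ)⁻¹ ^ x.1) * (q x.2 * circleMap 0 ρ θ ^ x.2))
      (∫ θ in (0 : ℝ)..2 * Real.pi, F (circleMap 0 ρ θ) * Q (circleMap 0 ρ θ)) := by
    refine intervalIntegral.hasSum_integral_of_dominated_convergence
      (fun x _ => (‖p x.1‖ * ρ⁻¹ ^ x.1) * (‖q x.2‖ * ρ ^ x.2)) ?_ ?_ ?_ ?_ ?_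
    · intro x
      refine Continuous.aestronglyMeasurable ?_
      have h1 := continuous_circleMap 0 ρ
      have h2 := h1.inv₀ hne
      fun_prop
    · intro x
      refine Filter.Eventually.of_forall fun θ _ => le_of_eq ?_
      simp only [norm_mul, norm_pow, norm_inv, hn]
    · exact Filter.Eventually.of_forall fun θ _ => hb
    · exact intervalIntegrable_const
    · refine Filter.Eventually.of_forall fun θ _ => ?_
      have h1 : Summable fun x : ℕ × ℕ =>
          (p x.1 * (circleMap 0 ρ θ)⁻¹ ^ x.1) * (q x.2 * circleMap 0 ρ θ ^ x.2) := by
        refine Summable.of_norm ?_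
        simpa only [norm_mul, norm_pow, norm_inv, hn] using hb
      have h2 := hF _ (hn θ)
      have h3 := hQ _ (hn θ)
      exact HasSum.mul (f := fun k => p k * (circleMap 0 ρ θ)⁻¹ ^ k)
        (g := fun n => q n * circleMap 0 ρ θ ^ n) h2 h3 h1
  have key2 : ∀ x : ℕ × ℕ, ∫ θ in (0 : ℝ)..2 * Real.pi,
      (p x.1 * (circleMap 0 ρ θ)⁻¹ ^ x.1) * (q x.2 * circleMap 0 ρ θ ^ x.2) =
      if x.1 = x.2 then 2 * (Real.pi : ℂ) * (p x.1 * q x.2) else 0 := by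
    intro x
    have : ∀ θ, (p x.1 * (circleMap 0 ρ θ)⁻¹ ^ x.1) * (q x.2 * circleMap 0 ρ θ ^ x.2) =
        p x.1 * q x.2 * ((circleMap 0 ρ θ)⁻¹ ^ x.1 * circleMap 0 ρ θ ^ x.2) := fun θ => by ring
    simp only [this]
    rw [intervalIntegral.integral_const_mul, integral_circleMap_pow ρ hρ]
    split_ifs <;> ring
  simp only [key2] at key
  have hinj : Function.Injective fun n : ℕ => (n, n) := fun a b h => (Prod.ext_iff.1 h).1
  rw [← hinj.hasSum_iff] at key
  · have h3 : ∮ u in C(0, ρ), F u * Q u * u⁻¹ =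
        I * ∫ θ in (0 : ℝ)..2 * Real.pi, F (circleMap 0 ρ θ) * Q (circleMap 0 ρ θ) := by
      rw [circleIntegral, ← intervalIntegral.integral_const_mul]
      refine intervalIntegral.integral_congr fun θ _ => ?_
      simp only [deriv_circleMap, smul_eq_mul]
      field_simp [hne θ]
    have h4 := key.tsum_eq
    simp only [Function.comp_def, if_true] at h4
    rw [h3, ← h4, tsum_mul_left]
    ring
  · rintro ⟨k, n⟩ hx
    rw [if_neg]
    intro h
    exact hx ⟨k, Prod.ext rfl h⟩

/-! ### The contour pairing as a series -/

/-- The coefficients `n! / (r)_n` of the hypergeometric series `₂F₁(1, 1; r; x)`. -/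
def hyperCoeff (r : ℝ) (n : ℕ) : ℂ :=
  (n.factorial : ℂ) * ((ascPochhammer ℂ n).eval (r : ℂ))⁻¹

/-- The function `h⁺` in the coordinate `w = (z - i) / (z + i)` of the unit disc. -/
def plusDisc (r : ℝ) (h : ℍ → ℂ) (w : ℂ) : ℂ := plusFun r h (I * (1 + w) / (1 - w))

theorem hyperCoeff_zero (r : ℝ) : hyperCoeff r 0 = 1 := by simp [hyperCoeff]

theorem ascPochhammer_eval_ne_zero {r : ℝ} (hr : 0 < r) (n : ℕ) :
    (ascPochhammer ℂ n).eval (r : ℂ) ≠ 0 := by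
  have h := ascPochhammer_pos n r hr
  have : (ascPochhammer ℂ n).eval (r : ℂ) = (((ascPochhammer ℝ n).eval r : ℝ) : ℂ) := by
    rw [← ascPochhammer_map (algebraMap ℝ ℂ), Polynomial.eval_map_algebraMap,
      ← Complex.coe_algebraMap, Polynomial.aeval_algebraMap_apply, Polynomial.coe_aeval_eq_eval]
  rw [this]
  exact_mod_cast h.ne'

theorem hyperCoeff_ne_zero {r : ℝ} (hr : 0 < r) (n : ℕ) : hyperCoeff r n ≠ 0 :=
  mul_ne_zero (by exact_mod_cast n.factorial_ne_zero) (inv_ne_zero (ascPochhammer_eval_ne_zero hr n))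

theorem hyperCoeff_succ (r : ℝ) (n : ℕ) :
    hyperCoeff r (n + 1) = hyperCoeff r n * ((n + 1) / (r + n)) := by
  rw [hyperCoeff, hyperCoeff, ascPochhammer_succ_eval, Nat.factorial_succ]
  push_cast
  rw [mul_inv, div_eq_mul_inv]
  ring

/-- In the product of the ratios `(k + 1)/(r + k)`, the factor `k = 0` is `1/r` and the others are
at most `(k + 1)/k`, which telescopes to `n + 1`. -/
theorem norm_hyperCoeff_succ_le {r : ℝ} (hr : 0 < r) (n : ℕ) :
    ‖hyperCoeff r (n + 1)‖ ≤ r⁻¹ * (n + 1) := by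
  have hn : ∀ n : ℕ, ‖((n : ℂ) + 1) / (r + n)‖ = (n + 1) / (r + n) := by
    intro n
    rw [show ((n : ℂ) + 1) / (r + n) = (((n + 1) / (r + n) : ℝ) : ℂ) by push_cast; rfl,
      Complex.norm_real, Real.norm_of_nonneg (by positivity)]
  induction n with
  | zero => rw [hyperCoeff_succ, norm_mul, hn, hyperCoeff_zero]; simp
  | succ n ih =>
    rw [hyperCoeff_succ, norm_mul, hn]
    have h2 : (((n + 1 : ℕ) : ℝ) + 1) / (r + (n + 1 : ℕ)) ≤ (((n + 1 : ℕ) : ℝ) + 1) / (n + 1) := by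
      push_cast
      exact div_le_div_of_nonneg_left (by positivity) (by positivity) (by linarith)
    calc _ ≤ (r⁻¹ * (n + 1)) * ((((n + 1 : ℕ) : ℝ) + 1) / (n + 1)) := by gcongr
      _ = _ := by field_simp

theorem isPolyBounded_hyperCoeff {r : ℝ} (hr : 0 < r) : IsPolyBounded (hyperCoeff r) := by
  refine ⟨1 + r⁻¹, 1, fun n => ?_⟩
  have : 0 < r⁻¹ := inv_pos.2 hr
  cases n with
  | zero => simp [hyperCoeff_zero, this.le]
  | succ n =>
    refine (norm_hyperCoeff_succ_le hr n).trans ?_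
    push_cast
    rw [pow_one]
    gcongr <;> linarith

theorem hasSum_ordinaryHypergeometric {r : ℝ} (hr : 0 < r) {x : ℂ} (hx : ‖x‖ < 1) :
    HasSum (fun n => hyperCoeff r n * x ^ n) (ordinaryHypergeometric (1 : ℂ) (1 : ℂ) (r : ℂ) x) := by
  have h1 : ordinaryHypergeometric (1 : ℂ) (1 : ℂ) (r : ℂ) x = ∑' n, hyperCoeff r n * x ^ n := by
    rw [ordinaryHypergeometric_eq_tsum]
    refine tsum_congr fun n => ?_
    have : (n.factorial : ℂ) ≠ 0 := by exact_mod_cast n.factorial_ne_zero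
    rw [hyperCoeff, ascPochhammer_eval_one, smul_eq_mul, inv_mul_cancel₀ this, one_mul]
  rw [h1]
  refine (Summable.of_norm ?_).hasSum
  simpa [norm_mul, norm_pow] using
    (isPolyBounded_hyperCoeff hr).summable_mul_pow (norm_nonneg x) hx

theorem one_sub_ne_zero_of_norm_lt {w : ℂ} (hw : ‖w‖ < 1) : 1 - w ≠ 0 := by
  intro h
  rw [← sub_eq_zero.1 h] at hw
  simp at hw

theorem upper_add_I {w : ℂ} (hw : 1 - w ≠ 0) : I * (1 + w) / (1 - w) + I = 2 * I / (1 - w) := by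
  field_simp; ring

theorem upper_sub_I {w : ℂ} (hw : 1 - w ≠ 0) :
    I * (1 + w) / (1 - w) - I = 2 * I * w / (1 - w) := by
  field_simp; ring

/-- From `z + i = 2i/(1 - w)` and `dz = 2i dw/(1 - w)²` one gets `dz/(z + i)² = dw/(2i)`. -/
theorem contourPairing_eq {r : ℝ} {h : ℍ → ℂ} {ρ : ℝ} (h0 : 0 < ρ) (h1 : ρ < 1) {s S : ℂ → ℂ}
    (hs : ∀ w : ℂ, ‖w‖ = ρ → s (I * (1 + w) / (1 - w)) = w⁻¹ * S w) :
    contourPairing r h ρ s = (2 * Real.pi * I)⁻¹ * ∮ w in C(0, ρ), S w * plusDisc r h w * w⁻¹ := by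
  rw [contourPairing, contourIntegral]
  have h2 : ∮ w in C(0, ρ), plusFun r h (I * (1 + w) / (1 - w)) * s (I * (1 + w) / (1 - w)) /
      (I * (1 + w) / (1 - w) + I) ^ 2 * (2 * I / (1 - w) ^ 2) =
      ∮ w in C(0, ρ), (2 * I)⁻¹ * (S w * plusDisc r h w * w⁻¹) := by
    refine circleIntegral.integral_congr h0.le fun w hw => ?_
    have hw' : ‖w‖ = ρ := by simpa using hw
    have hne : 1 - w ≠ 0 := one_sub_ne_zero_of_norm_lt (hw'.trans_lt h1)
    have hI := I_ne_zero
    rw [hs w hw', upper_add_I hne, plusDisc]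
    field_simp
  rw [h2, circleIntegral.integral_const_mul]
  have hI := I_ne_zero
  have hpi : (Real.pi : ℂ) ≠ 0 := by exact_mod_cast Real.pi_ne_zero
  field_simp

/-- In the disc coordinates `u` of `τ` and `w` of `z`, the hypergeometric argument is `u/w`, the
measure `dτ/(τ² + 1)` is `du/(2iu)`, and `f⁻(τ)` is `G(u⁻¹)`, because the coordinate used on the
lower half-plane is the inverse of the one used here. The integral then pairs a series in `u⁻¹` with
one in `u`. -/
theorem sigmaOp_eq {r : ℝ} (hr : 0 < r) {G : ℂ → ℂ} {R ρ : ℝ} (hR : 1 < R)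
    (hG : DifferentiableOn ℂ G (ball 0 R)) (hRρ : R⁻¹ < ρ) (hρ1 : ρ < 1) {w : ℂ} (hw : ρ < ‖w‖)
    (hw1 : ‖w‖ < 1) :
    sigmaOp r G ρ (I * (1 + w) / (1 - w)) =
      w⁻¹ * ∑' n, taylorCoeff G n * hyperCoeff r n * w⁻¹ ^ n := by
  have hR0 : 0 < R := one_pos.trans hR
  have hρ0 : 0 < ρ := (inv_pos.2 hR0).trans hRρ
  have hwne : w ≠ 0 := norm_pos_iff.1 (hρ0.trans hw)
  have hw2 : 1 - w ≠ 0 := one_sub_ne_zero_of_norm_lt hw1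
  have hρR : ρ⁻¹ < R := (inv_lt_comm₀ hR0 hρ0).1 hRρ
  have hI := I_ne_zero
  have hpi : (Real.pi : ℂ) ≠ 0 := by exact_mod_cast Real.pi_ne_zero
  rw [sigmaOp, contourIntegral]
  have h1 : ∮ u in C(0, ρ), G ((I * (1 + u) / (1 - u) + I) / (I * (1 + u) / (1 - u) - I)) *
      ordinaryHypergeometric (1 : ℂ) (1 : ℂ) (r : ℂ)
        ((I * (1 + u) / (1 - u) - I) * (I * (1 + w) / (1 - w) + I) /
          ((I * (1 + u) / (1 - u) + I) * (I * (1 + w) / (1 - w) - I))) /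
        ((I * (1 + u) / (1 - u)) ^ 2 + 1) * (2 * I / (1 - u) ^ 2) =
      ∮ u in C(0, ρ), (2 * I)⁻¹ * (G u⁻¹ *
        ordinaryHypergeometric (1 : ℂ) (1 : ℂ) (r : ℂ) (u / w) * u⁻¹) := by
    refine circleIntegral.integral_congr hρ0.le fun u hu => ?_
    have hu' : ‖u‖ = ρ := by simpa using hu
    have hune : u ≠ 0 := norm_pos_iff.1 (hρ0.trans_eq hu'.symm)
    have hne : 1 - u ≠ 0 := one_sub_ne_zero_of_norm_lt (hu'.trans_lt hρ1)
    have e1 : (I * (1 + u) / (1 - u)) ^ 2 + 1 = -4 * u / (1 - u) ^ 2 := by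
      rw [div_pow, mul_pow, I_sq]
      field_simp
      ring
    have e2 : 2 * I / (1 - u) / (2 * I * u / (1 - u)) = u⁻¹ := by field_simp
    have e3 : 2 * I * u / (1 - u) * (2 * I / (1 - w)) / (2 * I / (1 - u) * (2 * I * w / (1 - w))) =
        u / w := by field_simp
    rw [upper_add_I hne, upper_sub_I hne, upper_add_I hw2, upper_sub_I hw2, e1, e2, e3]
    generalize ordinaryHypergeometric (1 : ℂ) (1 : ℂ) (r : ℂ) (u / w) = X
    generalize G u⁻¹ = Y
    have e4 : (2 * I)⁻¹ = -I / 2 := by rw [mul_inv, inv_I]; ring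
    rw [e4]
    field_simp
    norm_num
  have hs1 : Summable fun n => ‖taylorCoeff G n‖ * ρ⁻¹ ^ n := by
    have := (hasSum_taylorCoeff hG (W := ((ρ⁻¹ : ℝ) : ℂ))
      (by simpa [abs_of_pos hρ0] using hρR)).summable.norm
    simpa [abs_of_pos hρ0] using this
  have hs2 : Summable fun n => ‖hyperCoeff r n * w⁻¹ ^ n‖ * ρ ^ n := by
    have := (isPolyBounded_hyperCoeff hr).summable_mul_pow (ρ := ρ / ‖w‖) (by positivity)
      ((div_lt_one (hρ0.trans hw)).2 hw)
    refine this.congr fun n => ?_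
    rw [norm_mul, norm_pow, norm_inv, div_pow, inv_pow]
    ring
  rw [h1, circleIntegral.integral_const_mul,
    circleIntegral_mul_of_hasSum (F := fun u => G u⁻¹)
      (Q := fun u => ordinaryHypergeometric (1 : ℂ) (1 : ℂ) (r : ℂ) (u / w)) hρ0 hs1 hs2,
    upper_add_I hw2, upper_sub_I hw2]
  · simp only [← mul_assoc]
    field_simp
  · intro u hu
    exact hasSum_taylorCoeff hG (by simpa [hu] using hρR)
  · intro u hu
    have : ‖u / w‖ < 1 := by
      rw [norm_div, hu]
      exact (div_lt_one (hρ0.trans hw)).2 hw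
    convert! hasSum_ordinaryHypergeometric hr this using 2 with n
    rw [div_eq_mul_inv, mul_pow]
    ring

/-- The contour pairing is the diagonal series in the Taylor coefficients. -/
theorem contourPairing_sigmaOp {r : ℝ} (hr : 0 < r) {h : ℍ → ℂ} {G : ℂ → ℂ} {R ρ₁ ρ₂ : ℝ}
    (hR : 1 < R) (hG : DifferentiableOn ℂ G (ball 0 R))
    (hh : DifferentiableOn ℂ (plusDisc r h) (ball 0 1)) (h1 : R⁻¹ < ρ₁) (h2 : ρ₁ < ρ₂)
    (h3 : ρ₂ < 1) :
    contourPairing r h ρ₂ (sigmaOp r G ρ₁) =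
      ∑' n, hyperCoeff r n * taylorCoeff (plusDisc r h) n * taylorCoeff G n := by
  have hR0 : 0 < R := one_pos.trans hR
  have hρ1 : 0 < ρ₁ := (inv_pos.2 hR0).trans h1
  have hρ2 : 0 < ρ₂ := hρ1.trans h2
  have hpi : (Real.pi : ℂ) ≠ 0 := by exact_mod_cast Real.pi_ne_zero
  have hI := I_ne_zero
  have hs2 : Summable fun n => ‖taylorCoeff (plusDisc r h) n‖ * ρ₂ ^ n := by
    have := (hasSum_taylorCoeff hh (W := ((ρ₂ : ℝ) : ℂ))
      (by simpa [abs_of_pos hρ2] using h3)).summable.norm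
    simpa [abs_of_pos hρ2] using this
  -- Split `ρ₂⁻ⁿ = ρ₁⁻ⁿ (ρ₁/ρ₂)ⁿ`: the first power is absorbed by `G`, as `ρ₁⁻¹ < R`, and the second
  -- beats the growth of the hypergeometric coefficients.
  have hs1 : Summable fun n => ‖taylorCoeff G n * hyperCoeff r n‖ * ρ₂⁻¹ ^ n := by
    have h4 : ρ₁⁻¹ < R := (inv_lt_comm₀ hR0 hρ1).1 h1
    have h5 := (hasSum_taylorCoeff hG (W := ((ρ₁⁻¹ : ℝ) : ℂ))
      (by simpa [abs_of_pos hρ1] using h4)).summable.norm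
    have h6 := (isPolyBounded_hyperCoeff hr).summable_mul_pow (ρ := ρ₁ / ρ₂) (by positivity)
      ((div_lt_one hρ2).2 h2)
    have h7 := h5.mul_of_nonneg h6 (fun _ => norm_nonneg _) (fun _ => by positivity)
    have h8 := h7.comp_injective (i := fun n : ℕ => (n, n)) fun a b h => (Prod.ext_iff.1 h).1
    refine h8.congr fun n => ?_
    simp only [Function.comp_apply, norm_mul, norm_pow, Complex.norm_real, norm_inv,
      Real.norm_of_nonneg hρ1.le, div_pow, inv_pow]
    field_simp
  rw [contourPairing_eq hρ2 h3 (S := fun w => ∑' n, taylorCoeff G n * hyperCoeff r n * w⁻¹ ^ n)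
    fun w hw => sigmaOp_eq hr hR hG h1 (h2.trans h3) (by rwa [hw]) (by rwa [hw]),
    circleIntegral_mul_of_hasSum (Q := plusDisc r h) hρ2 hs1 hs2]
  · rw [← mul_assoc, inv_mul_cancel₀ (by simp [hpi]), one_mul]
    exact tsum_congr fun n => by ring
  · intro u hu
    refine (Summable.of_norm (hs1.congr fun n => ?_)).hasSum
    rw [norm_mul _ (u⁻¹ ^ n), norm_pow, norm_inv, hu]
  · intro u hu
    exact hasSum_taylorCoeff hh (by simpa [hu] using h3)

/-- The contour integral that defines the form of weight zero picks out the value at `i`. -/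
theorem contourPairing_inv {r : ℝ} {h : ℍ → ℂ} {ρ : ℝ} (h0 : 0 < ρ) (h1 : ρ < 1)
    (hh : DifferentiableOn ℂ (plusDisc r h) (ball 0 1)) (d : ℂ) :
    contourPairing r h ρ (fun z => d * ((z - I) / (z + I))⁻¹) = d * plusDisc r h 0 := by
  have hpi : (Real.pi : ℂ) ≠ 0 := by exact_mod_cast Real.pi_ne_zero
  have hI := I_ne_zero
  have hs2 : Summable fun n => ‖taylorCoeff (plusDisc r h) n‖ * ρ ^ n := by
    have := (hasSum_taylorCoeff hh (W := ((ρ : ℝ) : ℂ))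
      (by simpa [abs_of_pos h0] using h1)).summable.norm
    simpa [abs_of_pos h0] using this
  have hz : ∀ n : ℕ, n ≠ 0 → (if n = 0 then d else 0) = 0 := fun n hn => if_neg hn
  rw [contourPairing_eq h0 h1 (S := fun _ => d),
    circleIntegral_mul_of_hasSum (p := fun n => if n = 0 then d else 0) (F := fun _ => d)
      (Q := plusDisc r h) h0 ?_ hs2,
    tsum_eq_single 0 fun n hn => by rw [hz n hn, zero_mul], if_pos rfl, ← mul_assoc,
    inv_mul_cancel₀ (by simp [hpi]), one_mul]
  · simp [taylorCoeff]
  · intro u _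
    have := hasSum_single (f := fun n : ℕ => (if n = 0 then d else 0) * u⁻¹ ^ n) 0
      fun n hn => by rw [hz n hn, zero_mul]
    simpa using this
  · intro u hu
    exact hasSum_taylorCoeff hh (by simpa [hu] using h1)
  · refine summable_of_ne_finset_zero (s := {0}) fun n hn => ?_
    rw [hz n (by simpa using hn), norm_zero, zero_mul]
  · intro w hw
    have hne : 1 - w ≠ 0 := one_sub_ne_zero_of_norm_lt (hw.trans_lt h1)
    have hw0 : w ≠ 0 := norm_pos_iff.1 (h0.trans_eq hw.symm)
    rw [upper_add_I hne, upper_sub_I hne]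
    field_simp

/-! ### The disc coordinate on the lower half-plane -/

theorem sub_one_ne_zero_of_mem_ball {W : ℂ} (hW : W ∈ ball (0 : ℂ) 1) : W - 1 ≠ 0 := by
  rw [← neg_ne_zero, neg_sub]
  exact one_sub_ne_zero_of_norm_lt (by simpa using hW)

theorem im_lowerOfDisc_neg {W : ℂ} (hW : W ∈ ball (0 : ℂ) 1) : (I * (W + 1) / (W - 1)).im < 0 := by
  have hne := sub_one_ne_zero_of_mem_ball hW
  have h1 : 0 < normSq (W - 1) := normSq_pos.2 hne
  have h2 : normSq W < 1 := by
    rw [normSq_eq_norm_sq]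
    have : ‖W‖ < 1 := by simpa using hW
    nlinarith [norm_nonneg W]
  have h3 : (I * (W + 1) / (W - 1)).im = (normSq W - 1) / normSq (W - 1) := by
    rw [div_im]
    simp only [mul_im, mul_re, I_re, I_im, add_re, add_im, one_re, one_im, sub_re, sub_im]
    rw [← sub_div]
    congr 1
    rw [normSq_apply]
    ring
  rw [h3]
  exact div_neg_of_neg_of_pos (by linarith) h1

theorem sub_I_ne_zero_of_im_neg {t : ℂ} (ht : t.im < 0) : t - I ≠ 0 := by
  intro h
  rw [sub_eq_zero.1 h, I_im] at ht
  linarith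

theorem discOfLower_mem_ball {t : ℂ} (ht : t.im < 0) : (t + I) / (t - I) ∈ ball (0 : ℂ) 1 := by
  have hne := sub_I_ne_zero_of_im_neg ht
  rw [mem_ball_zero_iff, norm_div, div_lt_one (norm_pos_iff.2 hne)]
  refine lt_of_pow_lt_pow_left₀ 2 (norm_nonneg _) ?_
  rw [← normSq_eq_norm_sq, ← normSq_eq_norm_sq, normSq_apply, normSq_apply]
  simp only [add_re, add_im, sub_re, sub_im, I_re, I_im]
  nlinarith

theorem lowerOfDisc_discOfLower {t : ℂ} (ht : t.im < 0) :
    I * ((t + I) / (t - I) + 1) / ((t + I) / (t - I) - 1) = t := by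
  have hne := sub_I_ne_zero_of_im_neg ht
  have hI := I_ne_zero
  have h1 : (t + I) / (t - I) + 1 = 2 * t / (t - I) := by field_simp; ring
  have h2 : (t + I) / (t - I) - 1 = 2 * I / (t - I) := by field_simp; ring
  rw [h1, h2]
  field_simp

theorem discOfLower_lowerOfDisc {W : ℂ} (hW : W - 1 ≠ 0) :
    (I * (W + 1) / (W - 1) + I) / (I * (W + 1) / (W - 1) - I) = W := by
  have hI := I_ne_zero
  have h1 : I * (W + 1) / (W - 1) + I = 2 * I * W / (W - 1) := by field_simp; ring
  have h2 : I * (W + 1) / (W - 1) - I = 2 * I / (W - 1) := by field_simp; ring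
  rw [h1, h2]
  field_simp

theorem im_I_sub_pos {t : ℂ} (ht : t.im < 0) : 0 < (I - t).im := by
  simp only [sub_im, I_im]; linarith

theorem I_sub_ne_zero {t : ℂ} (ht : t.im < 0) : I - t ≠ 0 := by
  rw [← neg_ne_zero, neg_sub]
  exact sub_I_ne_zero_of_im_neg ht

theorem mem_slitPlane_of_im_pos {z : ℂ} (hz : 0 < z.im) : z ∈ slitPlane :=
  Or.inr hz.ne'

/-- The function on the lower half-plane with `f⁻ = G` in the disc coordinate. -/
def ofDisc (r : ℝ) (G : ℂ → ℂ) (t : LowerHalfPlane) : ℂ :=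
  (I - (t : ℂ)) ^ (-(r : ℂ)) * G (((t : ℂ) + I) / ((t : ℂ) - I))

theorem discFun_eq {r : ℝ} {f : LowerHalfPlane → ℂ} {W : ℂ} (hW : W ∈ ball (0 : ℂ) 1) :
    discFun r f W = (I - I * (W + 1) / (W - 1)) ^ (r : ℂ) * f ⟨_, im_lowerOfDisc_neg hW⟩ := by
  rw [discFun, extendZero, dif_pos (im_lowerOfDisc_neg hW)]

theorem discFun_ofDisc {r : ℝ} {G : ℂ → ℂ} {W : ℂ} (hW : W ∈ ball (0 : ℂ) 1) :
    discFun r (ofDisc r G) W = G W := by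
  rw [discFun_eq hW, ofDisc, discOfLower_lowerOfDisc (sub_one_ne_zero_of_mem_ball hW), ← mul_assoc,
    cpow_neg, mul_inv_cancel₀, one_mul]
  exact cpow_ne_zero_iff.2 (Or.inl (I_sub_ne_zero (im_lowerOfDisc_neg hW)))

/-- The power `(i - t)^r` never vanishes, so `f` is recovered from `f⁻`. Membership in the smooth
module thereby becomes a question about functions on the disc. -/
theorem eq_ofDisc {r : ℝ} {f : LowerHalfPlane → ℂ} {G : ℂ → ℂ}
    (h : Set.EqOn (discFun r f) G (ball 0 1)) : f = ofDisc r G := by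
  funext t
  have hW := discOfLower_mem_ball t.2
  rw [ofDisc, ← h hW, discFun_eq hW, ← mul_assoc, cpow_neg]
  simp only [lowerOfDisc_discOfLower t.2]
  rw [inv_mul_cancel₀ (cpow_ne_zero_iff.2 (Or.inl (I_sub_ne_zero t.2))), one_mul]

theorem ofDisc_mem_smoothSubmodule (r : ℝ) {G : ℂ → ℂ} (h1 : DifferentiableOn ℂ G (ball 0 1))
    (h2 : ContDiffOn ℝ ∞ G (closedBall 0 1)) : ofDisc r G ∈ smoothSubmodule r := by
  refine ⟨?_, G, h2, fun W hW => discFun_ofDisc hW⟩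
  have h3 : DifferentiableOn ℂ (fun t => (I - t) ^ (-(r : ℂ)) * G ((t + I) / (t - I)))
      {t : ℂ | t.im < 0} := by
    refine DifferentiableOn.mul (fun t ht => ?_) (h1.comp (fun t ht => ?_) fun t ht =>
      discOfLower_mem_ball ht)
    · exact ((differentiableAt_id.const_sub I).cpow_const (mem_slitPlane_of_im_pos
        (im_I_sub_pos ht))).differentiableWithinAt
    · exact ((differentiableAt_id.add_const I).div (differentiableAt_id.sub_const I)
        (sub_I_ne_zero_of_im_neg ht)).differentiableWithinAt
  refine h3.congr fun t ht => ?_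
  have ht' : t.im < 0 := ht
  rw [extendZero, dif_pos ht', ofDisc]

theorem differentiableOn_discFun {r : ℝ} {f : LowerHalfPlane → ℂ} (hf : f ∈ smoothSubmodule r) :
    DifferentiableOn ℂ (discFun r f) (ball 0 1) := by
  have h1 : DifferentiableOn ℂ (fun W : ℂ => I * (W + 1) / (W - 1)) (ball 0 1) :=
    DifferentiableOn.div (by fun_prop) (by fun_prop) fun W hW => sub_one_ne_zero_of_mem_ball hW
  refine DifferentiableOn.mul (fun W hW => ?_) (hf.1.comp h1 fun W hW => im_lowerOfDisc_neg hW)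
  exact ((h1 W hW).const_sub I).cpow_const
    (mem_slitPlane_of_im_pos (im_I_sub_pos (im_lowerOfDisc_neg hW)))

/-! ### Boundary values -/

theorem norm_exp_boundary (θ : ℝ) : ‖exp (-2 * I * θ)‖ = 1 := by
  rw [show -2 * I * (θ : ℂ) = ((-2 * θ : ℝ) : ℂ) * I by push_cast; ring]
  exact norm_exp_ofReal_mul_I _

theorem boundaryFun_eq {r : ℝ} {f : LowerHalfPlane → ℂ} {G : ℂ → ℂ}
    (hG : ContinuousOn G (closedBall 0 1)) (h : Set.EqOn (discFun r f) G (ball 0 1)) (θ : ℝ) :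
    boundaryFun r f θ = G (exp (-2 * I * θ)) := by
  have hmem : exp (-2 * I * θ) ∈ closedBall (0 : ℂ) 1 := by
    rw [mem_closedBall_zero_iff, norm_exp_boundary]
  refine extendFrom_eq (by rwa [closure_ball _ one_ne_zero]) ?_
  refine Filter.Tendsto.congr' ?_ ((hG _ hmem).mono ball_subset_closedBall)
  filter_upwards [self_mem_nhdsWithin] with W hW using (h hW).symm

theorem contDiff_boundaryFun {r : ℝ} {f : LowerHalfPlane → ℂ} (hf : f ∈ smoothSubmodule r) :
    ContDiff ℝ ∞ (boundaryFun r f) := by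
  obtain ⟨-, G, hG, h⟩ := hf
  rw [show boundaryFun r f = fun θ : ℝ => G (exp (-2 * I * θ)) from
    funext fun θ => boundaryFun_eq hG.continuousOn h θ]
  refine hG.comp_contDiff (f := fun θ : ℝ => exp (-2 * I * θ)) ?_ fun θ => ?_
  · exact (contDiff_const.mul ofRealCLM.contDiff).cexp
  · rw [mem_closedBall_zero_iff, norm_exp_boundary]

theorem boundaryFun_sub {r : ℝ} {f g : LowerHalfPlane → ℂ} (hf : f ∈ smoothSubmodule r)
    (hg : g ∈ smoothSubmodule r) : boundaryFun r (f - g) = boundaryFun r f - boundaryFun r g := by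
  obtain ⟨-, F, hF, h⟩ := hf
  obtain ⟨-, G, hG, h'⟩ := hg
  funext θ
  rw [Pi.sub_apply, boundaryFun_eq hF.continuousOn h, boundaryFun_eq hG.continuousOn h',
    boundaryFun_eq (hF.sub hG).continuousOn (fun W hW => ?_)]
  change _ = F W - G W
  rw [← h hW, ← h' hW, discFun_eq hW, discFun_eq hW, discFun_eq hW, Pi.sub_apply]
  ring

/-- Integration by parts `k` times; periodicity cancels the boundary terms. -/
theorem integral_exp_mul_iteratedDeriv {ψ : ℝ → ℂ} (hψ : ContDiff ℝ ∞ ψ)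
    (hper : Function.Periodic ψ (2 * Real.pi)) (n k : ℕ) :
    ∫ θ in (0 : ℝ)..2 * Real.pi, exp (-(n * I) * θ) * iteratedDeriv k ψ θ =
      (n * I) ^ k * ∫ θ in (0 : ℝ)..2 * Real.pi, exp (-(n * I) * θ) * ψ θ := by
  induction k generalizing ψ with
  | zero => simp
  | succ k ih =>
    have h1 : ContDiff ℝ ∞ (deriv ψ) := (contDiff_infty_iff_deriv.1 hψ).2
    have h2 : Function.Periodic (deriv ψ) (2 * Real.pi) := by
      intro θ
      rw [← deriv_comp_add_const, show (fun x => ψ (x + 2 * Real.pi)) = ψ from funext hper]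
    rw [iteratedDeriv_succ', ih h1 h2, pow_succ, mul_assoc]
    congr 1
    have h3 : ∀ θ : ℝ, HasDerivAt (fun θ : ℝ => exp (-(n * I) * θ))
        (exp (-(n * I) * θ) * (-(n * I))) θ := by
      intro θ
      have := ((hasDerivAt_id (θ : ℂ)).const_mul (-(n * I))).cexp.comp_ofReal
      simpa using this
    rw [intervalIntegral.integral_mul_deriv_eq_deriv_mul (fun θ _ => h3 θ)
      (fun θ _ => ((hψ.differentiable (by simp)) θ).hasDerivAt)
      (Continuous.intervalIntegrable (by fun_prop) _ _) (h1.continuous.intervalIntegrable _ _)]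
    have h4 : exp (-(n * I) * ((2 * Real.pi : ℝ) : ℂ)) = 1 := by
      rw [show -(n * I) * ((2 * Real.pi : ℝ) : ℂ) = ((-n : ℤ) : ℂ) * (2 * Real.pi * I) by
        push_cast; ring]
      exact exp_int_mul_two_pi_mul_I _
    have h5 : ψ (2 * Real.pi) = ψ 0 := by simpa using hper 0
    rw [h4, h5, ← intervalIntegral.integral_const_mul]
    simp only [ofReal_zero, mul_zero, exp_zero, sub_self, zero_sub]
    rw [← intervalIntegral.integral_neg]
    refine intervalIntegral.integral_congr fun θ _ => ?_
    ring

/-- The Taylor coefficients of `f⁻` in the disc coordinate. -/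
def coef (r : ℝ) (f : LowerHalfPlane → ℂ) (n : ℕ) : ℂ := taylorCoeff (discFun r f) n

/-- Cauchy's formula on the unit circle itself, allowed because the extension is continuous on the
closed disc. The boundary parameter satisfies `W = e^(-2iθ)`, so the substitution `-θ/2` gives the
standard parametrisation. -/
theorem coef_eq_integral {r : ℝ} {f : LowerHalfPlane → ℂ} (hf : f ∈ smoothSubmodule r) (n : ℕ) :
    2 * Real.pi * coef r f n = ∫ θ in (0 : ℝ)..2 * Real.pi,
      exp (-(n * I) * θ) * boundaryFun r f (-(1 / 2) * θ) := by
  have hd := differentiableOn_discFun hf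
  obtain ⟨-, G, hG, h⟩ := hf
  have h1 : DiffContOnCl ℂ G (ball 0 1) :=
    ⟨hd.congr fun W hW => (h hW).symm, by
      rw [closure_ball _ one_ne_zero]; exact hG.continuousOn⟩
  have h2 := h1.circleIntegral_one_div_sub_center_pow_smul one_pos n
  have h3 : 2 * Real.pi * coef r f n * I = (2 * Real.pi * I / n.factorial) • iteratedDeriv n G 0 := by
    rw [coef, taylorCoeff_congr one_pos h, taylorCoeff, smul_eq_mul]
    ring
  have h4 : (∫ θ in (0 : ℝ)..2 * Real.pi,
      exp (-(n * I) * θ) * boundaryFun r f (-(1 / 2) * θ)) * I =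
      ∮ z in C(0, 1), (1 / (z - 0) ^ (n + 1)) • G z := by
    rw [circleIntegral, mul_comm, ← intervalIntegral.integral_const_mul]
    refine intervalIntegral.integral_congr fun θ _ => ?_
    have h5 : circleMap 0 1 θ = exp (θ * I) := by simp [circleMap]
    simp only [deriv_circleMap, smul_eq_mul, sub_zero]
    rw [boundaryFun_eq hG.continuousOn h, h5,
      show -2 * I * ((-(1 / 2) * θ : ℝ) : ℂ) = θ * I by push_cast; ring, pow_succ,
      ← Complex.exp_nat_mul, show -(n * I) * (θ : ℂ) = -(n * (θ * I)) by ring, exp_neg]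
    have := exp_ne_zero (θ * I)
    field_simp
  exact mul_right_cancel₀ I_ne_zero (h3.trans (h2.symm.trans h4.symm))

/-- The `k` integrations by parts give `n^k`, and rescaling the parameter by `-1/2` gives the extra
`2^k`. -/
theorem norm_coef_mul_pow_le {r : ℝ} {f : LowerHalfPlane → ℂ} (hf : f ∈ smoothSubmodule r) {k : ℕ}
    {M : ℝ} (hM : ∀ θ, ‖iteratedDeriv k (boundaryFun r f) θ‖ ≤ M) (n : ℕ) :
    ‖coef r f n‖ * (2 * n) ^ k ≤ M := by
  have hβ := contDiff_boundaryFun hf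
  set ψ : ℝ → ℂ := fun θ => boundaryFun r f (-(1 / 2) * θ) with hψ
  have h1 : ContDiff ℝ ∞ ψ := hβ.comp (contDiff_const.mul contDiff_id)
  have h2 : Function.Periodic ψ (2 * Real.pi) := by
    intro θ
    obtain ⟨-, G, hG, h⟩ := hf
    simp only [hψ, boundaryFun_eq hG.continuousOn h]
    congr 1
    rw [show -2 * I * ((-(1 / 2) * (θ + 2 * Real.pi) : ℝ) : ℂ) =
      -2 * I * ((-(1 / 2) * θ : ℝ) : ℂ) + 2 * Real.pi * I by push_cast; ring, exp_periodic]
  have h3 : ∀ θ, ‖iteratedDeriv k ψ θ‖ ≤ (1 / 2) ^ k * M := by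
    intro θ
    have := congrFun (iteratedDeriv_comp_const_smul (n := k) (hβ.of_le (by exact_mod_cast le_top))
      (-(1 / 2) : ℝ)) θ
    rw [hψ, this, norm_smul, norm_pow, norm_neg]
    gcongr
    · norm_num
    · exact hM _
  have h4 := integral_exp_mul_iteratedDeriv h1 h2 n k
  rw [← coef_eq_integral hf] at h4
  have h5 : ‖∫ θ in (0 : ℝ)..2 * Real.pi, exp (-(n * I) * θ) * iteratedDeriv k ψ θ‖ ≤
      (1 / 2) ^ k * M * |2 * Real.pi - 0| := by
    refine intervalIntegral.norm_integral_le_of_norm_le_const fun θ _ => ?_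
    rw [norm_mul, show -(n * I) * (θ : ℂ) = ((-n * θ : ℝ) : ℂ) * I by push_cast; ring,
      norm_exp_ofReal_mul_I, one_mul]
    exact h3 θ
  have hpi := Real.pi_pos
  rw [h4, sub_zero, abs_of_pos (by positivity), norm_mul, norm_mul, norm_pow, norm_mul,
    Complex.norm_natCast, norm_I, norm_mul, Complex.norm_real, Complex.norm_ofNat,
    Real.norm_of_nonneg hpi.le, mul_one] at h5
  rw [mul_pow]
  have h6 : (n : ℝ) ^ k * ‖coef r f n‖ ≤ (1 / 2) ^ k * M := by
    refine le_of_mul_le_mul_right ?_ (show 0 < 2 * Real.pi by positivity)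
    linarith
  calc ‖coef r f n‖ * (2 ^ k * n ^ k) = 2 ^ k * (n ^ k * ‖coef r f n‖) := by ring
    _ ≤ 2 ^ k * ((1 / 2) ^ k * M) := by gcongr
    _ = M := by rw [← mul_assoc, ← mul_pow]; norm_num

/-- For `n ≥ 1` the factor `2` pays for `n + 1 ≤ 2n`. At `n = 0` the derivative bound says nothing
for `k > 0`, hence the sup bound as a second hypothesis. -/
theorem norm_coef_mul_add_one_pow_le {r : ℝ} {f : LowerHalfPlane → ℂ} (hf : f ∈ smoothSubmodule r)
    {k : ℕ} {M : ℝ} (h0 : ∀ θ, ‖boundaryFun r f θ‖ ≤ M)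
    (hM : ∀ θ, ‖iteratedDeriv k (boundaryFun r f) θ‖ ≤ M) (n : ℕ) :
    ‖coef r f n‖ * (n + 1) ^ k ≤ M := by
  cases n with
  | zero => simpa using norm_coef_mul_pow_le hf (k := 0) (by simpa using h0) 0
  | succ n =>
    refine le_trans ?_ (norm_coef_mul_pow_le hf hM (n + 1))
    gcongr
    push_cast
    linarith

/-- The boundary function is smooth and `π`-periodic, so each of its derivatives is bounded. -/
theorem isRapidlyDecaying_coef {r : ℝ} {f : LowerHalfPlane → ℂ} (hf : f ∈ smoothSubmodule r) :
    IsRapidlyDecaying (coef r f) := by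
  intro k
  have hper : Function.Periodic (boundaryFun r f) Real.pi := by
    intro θ
    obtain ⟨-, G, hG, h⟩ := hf
    rw [boundaryFun_eq hG.continuousOn h, boundaryFun_eq hG.continuousOn h]
    congr 1
    rw [show -2 * I * ((θ + Real.pi : ℝ) : ℂ) = -2 * I * θ - 2 * Real.pi * I by push_cast; ring,
      exp_periodic.sub_eq]
  have hb : ∀ j : ℕ, ∃ M, ∀ θ, ‖iteratedDeriv j (boundaryFun r f) θ‖ ≤ M := by
    intro j
    have hc : Continuous (iteratedDeriv j (boundaryFun r f)) :=
      (contDiff_boundaryFun hf).continuous_iteratedDeriv j (by exact_mod_cast le_top)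
    have hp : Function.Periodic (iteratedDeriv j (boundaryFun r f)) Real.pi := by
      intro θ
      have := congrFun (iteratedDeriv_comp_add_const j (boundaryFun r f) Real.pi) θ
      rw [← this, show (fun x => boundaryFun r f (x + Real.pi)) = boundaryFun r f from funext hper]
    obtain ⟨M, hM⟩ := isBounded_iff_forall_norm_le.1 (hp.isBounded_of_continuous Real.pi_ne_zero hc)
    exact ⟨M, fun θ => hM _ ⟨θ, rfl⟩⟩
  obtain ⟨M, hM⟩ := hb 0
  obtain ⟨N, hN⟩ := hb k
  exact ⟨max M N, fun n => norm_coef_mul_add_one_pow_le hf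
    (fun θ => (by simpa using hM θ : _ ≤ M).trans (le_max_left _ _))
    (fun θ => (hN θ).trans (le_max_right _ _)) n⟩

theorem hasSum_coef {r : ℝ} {f : LowerHalfPlane → ℂ} (hf : f ∈ smoothSubmodule r) {W : ℂ}
    (hW : W ∈ ball (0 : ℂ) 1) : HasSum (fun n => coef r f n * W ^ n) (discFun r f W) :=
  hasSum_taylorCoeff (differentiableOn_discFun hf) hW

theorem coef_ofDisc {r : ℝ} {G : ℂ → ℂ} (n : ℕ) : coef r (ofDisc r G) n = taylorCoeff G n :=
  taylorCoeff_congr one_pos (fun _ hW => discFun_ofDisc hW) n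

theorem coef_add {r : ℝ} {f g : LowerHalfPlane → ℂ} (hf : f ∈ smoothSubmodule r)
    (hg : g ∈ smoothSubmodule r) (n : ℕ) : coef r (f + g) n = coef r f n + coef r g n := by
  refine taylorCoeff_eq_of_hasSum (a := fun n => coef r f n + coef r g n) one_pos
    (fun W hW => ?_) n
  convert! (hasSum_coef hf hW).add (hasSum_coef hg hW) using 1
  · funext n; ring
  · rw [discFun_eq hW, discFun_eq hW, discFun_eq hW, Pi.add_apply, mul_add]

theorem coef_smul {r : ℝ} {f : LowerHalfPlane → ℂ} (hf : f ∈ smoothSubmodule r) (a : ℂ) (n : ℕ) :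
    coef r (a • f) n = a * coef r f n := by
  refine taylorCoeff_eq_of_hasSum (a := fun n => a * coef r f n) one_pos (fun W hW => ?_) n
  convert! (hasSum_coef hf hW).mul_left a using 1
  · funext n; ring
  · rw [discFun_eq hW, discFun_eq hW, Pi.smul_apply, smul_eq_mul]; ring

/-! ### Continuous functionals -/

theorem SmoothModule.toFun_mem {r : ℝ} (f : SmoothModule r) : f.toFun ∈ smoothSubmodule r := f.2

theorem SmoothModule.tendsto_iff {r : ℝ} {ι : Type*} {l : Filter ι} {u : ι → SmoothModule r}
    {f : SmoothModule r} : Tendsto u l (𝓝 f) ↔ ∀ k : ℕ, TendstoUniformly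
      (fun i => iteratedDeriv k (boundaryFun r (u i).toFun))
      (iteratedDeriv k (boundaryFun r f.toFun)) l := by
  rw [nhds_induced, tendsto_comap_iff, tendsto_pi_nhds]
  exact forall_congr' fun k => UniformFun.tendsto_iff_tendstoUniformly

/-- The linear form `f ↦ ∑ lₙ aₙ(f)`, where `aₙ(f)` are the Taylor coefficients of `f⁻`. -/
def seqForm (r : ℝ) (l : ℕ → ℂ) (f : LowerHalfPlane → ℂ) : ℂ := ∑' n, l n * coef r f n

theorem hasSum_seqForm {r : ℝ} {l : ℕ → ℂ} (hl : IsPolyBounded l) {f : LowerHalfPlane → ℂ}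
    (hf : f ∈ smoothSubmodule r) : HasSum (fun n => l n * coef r f n) (seqForm r l f) :=
  (Summable.of_norm (hl.summable_norm_mul (isRapidlyDecaying_coef hf))).hasSum

theorem seqForm_add {r : ℝ} {l : ℕ → ℂ} (hl : IsPolyBounded l) {f g : LowerHalfPlane → ℂ}
    (hf : f ∈ smoothSubmodule r) (hg : g ∈ smoothSubmodule r) :
    seqForm r l (f + g) = seqForm r l f + seqForm r l g := by
  refine HasSum.tsum_eq ?_
  convert! (hasSum_seqForm hl hf).add (hasSum_seqForm hl hg) using 2 with n
  rw [coef_add hf hg, mul_add]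

theorem seqForm_smul {r : ℝ} {l : ℕ → ℂ} (hl : IsPolyBounded l) {f : LowerHalfPlane → ℂ}
    (hf : f ∈ smoothSubmodule r) (a : ℂ) : seqForm r l (a • f) = a * seqForm r l f := by
  refine HasSum.tsum_eq ?_
  convert! (hasSum_seqForm hl hf).mul_left a using 2 with n
  rw [coef_smul hf]
  ring

theorem seqForm_sub {r : ℝ} {l : ℕ → ℂ} (hl : IsPolyBounded l) {f g : LowerHalfPlane → ℂ}
    (hf : f ∈ smoothSubmodule r) (hg : g ∈ smoothSubmodule r) :
    seqForm r l (f - g) = seqForm r l f - seqForm r l g := by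
  rw [sub_eq_add_neg, ← neg_one_smul ℂ g, seqForm_add hl hf (Submodule.smul_mem _ _ hg),
    seqForm_smul hl hg]
  ring

/-- The form `seqForm` is bounded by two of the seminorms that define the topology. -/
theorem exists_norm_seqForm_le (r : ℝ) {l : ℕ → ℂ} (hl : IsPolyBounded l) :
    ∃ (B : ℝ) (k : ℕ), 0 < B ∧ ∀ f ∈ smoothSubmodule r, ∀ M : ℝ,
      (∀ θ, ‖boundaryFun r f θ‖ ≤ M) → (∀ θ, ‖iteratedDeriv k (boundaryFun r f) θ‖ ≤ M) →
      ‖seqForm r l f‖ ≤ B * M := by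
  obtain ⟨C, K, hC⟩ := hl
  have hs := summable_inv_add_one_sq
  have hC0 : 0 ≤ C := by simpa using (norm_nonneg _).trans (hC 0)
  -- Two derivatives beyond the growth exponent of `l` make the series converge. The `+ 1` only
  -- ensures that the constant is strictly positive.
  refine ⟨C * ∑' n : ℕ, (((n : ℝ) + 1) ^ 2)⁻¹ + 1, K + 2, ?_, fun f hf M h0 hM => ?_⟩
  · have : 0 ≤ ∑' n : ℕ, (((n : ℝ) + 1) ^ 2)⁻¹ := tsum_nonneg fun n => by positivity
    positivity
  have hM0 : 0 ≤ M := (norm_nonneg _).trans (h0 0)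
  have h1 : ‖seqForm r l f‖ ≤ C * M * ∑' n : ℕ, (((n : ℝ) + 1) ^ 2)⁻¹ := by
    refine tsum_of_norm_bounded (hs.hasSum.mul_left (C * M)) fun n => ?_
    have h2 := norm_coef_mul_add_one_pow_le hf h0 hM n
    rw [norm_mul, ← div_eq_mul_inv, le_div_iff₀ (by positivity)]
    calc ‖l n‖ * ‖coef r f n‖ * (n + 1) ^ 2 ≤ C * (n + 1) ^ K * ‖coef r f n‖ * (n + 1) ^ 2 := by
          gcongr; exact hC n
      _ = C * (‖coef r f n‖ * (n + 1) ^ (K + 2)) := by ring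
      _ ≤ C * M := by gcongr
  refine h1.trans ?_
  rw [add_mul, one_mul]
  linarith [mul_right_comm C M (∑' n : ℕ, (((n : ℝ) + 1) ^ 2)⁻¹)]

theorem continuous_seqForm (r : ℝ) {l : ℕ → ℂ} (hl : IsPolyBounded l) :
    Continuous fun f : SmoothModule r => seqForm r l f.toFun := by
  obtain ⟨B, k, hB, h⟩ := exists_norm_seqForm_le r hl
  refine continuous_iff_continuousAt.2 fun f => Metric.tendsto_nhds.2 fun ε hε => ?_
  have h1 := SmoothModule.tendsto_iff.1 (tendsto_id (x := 𝓝 f))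
  have h2 := fun j => Metric.tendstoUniformly_iff.1 (h1 j) (ε / (2 * B)) (by positivity)
  filter_upwards [h2 0, h2 k] with g hg0 hgk
  have h3 : ∀ j, (∀ θ, dist (iteratedDeriv j (boundaryFun r f.toFun) θ)
      (iteratedDeriv j (boundaryFun r (id g).toFun) θ) < ε / (2 * B)) →
      ∀ θ, ‖iteratedDeriv j (boundaryFun r (g.toFun - f.toFun)) θ‖ ≤ ε / (2 * B) := by
    intro j hj θ
    rw [boundaryFun_sub g.toFun_mem f.toFun_mem, iteratedDeriv_sub
      ((contDiff_boundaryFun g.toFun_mem).contDiffAt.of_le (by exact_mod_cast le_top))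
      ((contDiff_boundaryFun f.toFun_mem).contDiffAt.of_le (by exact_mod_cast le_top)), ← dist_eq_norm,
      dist_comm]
    exact (hj θ).le
  have h4 := h _ (Submodule.sub_mem _ g.toFun_mem f.toFun_mem) _
    (by simpa using h3 0 hg0) (h3 k hgk)
  rw [dist_eq_norm, ← seqForm_sub hl g.toFun_mem f.toFun_mem]
  refine h4.trans_lt ?_
  field_simp
  norm_num

/-- The continuous linear form `f ↦ ∑ lₙ aₙ(f)`. -/
def seqCLM (r : ℝ) (l : ℕ → ℂ) (hl : IsPolyBounded l) : SmoothModule r →L[ℂ] ℂ where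
  toFun f := seqForm r l f.toFun
  map_add' f g := seqForm_add hl f.toFun_mem g.toFun_mem
  map_smul' a f := seqForm_smul hl f.toFun_mem a
  cont := continuous_seqForm r hl

/-! ### Density of the polynomial vectors -/

theorem ofDisc_pow_mem (r : ℝ) (n : ℕ) : ofDisc r (fun W => W ^ n) ∈ smoothSubmodule r :=
  ofDisc_mem_smoothSubmodule r (differentiableOn_id.pow n) (contDiff_id.pow n).contDiffOn

/-- The vector with `f⁻ = Wⁿ`. -/
def monomialVec (r : ℝ) (n : ℕ) : SmoothModule r := ⟨ofDisc r fun W => W ^ n, ofDisc_pow_mem r n⟩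

theorem coef_monomialVec (r : ℝ) (n m : ℕ) :
    coef r (monomialVec r n).toFun m = if m = n then 1 else 0 := by
  refine (coef_ofDisc (G := fun W => W ^ n) m).trans
    (taylorCoeff_eq_of_hasSum (a := fun m => if m = n then 1 else 0) one_pos (fun W _ => ?_) m)
  have := hasSum_single (f := fun m : ℕ => (if m = n then (1 : ℂ) else 0) * W ^ m) n
    fun m hm => by rw [if_neg hm, zero_mul]
  simpa using this

theorem coef_sum_smul_monomialVec (r : ℝ) (a : ℕ → ℂ) (N m : ℕ) :
    coef r (∑ n ∈ Finset.range N, a n • monomialVec r n : SmoothModule r).toFun m =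
      if m < N then a m else 0 := by
  induction N with
  | zero =>
    rw [Finset.sum_range_zero, if_neg (by omega)]
    have := coef_smul (zero_mem (smoothSubmodule r)) 0 m
    rwa [zero_mul, zero_smul] at this
  | succ N ih =>
    rw [Finset.sum_range_succ]
    refine (coef_add (SmoothModule.toFun_mem _) (SmoothModule.toFun_mem _) m).trans ?_
    rw [ih]
    refine (congrArg _ (coef_smul (monomialVec r N).toFun_mem (a N) m)).trans ?_
    rw [coef_monomialVec]
    rcases lt_trichotomy m N with h | rfl | h
    · rw [if_pos h, if_neg h.ne, if_pos (by omega), mul_zero, add_zero]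
    · simp
    · rw [if_neg (by omega), if_neg h.ne', if_neg (by omega), mul_zero, add_zero]

/-- Rapid decay makes the Taylor series converge uniformly on the closed disc, so its sum is itself
a continuous extension and gives the boundary values. -/
theorem boundaryFun_eq_tsum {r : ℝ} {f : LowerHalfPlane → ℂ} (hf : f ∈ smoothSubmodule r) (θ : ℝ) :
    boundaryFun r f θ = ∑' n : ℕ, coef r f n * exp (n * (-2 * I) * θ) := by
  have h1 : ContinuousOn (fun W : ℂ => ∑' n, coef r f n * W ^ n) (closedBall 0 1) := by
    refine continuousOn_tsum (fun n => by fun_prop) (isRapidlyDecaying_coef hf).summable_norm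
      fun n W hW => ?_
    rw [norm_mul, norm_pow]
    exact mul_le_of_le_one_right (norm_nonneg _) (pow_le_one₀ (norm_nonneg _) (by simpa using hW))
  rw [boundaryFun_eq h1 fun W hW => (hasSum_coef hf hW).tsum_eq.symm]
  refine tsum_congr fun n => ?_
  rw [← Complex.exp_nat_mul]
  ring_nf

theorem iteratedDeriv_const_mul_exp (c a : ℂ) (k : ℕ) :
    iteratedDeriv k (fun θ : ℝ => c * exp (a * θ)) = fun θ : ℝ => c * a ^ k * exp (a * θ) := by
  induction k with
  | zero => simp
  | succ k ih =>
    rw [iteratedDeriv_succ, ih]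
    funext θ
    have := (((hasDerivAt_id (θ : ℂ)).const_mul a).cexp.const_mul (c * a ^ k)).comp_ofReal
    have h2 := this.deriv
    simp only [id, mul_one] at h2
    rw [h2, pow_succ]
    ring

/-- Termwise differentiation of the Fourier series, each derivative contributing a factor `-2in`.
This is the converse of the coefficient estimate: the seminorms are controlled by weighted sums of
coefficients. -/
theorem norm_iteratedDeriv_boundaryFun_le {r : ℝ} {f : LowerHalfPlane → ℂ}
    (hf : f ∈ smoothSubmodule r) (k : ℕ) (θ : ℝ) :
    ‖iteratedDeriv k (boundaryFun r f) θ‖ ≤ 2 ^ k * ∑' n : ℕ, ‖coef r f n‖ * (n + 1) ^ k := by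
  rw [show boundaryFun r f = fun θ : ℝ => ∑' n : ℕ, coef r f n * exp (n * (-2 * I) * θ) from
    funext (boundaryFun_eq_tsum hf), ← norm_iteratedFDeriv_eq_norm_iteratedDeriv (𝕜 := ℝ)]
  have hs : ∀ k : ℕ, Summable fun n : ℕ => 2 ^ k * (‖coef r f n‖ * ((n : ℝ) + 1) ^ k) := fun k =>
    ((isRapidlyDecaying_coef hf).summable_norm_mul k).mul_left _
  have hb : ∀ (k n : ℕ) (x : ℝ), ‖iteratedFDeriv ℝ k
      (fun θ : ℝ => coef r f n * exp (n * (-2 * I) * θ)) x‖ ≤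
      2 ^ k * (‖coef r f n‖ * ((n : ℝ) + 1) ^ k) := by
    intro k n x
    rw [norm_iteratedFDeriv_eq_norm_iteratedDeriv, iteratedDeriv_const_mul_exp, norm_mul, norm_mul,
      norm_pow, norm_mul, norm_mul, norm_neg, norm_I, Complex.norm_natCast, Complex.norm_ofNat,
      show (n : ℂ) * (-2 * I) * x = ((-2 * n * x : ℝ) : ℂ) * I by push_cast; ring,
      norm_exp_ofReal_mul_I, mul_one, mul_one, mul_pow]
    have : (n : ℝ) ^ k ≤ (n + 1) ^ k := by gcongr; linarith
    calc _ = 2 ^ k * (‖coef r f n‖ * n ^ k) := by ring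
      _ ≤ _ := by gcongr
  rw [iteratedFDeriv_tsum_apply (N := ⊤) (v := fun k n => 2 ^ k * (‖coef r f n‖ * (n + 1) ^ k))
    (fun n => ?_) (fun k _ => hs k) (fun k n x _ => hb k n x) le_top, ← tsum_mul_left]
  · exact tsum_of_norm_bounded (hs k).hasSum fun n => hb k n θ
  · exact contDiff_const.mul (contDiff_const.mul ofRealCLM.contDiff).cexp

/-- The `k`-th seminorm of the remainder is bounded by a tail of the convergent series `∑ ‖aₙ‖ (n +
1)^k`. -/
theorem tendsto_sum_smul_monomialVec {r : ℝ} (f : SmoothModule r) :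
    Tendsto (fun N => ∑ n ∈ Finset.range N, coef r f.toFun n • monomialVec r n) atTop (𝓝 f) := by
  refine SmoothModule.tendsto_iff.2 fun k => Metric.tendstoUniformly_iff.2 fun ε hε => ?_
  have hs := (isRapidlyDecaying_coef f.toFun_mem).summable_norm_mul k
  have h1 := tendsto_sum_nat_add fun n : ℕ => ‖coef r f.toFun n‖ * ((n : ℝ) + 1) ^ k
  have h2 := h1.const_mul ((2 : ℝ) ^ k)
  rw [mul_zero] at h2
  filter_upwards [h2.eventually_lt_const hε] with N hN θ
  set S : SmoothModule r := ∑ n ∈ Finset.range N, coef r f.toFun n • monomialVec r n with hS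
  have h3 : ∀ n, coef r (f.toFun - S.toFun) n = if n < N then 0 else coef r f.toFun n := by
    intro n
    have h4 : coef r (f.toFun - S.toFun) n = coef r f.toFun n - coef r S.toFun n := by
      rw [sub_eq_add_neg, ← neg_one_smul ℂ S.toFun,
        coef_add f.toFun_mem (Submodule.smul_mem _ _ S.toFun_mem), coef_smul S.toFun_mem]
      ring
    rw [h4, hS, coef_sum_smul_monomialVec]
    split_ifs <;> ring
  have h5 := norm_iteratedDeriv_boundaryFun_le (Submodule.sub_mem _ f.toFun_mem S.toFun_mem) k θ
  rw [boundaryFun_sub f.toFun_mem S.toFun_mem, iteratedDeriv_sub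
      ((contDiff_boundaryFun f.toFun_mem).contDiffAt.of_le (by exact_mod_cast le_top))
      ((contDiff_boundaryFun S.toFun_mem).contDiffAt.of_le (by exact_mod_cast le_top)),
      ← dist_eq_norm] at h5
  refine h5.trans_lt (lt_of_eq_of_lt ?_ hN)
  congr 1
  have hs' := (isRapidlyDecaying_coef
    (Submodule.sub_mem _ f.toFun_mem S.toFun_mem)).summable_norm_mul k
  rw [← hs'.sum_add_tsum_nat_add N, Finset.sum_eq_zero, zero_add]
  · refine tsum_congr fun n => ?_
    rw [h3, if_neg (by omega)]
  · intro n hn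
    rw [h3, if_pos (Finset.mem_range.1 hn), norm_zero, zero_mul]

/-- Continuous linear forms that agree on the polynomial vectors are equal. -/
theorem SmoothModule.clm_ext {r : ℝ} {l₁ l₂ : SmoothModule r →L[ℂ] ℂ}
    (h : ∀ n, l₁ (monomialVec r n) = l₂ (monomialVec r n)) : l₁ = l₂ := by
  ext f
  have h1 := (l₁.continuous.tendsto f).comp (tendsto_sum_smul_monomialVec f)
  have h2 := (l₂.continuous.tendsto f).comp (tendsto_sum_smul_monomialVec f)
  refine tendsto_nhds_unique h1 (h2.congr fun N => ?_)
  simp [map_sum, h]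

/-- Existence and uniqueness of the continuous extension of the contour pairing. -/
theorem extendsAnalyticPairing_iff {r : ℝ} (hr : 0 < r) {h : ℍ → ℂ}
    (hh : DifferentiableOn ℂ (plusDisc r h) (ball 0 1))
    (hl : IsPolyBounded fun n => hyperCoeff r n * taylorCoeff (plusDisc r h) n)
    (ℓ : SmoothModule r →L[ℂ] ℂ) : ExtendsAnalyticPairing r h ℓ ↔ ℓ = seqCLM r _ hl := by
  have key : ExtendsAnalyticPairing r h (seqCLM r _ hl) := by
    intro f G R ρ₁ ρ₂ hR hG hfG h1 h2 h3
    rw [contourPairing_sigmaOp hr hR hG hh h1 h2 h3]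
    refine tsum_congr fun n => ?_
    rw [coef, taylorCoeff_congr one_pos hfG]
  refine ⟨fun hℓ => SmoothModule.clm_ext fun n => ?_, fun h => h ▸ key⟩
  have h1 : Set.EqOn (discFun r (monomialVec r n).toFun) (fun W => W ^ n) (ball 0 1) :=
    fun W hW => discFun_ofDisc hW
  have h2 : DifferentiableOn ℂ (fun W : ℂ => W ^ n) (ball 0 2) := differentiableOn_id.pow n
  -- A monomial extends to every disc, so any admissible radii serve: `1/2 < 3/5 < 4/5 < 1`.
  rw [hℓ (monomialVec r n) _ 2 (3 / 5) (4 / 5) (by norm_num) h2 h1 (by norm_num) (by norm_num)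
    (by norm_num),
    key (monomialVec r n) _ 2 (3 / 5) (4 / 5) (by norm_num) h2 h1 (by norm_num) (by norm_num)
    (by norm_num)]

/-! ### Branches of powers -/

/-- The identities between products of principal powers below are proved at the level of logarithms:
the exponentials agree by algebra, and an estimate of arguments excludes a jump by `2πi`. -/
theorem exp_injOn_strip {z w : ℂ} (h : exp z = exp w) (him : |z.im - w.im| < 2 * Real.pi) :
    z = w := by
  obtain ⟨n, hn⟩ := exp_eq_exp_iff_exists_int.1 h
  have h1 : z.im - w.im = n * (2 * Real.pi) := by
    rw [hn]; simp
  have hpi := Real.pi_pos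
  rw [h1, abs_mul, abs_of_pos (show 0 < 2 * Real.pi by positivity)] at him
  have h2 : |(n : ℝ)| < 1 := by
    by_contra h3
    push Not at h3
    nlinarith
  have h3 : n = 0 := by
    rw [← Int.cast_abs] at h2
    exact Int.abs_lt_one_iff.1 (by exact_mod_cast h2)
  simpa [h3] using hn

theorem arg_mem_Ioo_of_im_pos {z : ℂ} (hz : 0 < z.im) : 0 < arg z ∧ arg z < Real.pi := by
  refine ⟨lt_of_le_of_ne (arg_nonneg_iff.2 hz.le) fun h => ?_, arg_lt_pi_iff.2 (Or.inr hz.ne')⟩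
  exact hz.ne' (arg_eq_zero_iff.1 h.symm).2

/-- According to the sign of `c`, both values lie in the same open half-plane or coincide. -/
theorem abs_arg_sub_arg_lt_pi {c d : ℝ} {z w : ℂ} (hz : 0 < z.im) (hw : 0 < w.im) :
    |arg (c * z + d) - arg (c * w + d)| < Real.pi := by
  have him : ∀ z : ℂ, (c * z + d).im = c * z.im := fun z => by simp
  rcases lt_trichotomy c 0 with hc | rfl | hc
  · have h : ∀ z : ℂ, 0 < z.im → -Real.pi < arg (c * z + d) ∧ arg (c * z + d) < 0 := fun z hz =>
      ⟨neg_pi_lt_arg _, arg_neg_iff.2 (by rw [him]; exact mul_neg_of_neg_of_pos hc hz)⟩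
    rw [abs_lt]
    constructor <;> linarith [h z hz, h w hw]
  · simpa using Real.pi_pos
  · have h : ∀ z : ℂ, 0 < z.im → 0 < arg (c * z + d) ∧ arg (c * z + d) < Real.pi := fun z hz =>
      arg_mem_Ioo_of_im_pos (by rw [him]; positivity)
    rw [abs_lt]
    constructor <;> linarith [h z hz, h w hw]

theorem im_upper_sub_lower_pos (ζ : ℍ) (t : LowerHalfPlane) : 0 < ((ζ : ℂ) - t).im := by
  have h1 := ζ.im_pos
  have h2 := t.2
  rw [sub_im, UpperHalfPlane.coe_im]
  linarith

theorem upper_sub_lower_ne_zero (ζ : ℍ) (t : LowerHalfPlane) : (ζ : ℂ) - t ≠ 0 := by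
  intro h
  have := im_upper_sub_lower_pos ζ t
  rw [h] at this
  simp at this

theorem autFactor_upper_ne_zero (γ : SL(2, ℤ)) (ζ : ℍ) : autFactor γ ζ ≠ 0 := by
  have := UpperHalfPlane.denom_ne_zero (γ : GL (Fin 2) ℝ) ζ
  simpa [UpperHalfPlane.denom, autFactor] using this

theorem conj_autFactor (γ : SL(2, ℤ)) (z : ℂ) : conj (autFactor γ z) = autFactor γ (conj z) := by
  simp [autFactor]

theorem im_conj_lower_pos (t : LowerHalfPlane) : 0 < (conj (t : ℂ)).im := by
  simpa using t.2

theorem autFactor_lower_ne_zero (γ : SL(2, ℤ)) (t : LowerHalfPlane) : autFactor γ t ≠ 0 := by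
  have h := autFactor_upper_ne_zero γ ⟨conj (t : ℂ), im_conj_lower_pos t⟩
  intro h'
  refine h ?_
  change autFactor γ (conj (t : ℂ)) = 0
  rw [← conj_autFactor, h', map_zero]

theorem coe_smul_eq (γ : SL(2, ℤ)) (ζ : ℍ) :
    ((γ • ζ : ℍ) : ℂ) = ((γ 0 0 : ℂ) * ζ + (γ 0 1 : ℂ)) / autFactor γ ζ := by
  rw [UpperHalfPlane.specialLinearGroup_apply]
  simp [autFactor]

theorem coe_lowerMoebius (γ : SL(2, ℤ)) (t : LowerHalfPlane) :
    (lowerMoebius γ t : ℂ) = ((γ 0 0 : ℂ) * t + (γ 0 1 : ℂ)) / autFactor γ t := rfl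

theorem det_eq_one (γ : SL(2, ℤ)) :
    (γ 0 0 : ℂ) * (γ 1 1 : ℂ) - (γ 0 1 : ℂ) * (γ 1 0 : ℂ) = 1 := by
  have := γ.det_coe
  rw [Matrix.det_fin_two] at this
  exact_mod_cast this

theorem smul_sub_lowerMoebius (γ : SL(2, ℤ)) (ζ : ℍ) (t : LowerHalfPlane) :
    ((γ • ζ : ℍ) : ℂ) - lowerMoebius γ t = (ζ - t) / (autFactor γ ζ * autFactor γ t) := by
  have h1 := autFactor_upper_ne_zero γ ζ
  have h2 := autFactor_lower_ne_zero γ t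
  rw [coe_smul_eq, coe_lowerMoebius, div_sub_div _ _ h1 h2]
  congr 1
  simp only [autFactor]
  linear_combination ((ζ : ℂ) - t) * det_eq_one γ

/-- This is `smul_sub_lowerMoebius` raised to the power `s`, with no spurious root of unity. The
convention `[-π, π)` on the lower half-plane makes the argument of `ct + d` minus that of `c t̄ +
d`, which differs from that of `cζ + d` by less than `π`; the two differences `ζ - t` and `γζ - γt`
have arguments in `(0, π)`. The total discrepancy is thus below `2π`. -/
theorem lowerPow_mul_cpow (γ : SL(2, ℤ)) (ζ : ℍ) (t : LowerHalfPlane) (s : ℝ) :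
    lowerPow (autFactor γ t) s * (((γ • ζ : ℍ) : ℂ) - lowerMoebius γ t) ^ (s : ℂ) =
      autFactor γ ζ ^ (-(s : ℂ)) * ((ζ : ℂ) - t) ^ (s : ℂ) := by
  have h1 := autFactor_upper_ne_zero γ ζ
  have h2 := autFactor_lower_ne_zero γ t
  have h3 := upper_sub_lower_ne_zero ζ t
  have h4 := upper_sub_lower_ne_zero (γ • ζ) (lowerMoebius γ t)
  have h5 : conj (autFactor γ t) ≠ 0 := (map_ne_zero _).2 h2
  have key : conj (log (conj (autFactor γ t))) + log (((γ • ζ : ℍ) : ℂ) - lowerMoebius γ t) =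
      -log (autFactor γ ζ) + log ((ζ : ℂ) - t) := by
    refine exp_injOn_strip ?_ ?_
    · rw [exp_add, exp_add, exp_log h4, exp_log h3, exp_neg, exp_log h1, exp_conj, exp_log h5,
        conj_conj, smul_sub_lowerMoebius]
      field_simp
    · have h6 := arg_mem_Ioo_of_im_pos (im_upper_sub_lower_pos ζ t)
      have h7 := arg_mem_Ioo_of_im_pos (im_upper_sub_lower_pos (γ • ζ) (lowerMoebius γ t))
      have h8 := abs_arg_sub_arg_lt_pi (c := (γ 1 0 : ℝ)) (d := (γ 1 1 : ℝ)) (z := ζ)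
        (by simpa using ζ.im_pos) (im_conj_lower_pos t)
      rw [conj_autFactor]
      simp only [add_im, neg_im, conj_im, log_im, autFactor]
      simp only [ofReal_intCast] at h8
      rw [abs_lt] at h8 ⊢
      constructor <;> linarith
  rw [lowerPow, cpow_def_of_ne_zero h5, cpow_def_of_ne_zero h4, cpow_def_of_ne_zero h1,
    cpow_def_of_ne_zero h3, ← exp_conj, map_mul, conj_ofReal, ← exp_add, ← exp_add]
  congr 1
  linear_combination (s : ℂ) * key

theorem upper_add_I_ne_zero (ζ : ℍ) : (ζ : ℂ) + I ≠ 0 := by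
  intro h
  have h1 := congrArg Complex.im h
  have h2 := ζ.im_pos
  simp only [add_im, I_im, zero_im, UpperHalfPlane.coe_im] at h1
  linarith

/-- The coordinate `(ζ - i) / (ζ + i)` on the upper half-plane. -/
def upperDisc (ζ : ℍ) : ℂ := ((ζ : ℂ) - I) / (ζ + I)

theorem norm_upperDisc_lt_one (ζ : ℍ) : ‖upperDisc ζ‖ < 1 := by
  rw [upperDisc, norm_div, div_lt_one (norm_pos_iff.2 (upper_add_I_ne_zero ζ))]
  refine lt_of_pow_lt_pow_left₀ 2 (norm_nonneg _) ?_
  rw [← normSq_eq_norm_sq, ← normSq_eq_norm_sq, normSq_apply, normSq_apply]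
  simp only [add_re, add_im, sub_re, sub_im, I_re, I_im, UpperHalfPlane.coe_im]
  nlinarith [ζ.im_pos]

theorem one_sub_upperDisc (ζ : ℍ) : 1 - upperDisc ζ = 2 * I / (ζ + I) := by
  have := upper_add_I_ne_zero ζ
  rw [upperDisc]
  field_simp
  ring

theorem re_one_sub_pos {x : ℂ} (hx : ‖x‖ < 1) : 0 < (1 - x).re := by
  rw [sub_re, one_re]
  linarith [(re_le_norm x)]

theorem norm_mul_lt_one {x W : ℂ} (hx : ‖x‖ < 1) (hW : ‖W‖ ≤ 1) : ‖x * W‖ < 1 := by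
  rw [norm_mul]
  exact (mul_le_of_le_one_right (norm_nonneg _) hW).trans_lt hx

/-- The underlying identity is `(ζ - t)(1 - x) = (i - t)(1 - xW)`. Arguments of `ζ - t` and `i - t`
lie in `(0, π)`, those of `1 - x` and `1 - xW` in `(-π/2, π/2)`, so the branches match. -/
theorem upper_sub_lower_cpow (ζ : ℍ) (t : LowerHalfPlane) (s : ℂ) :
    ((ζ : ℂ) - t) ^ s * (1 - upperDisc ζ) ^ s =
      (I - (t : ℂ)) ^ s * (1 - upperDisc ζ * (((t : ℂ) + I) / (t - I))) ^ s := by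
  have hx := norm_upperDisc_lt_one ζ
  have hW := mem_ball_zero_iff.1 (discOfLower_mem_ball t.2)
  have hxW := norm_mul_lt_one hx hW.le
  have h1 := upper_sub_lower_ne_zero ζ t
  have h2 := one_sub_ne_zero_of_norm_lt hx
  have h3 := I_sub_ne_zero t.2
  have h4 := one_sub_ne_zero_of_norm_lt hxW
  have key : log ((ζ : ℂ) - t) + log (1 - upperDisc ζ) =
      log (I - (t : ℂ)) + log (1 - upperDisc ζ * (((t : ℂ) + I) / (t - I))) := by
    refine exp_injOn_strip ?_ ?_
    · rw [exp_add, exp_add, exp_log h1, exp_log h2, exp_log h3, exp_log h4, one_sub_upperDisc,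
        upperDisc]
      have h5 := upper_add_I_ne_zero ζ
      have h6 := sub_I_ne_zero_of_im_neg t.2
      field_simp
      ring
    · have h6 := arg_mem_Ioo_of_im_pos (im_upper_sub_lower_pos ζ t)
      have h7 := arg_mem_Ioo_of_im_pos (im_I_sub_pos t.2)
      have h8 := abs_lt.1 (abs_arg_lt_pi_div_two_iff.2 (Or.inl (re_one_sub_pos hx)))
      have h9 := abs_lt.1 (abs_arg_lt_pi_div_two_iff.2 (Or.inl (re_one_sub_pos hxW)))
      simp only [add_im, log_im]
      rw [abs_lt]
      constructor <;> linarith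
  rw [cpow_def_of_ne_zero h1, cpow_def_of_ne_zero h2, cpow_def_of_ne_zero h3,
    cpow_def_of_ne_zero h4, ← exp_add, ← exp_add]
  congr 1
  linear_combination s * key

/-! ### The action in the disc coordinate -/

theorem cpow_mul_cpow_neg {z : ℂ} (hz : z ≠ 0) (s : ℂ) : z ^ s * z ^ (-s) = 1 := by
  rw [cpow_neg, mul_inv_cancel₀ (cpow_ne_zero_iff.2 (Or.inl hz))]

/-- With `η = γ⁻¹ i`, the point `γt` equals `i` at `t = η` and `-i` at the conjugate of `η`. This
locates the pole and the zero of the transformed coordinate, and what remains is a quotient of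
conjugates. -/
theorem exists_discOfLower_lowerMoebius (γ : SL(2, ℤ)) : ∃ u : ℂ, ‖u‖ = 1 ∧ ∀ t : LowerHalfPlane,
    ((lowerMoebius γ t : ℂ) + I) / (lowerMoebius γ t - I) =
      u * ((((t : ℂ) + I) / (t - I) - conj (upperDisc (γ⁻¹ • UpperHalfPlane.I))) /
        (1 - upperDisc (γ⁻¹ • UpperHalfPlane.I) * (((t : ℂ) + I) / (t - I)))) := by
  set η : ℍ := γ⁻¹ • UpperHalfPlane.I with hη
  have hp : ((γ 0 0 : ℂ) - I * (γ 1 0 : ℂ)) ≠ 0 := by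
    intro h
    have h1 := congrArg Complex.re h
    have h2 := congrArg Complex.im h
    simp at h1 h2
    have := det_eq_one γ
    simp [h1, h2] at this
  have hη1 : ((γ 0 0 : ℂ) - I * (γ 1 0 : ℂ)) * η + ((γ 0 1 : ℂ) - I * (γ 1 1 : ℂ)) = 0 := by
    have h1 := coe_smul_eq γ η
    have h2 := autFactor_upper_ne_zero γ η
    rw [hη, smul_inv_smul, ← hη, eq_div_iff h2, UpperHalfPlane.coe_I, autFactor] at h1
    linear_combination -h1
  have hη2 : ((γ 0 0 : ℂ) + I * (γ 1 0 : ℂ)) * conj (η : ℂ) +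
      ((γ 0 1 : ℂ) + I * (γ 1 1 : ℂ)) = 0 := by
    have := congrArg conj hη1
    simpa using this
  have hpc : conj ((γ 0 0 : ℂ) - I * (γ 1 0 : ℂ)) = (γ 0 0 : ℂ) + I * (γ 1 0 : ℂ) := by simp
  have hec : conj ((η : ℂ) + I) = conj (η : ℂ) - I := by simp [sub_eq_add_neg]
  have he := upper_add_I_ne_zero η
  have hec0 : conj (η : ℂ) - I ≠ 0 := by rw [← hec]; exact (map_ne_zero _).2 he
  have hpc0 : (γ 0 0 : ℂ) + I * (γ 1 0 : ℂ) ≠ 0 := by rw [← hpc]; exact (map_ne_zero _).2 hp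
  refine ⟨-(((γ 0 0 : ℂ) + I * (γ 1 0 : ℂ)) / ((γ 0 0 : ℂ) - I * (γ 1 0 : ℂ)) *
    ((conj (η : ℂ) - I) / (η + I))), ?_, fun t => ?_⟩
  · rw [norm_neg, norm_mul, norm_div, norm_div, ← hpc, ← hec, RCLike.norm_conj, RCLike.norm_conj,
      div_self (norm_ne_zero_iff.2 hp), div_self (norm_ne_zero_iff.2 he), one_mul]
  have ht := sub_I_ne_zero_of_im_neg t.2
  have h2 := autFactor_lower_ne_zero γ t
  have hηt : (t : ℂ) - η ≠ 0 := by
    rw [← neg_ne_zero, neg_sub]; exact upper_sub_lower_ne_zero η t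
  have hI := I_ne_zero
  have e1 : (lowerMoebius γ t : ℂ) + I =
      ((γ 0 0 : ℂ) + I * (γ 1 0 : ℂ)) * (t - conj (η : ℂ)) / autFactor γ t := by
    rw [coe_lowerMoebius, eq_div_iff h2, add_mul, div_mul_cancel₀ _ h2, autFactor]
    linear_combination hη2
  have e2 : (lowerMoebius γ t : ℂ) - I =
      ((γ 0 0 : ℂ) - I * (γ 1 0 : ℂ)) * (t - η) / autFactor γ t := by
    rw [coe_lowerMoebius, eq_div_iff h2, sub_mul, div_mul_cancel₀ _ h2, autFactor]
    linear_combination hη1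
  have e3 : 1 - upperDisc η * (((t : ℂ) + I) / (t - I)) =
      2 * I * (t - η) / ((η + I) * (t - I)) := by
    rw [upperDisc]; field_simp; ring
  have e4 : ((t : ℂ) + I) / (t - I) - conj (upperDisc η) =
      -(2 * I * (t - conj (η : ℂ)) / ((conj (η : ℂ) - I) * (t - I))) := by
    rw [upperDisc, map_div₀, hec, map_sub, conj_I, sub_neg_eq_add]; field_simp; ring
  rw [e1, e2, e3, e4]
  field_simp

/-- Taking `ζ = η = γ⁻¹ i` in `lowerPow_mul_cpow` makes `γζ = i`, so the factor `(i - γt)^(-r)`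
there cancels the power contained in `f⁻(γt)`; `upper_sub_lower_cpow` rewrites what is left in terms
of `W`. The constants depend on `γ` only, not on `f`. -/
theorem discFun_lowerSlash (r : ℝ) (v : SL(2, ℤ) → ℂˣ) (γ : SL(2, ℤ)) :
    ∃ κ x u : ℂ, ‖x‖ < 1 ∧ ‖u‖ = 1 ∧ ∀ (f : LowerHalfPlane → ℂ), ∀ W ∈ ball (0 : ℂ) 1,
      discFun r (lowerSlash r v γ f) W =
        κ * (1 - x * W) ^ (-(r : ℂ)) * discFun r f (u * ((W - conj x) / (1 - x * W))) := by
  obtain ⟨u, hu, h⟩ := exists_discOfLower_lowerMoebius γ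
  set η : ℍ := γ⁻¹ • UpperHalfPlane.I with hη
  refine ⟨(v γ : ℂ) * autFactor γ η ^ (r : ℂ) * (1 - upperDisc η) ^ (r : ℂ), upperDisc η, u,
    norm_upperDisc_lt_one η, hu, fun f W hW => ?_⟩
  set t : LowerHalfPlane := ⟨_, im_lowerOfDisc_neg hW⟩ with ht
  have hW' : W = ((t : ℂ) + I) / (t - I) :=
    (discOfLower_lowerOfDisc (sub_one_ne_zero_of_mem_ball hW)).symm
  have hdisc : ∀ (g : LowerHalfPlane → ℂ) (s : LowerHalfPlane),
      discFun r g (((s : ℂ) + I) / (s - I)) = (I - (s : ℂ)) ^ (r : ℂ) * g s := by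
    intro g s
    rw [discFun_eq (discOfLower_mem_ball s.2)]
    simp only [lowerOfDisc_discOfLower s.2]
  rw [hW', ← h t, hdisc, hdisc, lowerSlash]
  have k1 := lowerPow_mul_cpow γ η t (-r)
  have k2 := upper_sub_lower_cpow η t (-(r : ℂ))
  rw [hη, smul_inv_smul, ← hη, UpperHalfPlane.coe_I, ofReal_neg, neg_neg] at k1
  have k3 := cpow_mul_cpow_neg (I_sub_ne_zero (lowerMoebius γ t).2) r
  have k4 := cpow_mul_cpow_neg (I_sub_ne_zero t.2) r
  have k5 := cpow_mul_cpow_neg (one_sub_ne_zero_of_norm_lt (norm_upperDisc_lt_one η)) r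
  generalize (I - (t : ℂ)) ^ (r : ℂ) = A1 at *
  generalize (I - (t : ℂ)) ^ (-(r : ℂ)) = A2 at *
  generalize (I - (lowerMoebius γ t : ℂ)) ^ (r : ℂ) = B1 at *
  generalize (I - (lowerMoebius γ t : ℂ)) ^ (-(r : ℂ)) = B2 at *
  generalize (1 - upperDisc η) ^ (r : ℂ) = C1 at *
  generalize (1 - upperDisc η) ^ (-(r : ℂ)) = C2 at *
  generalize lowerPow (autFactor γ t) (-r) = L at *
  generalize autFactor γ η ^ (r : ℂ) = J at *
  generalize ((η : ℂ) - t) ^ (-(r : ℂ)) = D at *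
  generalize (1 - upperDisc η * (((t : ℂ) + I) / (t - I))) ^ (-(r : ℂ)) = E at *
  have k6 : A1 * L = J * C1 * E * B1 := by
    calc A1 * L = A1 * (L * B2) * B1 := by linear_combination (-A1 * L) * k3
      _ = A1 * J * D * B1 := by rw [k1]; ring
      _ = A1 * J * (D * C2) * C1 * B1 := by linear_combination (-A1 * J * D * B1) * k5
      _ = (A1 * A2) * J * E * C1 * B1 := by rw [k2]; ring
      _ = _ := by rw [k4]; ring
  linear_combination ((v γ : ℂ) * f (lowerMoebius γ t)) * k6

/-- Being an exact identity, it serves on both sides of the unit circle: for the mapping properties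
of the disc and for estimates slightly outside it. -/
theorem normSq_blaschke (x W : ℂ) : ‖W - conj x‖ ^ 2 =
    ‖1 - x * W‖ ^ 2 + (‖W‖ ^ 2 - 1) * (1 - ‖x‖ ^ 2) := by
  simp only [← normSq_eq_norm_sq, normSq_apply, sub_re, sub_im, mul_re, mul_im, conj_re, conj_im,
    one_re, one_im]
  ring

theorem norm_blaschke_le_one {x u W : ℂ} (hx : ‖x‖ < 1) (hu : ‖u‖ = 1) (hW : ‖W‖ ≤ 1) :
    ‖u * ((W - conj x) / (1 - x * W))‖ ≤ 1 := by
  have h1 := one_sub_ne_zero_of_norm_lt (norm_mul_lt_one hx hW)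
  rw [norm_mul, hu, one_mul, norm_div, div_le_one (norm_pos_iff.2 h1)]
  refine (pow_le_pow_iff_left₀ (norm_nonneg _) (norm_nonneg _) two_ne_zero).1 ?_
  rw [normSq_blaschke]
  have h2 : 0 ≤ 1 - ‖x‖ ^ 2 := by nlinarith [norm_nonneg x]
  have h3 : 0 ≤ 1 - ‖W‖ ^ 2 := by nlinarith [norm_nonneg W]
  nlinarith [mul_nonneg h2 h3]

theorem norm_blaschke_lt_one {x u W : ℂ} (hx : ‖x‖ < 1) (hu : ‖u‖ = 1) (hW : ‖W‖ < 1) :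
    ‖u * ((W - conj x) / (1 - x * W))‖ < 1 := by
  have h1 := one_sub_ne_zero_of_norm_lt (norm_mul_lt_one hx hW.le)
  rw [norm_mul, hu, one_mul, norm_div, div_lt_one (norm_pos_iff.2 h1)]
  refine lt_of_pow_lt_pow_left₀ 2 (norm_nonneg _) ?_
  rw [normSq_blaschke]
  have h2 : 0 < 1 - ‖x‖ ^ 2 := by nlinarith [norm_nonneg x]
  have h3 : 0 < 1 - ‖W‖ ^ 2 := by nlinarith [norm_nonneg W]
  nlinarith [mul_pos h2 h3]

theorem differentiableOn_cocycle (x s : ℂ) :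
    DifferentiableOn ℂ (fun W : ℂ => (1 - x * W) ^ s) {W | 1 - x * W ∈ slitPlane} := fun _ hW =>
  (((differentiableAt_id.const_mul x).const_sub 1).cpow_const hW).differentiableWithinAt

theorem differentiableOn_blaschke (x u : ℂ) :
    DifferentiableOn ℂ (fun W : ℂ => u * ((W - conj x) / (1 - x * W)))
      {W | 1 - x * W ∈ slitPlane} :=
  DifferentiableOn.const_mul (DifferentiableOn.div (c := fun W : ℂ => W - conj x)
    (d := fun W : ℂ => 1 - x * W) (by fun_prop) (by fun_prop)
    fun _ hW => slitPlane_ne_zero hW) u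

theorem isOpen_cocycle_domain (x : ℂ) : IsOpen {W : ℂ | 1 - x * W ∈ slitPlane} :=
  isOpen_slitPlane.preimage (by fun_prop)

theorem mem_slitPlane_one_sub_mul {x W : ℂ} (h : ‖x * W‖ < 1) : 1 - x * W ∈ slitPlane :=
  Or.inl (re_one_sub_pos h)

/-- The action preserves the smooth vectors. -/
theorem lowerSlash_mem_smoothSubmodule {r : ℝ} (v : SL(2, ℤ) → ℂˣ) (γ : SL(2, ℤ))
    {f : LowerHalfPlane → ℂ} (hf : f ∈ smoothSubmodule r) :
    lowerSlash r v γ f ∈ smoothSubmodule r := by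
  obtain ⟨κ, x, u, hx, hu, h⟩ := discFun_lowerSlash r v γ
  have hd := differentiableOn_discFun hf
  obtain ⟨-, G, hG, hfG⟩ := hf
  have hU : closedBall (0 : ℂ) 1 ⊆ {W | 1 - x * W ∈ slitPlane} := fun W hW =>
    mem_slitPlane_one_sub_mul (norm_mul_lt_one hx (by simpa using hW))
  have hm : Set.MapsTo (fun W : ℂ => u * ((W - conj x) / (1 - x * W))) (ball 0 1) (ball 0 1) :=
    fun W hW => mem_ball_zero_iff.2 (norm_blaschke_lt_one hx hu (mem_ball_zero_iff.1 hW))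
  have hm' : Set.MapsTo (fun W : ℂ => u * ((W - conj x) / (1 - x * W))) (closedBall 0 1)
      (closedBall 0 1) := fun W hW =>
    mem_closedBall_zero_iff.2 (norm_blaschke_le_one hx hu (mem_closedBall_zero_iff.1 hW))
  have hsm : ∀ {g : ℂ → ℂ}, DifferentiableOn ℂ g {W | 1 - x * W ∈ slitPlane} →
      ContDiffOn ℝ ∞ g (closedBall 0 1) := fun hg =>
    ((hg.contDiffOn (isOpen_cocycle_domain x)).restrict_scalars ℝ).mono hU
  have key : Set.EqOn (discFun r (lowerSlash r v γ f))
      (fun W => κ * (1 - x * W) ^ (-(r : ℂ)) * G (u * ((W - conj x) / (1 - x * W)))) (ball 0 1) :=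
    fun W hW => by rw [h f W hW, hfG (hm hW)]
  rw [eq_ofDisc key]
  refine ofDisc_mem_smoothSubmodule r ?_ ?_
  · refine DifferentiableOn.mul (((differentiableOn_cocycle x _).mono
      (ball_subset_closedBall.trans hU)).const_mul κ) ?_
    exact (hd.congr fun W hW => (hfG hW).symm).comp
      ((differentiableOn_blaschke x u).mono (ball_subset_closedBall.trans hU)) hm
  · exact (contDiffOn_const.mul (hsm (differentiableOn_cocycle x _))).mul
      (hG.comp (hsm (differentiableOn_blaschke x u)) hm')

/-! ### The action on Taylor coefficients -/

/-- Families of rapidly decaying sequences that grow polynomially with the index `n`. -/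
def IsTemperate (α : ℕ → ℕ → ℂ) : Prop :=
  ∀ N : ℕ, ∃ D : ℝ, ∀ n m, ‖α n m‖ * (m + 1) ^ N ≤ D * (n + 1) ^ N

theorem IsTemperate.norm_mul_le {α : ℕ → ℕ → ℂ} (hα : IsTemperate α) {y : ℕ → ℂ}
    (hy : IsPolyBounded y) : ∃ (D : ℝ) (K : ℕ), 0 ≤ D ∧ ∀ n m,
      ‖α n m * y m‖ ≤ D * (n + 1) ^ K * (((m : ℝ) + 1) ^ 2)⁻¹ := by
  obtain ⟨C, K, hC⟩ := hy
  obtain ⟨D, hD⟩ := hα (K + 2)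
  have hC0 : 0 ≤ C := by simpa using (norm_nonneg _).trans (hC 0)
  have hD0 : 0 ≤ D := by
    have : 0 ≤ ‖α 0 0‖ * ((0 : ℕ) + 1 : ℝ) ^ (K + 2) := by positivity
    simpa using this.trans (hD 0 0)
  refine ⟨C * D, K + 2, by positivity, fun n m => ?_⟩
  rw [norm_mul, ← div_eq_mul_inv, le_div_iff₀ (by positivity)]
  calc ‖α n m‖ * ‖y m‖ * (m + 1) ^ 2 ≤ ‖α n m‖ * (C * (m + 1) ^ K) * (m + 1) ^ 2 := by
        gcongr; exact hC m
    _ = C * (‖α n m‖ * (m + 1) ^ (K + 2)) := by ring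
    _ ≤ C * (D * (n + 1) ^ (K + 2)) := mul_le_mul_of_nonneg_left (hD n m) hC0
    _ = _ := by ring

theorem IsTemperate.isPolyBounded_tsum {α : ℕ → ℕ → ℂ} (hα : IsTemperate α) {y : ℕ → ℂ}
    (hy : IsPolyBounded y) : IsPolyBounded fun n => ∑' m, α n m * y m := by
  obtain ⟨D, K, -, hD⟩ := hα.norm_mul_le hy
  refine ⟨D * ∑' m : ℕ, (((m : ℝ) + 1) ^ 2)⁻¹, K, fun n => ?_⟩
  rw [mul_right_comm]
  exact tsum_of_norm_bounded (summable_inv_add_one_sq.hasSum.mul_left _) (hD n)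

/-- Fubini: the decay of `a` absorbs the growth in `n`, and temperateness gives `(m + 1)⁻²` in the
other index. -/
theorem IsTemperate.exists_hasSum {α : ℕ → ℕ → ℂ} (hα : IsTemperate α) {a y : ℕ → ℂ}
    (ha : IsRapidlyDecaying a) (hy : IsPolyBounded y) :
    ∃ S, HasSum (fun n => a n * ∑' m, α n m * y m) S ∧
      HasSum (fun m => (∑' n, a n * α n m) * y m) S := by
  obtain ⟨D, K, hD0, hD⟩ := hα.norm_mul_le hy
  have h1 : Summable fun p : ℕ × ℕ =>
      (D * (‖a p.1‖ * ((p.1 : ℝ) + 1) ^ K)) * (((p.2 : ℝ) + 1) ^ 2)⁻¹ :=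
    ((ha.summable_norm_mul K).mul_left D).mul_of_nonneg summable_inv_add_one_sq
      (fun n => by positivity) (fun m => by positivity)
  have h2 : Summable fun p : ℕ × ℕ => a p.1 * (α p.1 p.2 * y p.2) := by
    refine Summable.of_norm_bounded h1 fun p => ?_
    rw [norm_mul]
    calc ‖a p.1‖ * ‖α p.1 p.2 * y p.2‖
        ≤ ‖a p.1‖ * (D * (p.1 + 1) ^ K * (((p.2 : ℝ) + 1) ^ 2)⁻¹) := by gcongr; exact hD _ _
      _ = _ := by ring
  refine ⟨_, h2.hasSum.prod_fiberwise fun n => ?_, ?_⟩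
  · rw [← tsum_mul_left]
    exact (h2.prod_factor n).hasSum
  · have h3 := h2.prod_symm
    have h4 := (Equiv.prodComm ℕ ℕ).hasSum_iff.2 h2.hasSum
    refine h4.prod_fiberwise fun m => ?_
    rw [← tsum_mul_right]
    convert! (h3.prod_factor m).hasSum using 2 with n
    funext n
    exact mul_assoc _ _ _

theorem exp_half_le_one_add {ε : ℝ} (h0 : 0 ≤ ε) (h1 : ε ≤ 1) : Real.exp (ε / 2) ≤ 1 + ε := by
  have h2 := Real.one_sub_le_exp_neg (ε / 2)
  rw [Real.exp_neg] at h2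
  have h3 := Real.exp_pos (ε / 2)
  have h4 : (1 - ε / 2) * Real.exp (ε / 2) ≤ 1 := by
    calc _ ≤ (Real.exp (ε / 2))⁻¹ * Real.exp (ε / 2) := by gcongr
      _ = 1 := inv_mul_cancel₀ h3.ne'
  have h5 : 1 ≤ (1 + ε) * (1 - ε / 2) := by nlinarith
  nlinarith

/-- From `y^N/N! ≤ e^y` at `y = ε(m + 1)/2`. What matters is the explicit loss `ε^(-N)`, since `ε`
will depend on `n`. -/
theorem add_one_pow_le_geometric {ε : ℝ} (h0 : 0 < ε) (h1 : ε ≤ 1) (m N : ℕ) :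
    ((m : ℝ) + 1) ^ N ≤ 2 * N.factorial * (2 / ε) ^ N * (1 + ε) ^ m := by
  have h2 := Real.pow_div_factorial_le_exp (ε * (m + 1) / 2) (by positivity) N
  have h3 : Real.exp (ε * (m + 1) / 2) ≤ 2 * (1 + ε) ^ m := by
    calc Real.exp (ε * (m + 1) / 2) = Real.exp (ε / 2) ^ (m + 1) := by
          rw [← Real.exp_nat_mul]; push_cast; ring_nf
      _ ≤ (1 + ε) ^ (m + 1) := by gcongr; exact exp_half_le_one_add h0.le h1
      _ = (1 + ε) * (1 + ε) ^ m := by ring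
      _ ≤ 2 * (1 + ε) ^ m := by gcongr; linarith
  have h4 : (0 : ℝ) < N.factorial := by exact_mod_cast N.factorial_pos
  rw [div_le_iff₀ h4] at h2
  calc ((m : ℝ) + 1) ^ N = (2 / ε) ^ N * (ε * (m + 1) / 2) ^ N := by
        rw [← mul_pow]; field_simp
    _ ≤ (2 / ε) ^ N * (Real.exp (ε * (m + 1) / 2) * N.factorial) := by gcongr
    _ ≤ (2 / ε) ^ N * ((2 * (1 + ε) ^ m) * N.factorial) := by gcongr
    _ = _ := by ring

/-- By `normSq_blaschke` the factor exceeds `1` only by a multiple of `‖W‖² - 1`, which is of order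
`1/n` on this circle, so its `n`-th power stays bounded. -/
theorem norm_blaschke_pow_le {x u W : ℂ} {s : ℝ} (hs : 0 < s) (hs1 : s ≤ 1) (hu : ‖u‖ = 1)
    (h1 : s ≤ ‖1 - x * W‖) (n : ℕ) (hW : ‖W‖ = 1 + s / (n + 2)) :
    ‖u * ((W - conj x) / (1 - x * W))‖ ^ n ≤ Real.exp (3 / s) := by
  set y := ‖u * ((W - conj x) / (1 - x * W))‖ with hy
  have hn : (0 : ℝ) < (n : ℝ) + 2 := by positivity
  have h2 : 0 < ‖1 - x * W‖ := hs.trans_le h1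
  have h3 : s / ((n : ℝ) + 2) ≤ 1 := by
    rw [div_le_one hn]; linarith [show (0 : ℝ) ≤ n from n.cast_nonneg]
  have h4 : 0 < s / ((n : ℝ) + 2) := by positivity
  have h5 : y ^ 2 ≤ 1 + 3 / (s * (n + 2)) := by
    have h6 : y ^ 2 = 1 + (‖W‖ ^ 2 - 1) * (1 - ‖x‖ ^ 2) / ‖1 - x * W‖ ^ 2 := by
      rw [hy, norm_mul, hu, one_mul, norm_div, div_pow, normSq_blaschke]
      field_simp
    have h7 : ‖W‖ ^ 2 - 1 ≤ 3 * (s / (n + 2)) := by rw [hW]; nlinarith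
    have h8 : 0 ≤ ‖W‖ ^ 2 - 1 := by rw [hW]; nlinarith
    have h9 : (‖W‖ ^ 2 - 1) * (1 - ‖x‖ ^ 2) ≤ 3 * (s / (n + 2)) := by
      nlinarith [sq_nonneg ‖x‖]
    rw [h6]
    gcongr 1 + ?_
    calc (‖W‖ ^ 2 - 1) * (1 - ‖x‖ ^ 2) / ‖1 - x * W‖ ^ 2
        ≤ 3 * (s / (n + 2)) / ‖1 - x * W‖ ^ 2 := by gcongr
      _ ≤ 3 * (s / (n + 2)) / s ^ 2 := by gcongr
      _ = 3 / (s * (n + 2)) := by field_simp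
  have h6 : (y ^ n) ^ 2 ≤ Real.exp (3 / s) := by
    calc (y ^ n) ^ 2 = (y ^ 2) ^ n := by ring
      _ ≤ Real.exp (3 / (s * (n + 2))) ^ n := by
          gcongr
          linarith [Real.add_one_le_exp (3 / (s * ((n : ℝ) + 2)))]
      _ = Real.exp (n * (3 / (s * (n + 2)))) := by rw [← Real.exp_nat_mul]
      _ ≤ Real.exp (3 / s) := by
          gcongr
          rw [mul_div_assoc', div_le_div_iff₀ (by positivity) hs]
          nlinarith
  have h7 : 1 ≤ Real.exp (3 / s) := Real.one_le_exp (by positivity)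
  have h8 : 0 ≤ y ^ n := by positivity
  nlinarith

/-- The Taylor coefficients of the transformed powers of the disc coordinate. -/
theorem isTemperate_blaschke {x u : ℂ} (hx : ‖x‖ < 1) (hu : ‖u‖ = 1) (κ s : ℂ) :
    IsTemperate fun n => taylorCoeff fun W =>
      κ * (1 - x * W) ^ s * (u * ((W - conj x) / (1 - x * W))) ^ n := by
  -- Chosen so that `‖xW‖ ≤ 1 - δ` on the disc of radius `1 + δ`, which keeps `1 - xW` in the slit
  -- plane and away from zero.
  set δ : ℝ := (1 - ‖x‖) / 2 with hδ
  have hx0 := norm_nonneg x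
  have hδ0 : 0 < δ := by rw [hδ]; linarith
  have hδ1 : δ ≤ 1 := by rw [hδ]; linarith
  have hxW : ∀ W : ℂ, ‖W‖ ≤ 1 + δ → ‖x * W‖ ≤ 1 - δ := by
    intro W hW
    rw [norm_mul]
    calc ‖x‖ * ‖W‖ ≤ ‖x‖ * (1 + δ) := by gcongr
      _ ≤ 1 - δ := by rw [hδ]; nlinarith
  have hU : closedBall (0 : ℂ) (1 + δ) ⊆ {W | 1 - x * W ∈ slitPlane} := fun W hW =>
    mem_slitPlane_one_sub_mul ((hxW W (by simpa using hW)).trans_lt (by linarith))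
  have hlow : ∀ W : ℂ, ‖W‖ ≤ 1 + δ → δ ≤ ‖1 - x * W‖ := by
    intro W hW
    have := norm_sub_norm_le (1 : ℂ) (x * W)
    rw [norm_one] at this
    linarith [hxW W hW]
  obtain ⟨B, hB⟩ := (isCompact_closedBall (0 : ℂ) (1 + δ)).exists_bound_of_continuousOn
    (((differentiableOn_cocycle x s).continuousOn.mono hU).const_mul κ)
  have hB0 : 0 ≤ B := (norm_nonneg _).trans (hB 0 (by simp; linarith))
  intro N
  refine ⟨B * Real.exp (3 / δ) * (2 * N.factorial * (4 / δ) ^ N), fun n m => ?_⟩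
  have hn : (0 : ℝ) < (n : ℝ) + 2 := by positivity
  -- Cauchy's estimate on radius `1 + ε`: the `n`-th Blaschke power is bounded there, and trading
  -- `(1 + ε)^(-m)` for `(m + 1)^(-N)` costs `ε^(-N)`, of order `(n + 1)^N`.
  set ε : ℝ := δ / (n + 2) with hε
  have hε0 : 0 < ε := by positivity
  have hεδ : ε < δ := by
    rw [hε, div_lt_iff₀ hn]
    nlinarith [show (0 : ℝ) ≤ n from n.cast_nonneg]
  have h1 : ‖taylorCoeff (fun W => κ * (1 - x * W) ^ s *
      (u * ((W - conj x) / (1 - x * W))) ^ n) m‖ ≤ B * Real.exp (3 / δ) / (1 + ε) ^ m := by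
    refine norm_taylorCoeff_le (R := 1 + δ) ?_ (by positivity) (by linarith) (fun W hW => ?_) m
    · have hU' := ball_subset_closedBall.trans hU
      exact (((differentiableOn_cocycle x s).mono hU').const_mul κ).mul
        (((differentiableOn_blaschke x u).mono hU').pow n)
    · have hW' : ‖W‖ ≤ 1 + δ := by linarith
      rw [norm_mul, norm_pow]
      exact mul_le_mul (hB W (by simpa using hW'))
        (norm_blaschke_pow_le hδ0 hδ1 hu (hlow W hW') n hW) (by positivity) hB0
  have h2 := add_one_pow_le_geometric hε0 (hεδ.le.trans hδ1) m N
  have h3 : (2 / ε) ^ N ≤ (4 / δ) ^ N * (n + 1) ^ N := by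
    rw [← mul_pow]
    gcongr
    rw [hε, div_div_eq_mul_div, div_mul_eq_mul_div]
    refine div_le_div_of_nonneg_right ?_ hδ0.le
    linarith [show (0 : ℝ) ≤ n from n.cast_nonneg]
  calc _ ≤ B * Real.exp (3 / δ) / (1 + ε) ^ m *
        (2 * N.factorial * (2 / ε) ^ N * (1 + ε) ^ m) := by gcongr
    _ = B * Real.exp (3 / δ) * (2 * N.factorial * (2 / ε) ^ N) := by field_simp
    _ ≤ B * Real.exp (3 / δ) * (2 * N.factorial * ((4 / δ) ^ N * (n + 1) ^ N)) := by gcongr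
    _ = _ := by ring

theorem isPolyBounded_pow {W : ℂ} (hW : ‖W‖ ≤ 1) : IsPolyBounded fun n => W ^ n :=
  ⟨1, 0, fun n => by simpa using pow_le_one₀ (norm_nonneg _) hW⟩

/-- The transform of a form `seqForm` under the action is again of this type. -/
theorem exists_seqForm_lowerSlash {r : ℝ} (v : SL(2, ℤ) → ℂˣ) (γ : SL(2, ℤ)) {l : ℕ → ℂ}
    (hl : IsPolyBounded l) : ∃ d : ℕ → ℂ, IsPolyBounded d ∧ ∀ f ∈ smoothSubmodule r,
      seqForm r l (lowerSlash r v γ f) = seqForm r d f := by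
  obtain ⟨κ, x, u, hx, hu, h⟩ := discFun_lowerSlash r v γ
  have hα := isTemperate_blaschke hx hu κ (-(r : ℂ))
  set φ : ℕ → ℂ → ℂ := fun n W =>
    κ * (1 - x * W) ^ (-(r : ℂ)) * (u * ((W - conj x) / (1 - x * W))) ^ n with hφ
  set α : ℕ → ℕ → ℂ := fun n => taylorCoeff (φ n) with hαdef
  have hφd : ∀ n, DifferentiableOn ℂ (φ n) (ball 0 1) := by
    intro n
    have hU' : ball (0 : ℂ) 1 ⊆ {W | 1 - x * W ∈ slitPlane} := fun W hW =>
      mem_slitPlane_one_sub_mul (norm_mul_lt_one hx (mem_ball_zero_iff.1 hW).le)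
    exact (((differentiableOn_cocycle x _).mono hU').const_mul κ).mul
        (((differentiableOn_blaschke x u).mono hU').pow n)
  refine ⟨fun n => ∑' m, α n m * l m, hα.isPolyBounded_tsum hl, fun f hf => ?_⟩
  have ha := isRapidlyDecaying_coef hf
  -- Expand `f⁻` at the transformed point and reorder by powers of `W`; the interchange applies with
  -- `y m = W^m`.
  have hcoef : ∀ m, coef r (lowerSlash r v γ f) m = ∑' n, coef r f n * α n m := by
    refine taylorCoeff_eq_of_hasSum (a := fun m => ∑' n, coef r f n * α n m) one_pos
      fun W hW => ?_
    have hW' := mem_ball_zero_iff.1 hW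
    obtain ⟨S, h1, h2⟩ := hα.exists_hasSum ha (isPolyBounded_pow hW'.le)
    have h3 := (hasSum_coef hf (mem_ball_zero_iff.2
      (norm_blaschke_lt_one hx hu hW'))).mul_left (κ * (1 - x * W) ^ (-(r : ℂ)))
    rw [← h f W hW] at h3
    have h4 : S = discFun r (lowerSlash r v γ f) W := by
      refine h1.unique (h3.congr_fun fun n => ?_)
      rw [(hasSum_taylorCoeff (hφd n) hW).tsum_eq]
      simp only [hφ]
      ring
    rw [← h4]
    exact h2
  -- The same interchange with `y = l` moves the matrix from the coefficients of `f` to the sequence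
  -- `l`.
  obtain ⟨S, h1, h2⟩ := hα.exists_hasSum ha hl
  have e1 := h2.tsum_eq
  have e2 := h1.tsum_eq
  trans S
  · rw [← e1]
    exact tsum_congr fun m => by rw [hcoef, mul_comm]
  · rw [← e2]
    exact tsum_congr fun n => mul_comm _ _

/-! ### Growth of modular forms -/

theorem norm_autFactor_sq (γ : SL(2, ℤ)) (z : ℍ) :
    (γ • z).im = z.im / ‖autFactor γ z‖ ^ 2 := by
  have h := ModularGroup.im_smul_eq_div_normSq γ z
  rw [h, normSq_eq_norm_sq]
  rfl

/-- The function `|f z| (im z)^(r/2)`. -/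
def invariantNorm (r : ℝ) (f : ℍ → ℂ) (z : ℍ) : ℝ := ‖f z‖ * z.im ^ (r / 2)

theorem invariantNorm_smul {r : ℝ} {v : SL(2, ℤ) → ℂˣ} {f : ℍ → ℂ} (hf : IsModularForm r v f)
    (γ : SL(2, ℤ)) (z : ℍ) :
    invariantNorm r f (γ • z) = ‖(v γ : ℂ)‖ * invariantNorm r f z := by
  have h0 : 0 < ‖autFactor γ z‖ := norm_pos_iff.2 (autFactor_upper_ne_zero γ z)
  rw [invariantNorm, invariantNorm, hf.2, norm_autFactor_sq, norm_mul, norm_mul, norm_cpow_real,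
    Real.div_rpow z.im_pos.le (by positivity), ← Real.rpow_natCast, ← Real.rpow_mul h0.le]
  have : ((2 : ℕ) : ℝ) * (r / 2) = r := by push_cast; ring
  rw [this]
  have := Real.rpow_pos_of_pos h0 r
  field_simp

/-- For general weight `v` need not be multiplicative, but its absolute value is: compare `|f|
y^(r/2)` at `z` and at `γδz` for a point `z` with `f z ≠ 0`. -/
theorem norm_multiplier_mul {r : ℝ} {v : SL(2, ℤ) → ℂˣ} (hv : IsMultiplierSystem r v)
    (γ δ : SL(2, ℤ)) : ‖(v (γ * δ) : ℂ)‖ = ‖(v γ : ℂ)‖ * ‖(v δ : ℂ)‖ := by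
  obtain ⟨f, hf0, hf⟩ := hv
  obtain ⟨z, hz⟩ := Function.ne_iff.1 hf0
  have h0 : 0 < invariantNorm r f z :=
    mul_pos (norm_pos_iff.2 hz) (Real.rpow_pos_of_pos z.im_pos _)
  refine mul_right_cancel₀ h0.ne' ?_
  rw [← invariantNorm_smul hf, mul_smul, invariantNorm_smul hf, invariantNorm_smul hf, mul_assoc]

theorem modular_S_pow_four : ModularGroup.S ^ 4 = 1 := by decide

theorem modular_ST_pow_six : (ModularGroup.S * ModularGroup.T) ^ 6 = 1 := by decide

/-- A positive real character is trivial on elements of finite order, and `S` and `ST` generate the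
group. -/
theorem norm_multiplier {r : ℝ} {v : SL(2, ℤ) → ℂˣ} (hv : IsMultiplierSystem r v)
    (γ : SL(2, ℤ)) : ‖(v γ : ℂ)‖ = 1 := by
  have h1 : ‖(v 1 : ℂ)‖ = 1 := by
    have h := norm_multiplier_mul hv 1 1
    rw [mul_one] at h
    exact (mul_left_cancel₀ (norm_ne_zero_iff.2 (v 1).ne_zero) (by rw [mul_one]; exact h)).symm
  let χ : SL(2, ℤ) →* ℝ :=
    { toFun := fun γ => ‖(v γ : ℂ)‖, map_one' := h1, map_mul' := norm_multiplier_mul hv }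
  have hfin : ∀ {δ : SL(2, ℤ)} {n : ℕ}, n ≠ 0 → δ ^ n = 1 → χ δ = 1 := by
    intro δ n hn h
    refine (pow_eq_one_iff_of_nonneg (norm_nonneg (v δ : ℂ)) hn).1 ?_
    change χ δ ^ n = 1
    rw [← map_pow, h, map_one]
  have hS := hfin four_ne_zero modular_S_pow_four
  have hST := hfin (by norm_num) modular_ST_pow_six
  rw [map_mul, hS, one_mul] at hST
  have : χ = 1 := by
    refine MonoidHom.eq_of_eqOn_dense SpecialLinearGroup.SL2Z_generators ?_
    rintro δ (rfl | rfl)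
    · exact hS
    · exact hST
  exact DFunLike.congr_fun this γ

/-- Moderate growth towards the boundary of the upper half-plane. -/
def HasModerateGrowth (g : ℍ → ℂ) : Prop :=
  ∃ (C : ℝ) (k : ℕ), 0 ≤ C ∧ ∀ z : ℍ, ‖g z‖ ≤ C * max 1 (1 / z.im) ^ k

/-- Since `|v| = 1`, the function `|h| y^(r/2)` is invariant. It is `O(y^(r/2))` at the cusp, hence
bounded by a multiple of `max(y, 1/y)^(r/2)` everywhere; dividing by `y^(r/2)` leaves `max(1,
1/y)^r`. -/
theorem hasModerateGrowth_of_isEntireModularForm {r : ℝ} (hr : 0 ≤ r) {v : SL(2, ℤ) → ℂˣ}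
    (hv : IsMultiplierSystem r v) {h : ℍ → ℂ} (hh : IsEntireModularForm r v h) :
    HasModerateGrowth h := by
  have hc : Continuous (invariantNorm r h) := by
    have h1 : Continuous h := hh.1.1.continuous
    exact h1.norm.mul (UpperHalfPlane.continuous_im.rpow_const fun z => Or.inl z.im_pos.ne')
  have hO : invariantNorm r h =O[UpperHalfPlane.atImInfty] fun z => z.im ^ (r / 2) := by
    have h1 : h =O[UpperHalfPlane.atImInfty] (1 : ℍ → ℝ) := hh.2
    have h2 := h1.norm_left.mul (Asymptotics.isBigO_refl (fun z : ℍ => z.im ^ (r / 2))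
      UpperHalfPlane.atImInfty)
    simpa [invariantNorm] using! h2
  obtain ⟨C, hC⟩ := ModularGroup.exists_bound_of_invariant_of_isBigO hc (by positivity) hO
    fun γ z => by rw [invariantNorm_smul hh.1, norm_multiplier hv, one_mul]
  refine ⟨|C|, ⌈r⌉₊, abs_nonneg C, fun z => ?_⟩
  have hy := z.im_pos
  have h1 : ‖h z‖ * z.im ^ (r / 2) ≤ |C| * max z.im (1 / z.im) ^ (r / 2) := by
    have := hC z
    rw [Real.norm_of_nonneg (by rw [invariantNorm]; positivity)] at this
    exact this.trans (by gcongr; exact le_abs_self C)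
  have h2 : max z.im (1 / z.im) ≤ z.im * max 1 (1 / z.im) ^ 2 := by
    rcases le_total 1 (1 / z.im) with h | h
    · have h3 : z.im ≤ 1 := by rwa [le_div_iff₀ hy, one_mul] at h
      rw [max_eq_right h, max_eq_right (h3.trans h)]
      exact le_of_eq (by field_simp)
    · have h3 : 1 ≤ z.im := by rwa [div_le_iff₀ hy, one_mul] at h
      rw [max_eq_left h, max_eq_left (h.trans h3)]
      simp
  have hm : 1 ≤ max 1 (1 / z.im) := le_max_left _ _
  have h3 : max z.im (1 / z.im) ^ (r / 2) ≤ z.im ^ (r / 2) * max 1 (1 / z.im) ^ ⌈r⌉₊ := by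
    calc max z.im (1 / z.im) ^ (r / 2) ≤ (z.im * max 1 (1 / z.im) ^ 2) ^ (r / 2) := by gcongr
      _ = z.im ^ (r / 2) * max 1 (1 / z.im) ^ r := by
          rw [Real.mul_rpow hy.le (by positivity), ← Real.rpow_natCast, ← Real.rpow_mul (by positivity)]
          congr 2
          push_cast
          ring
      _ ≤ z.im ^ (r / 2) * max 1 (1 / z.im) ^ ⌈r⌉₊ := by
          gcongr
          rw [← Real.rpow_natCast]
          exact Real.rpow_le_rpow_of_exponent_le hm (Nat.le_ceil r)
  have h4 : 0 < z.im ^ (r / 2) := Real.rpow_pos_of_pos hy _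
  refine le_of_mul_le_mul_right (h1.trans ?_) h4
  calc _ ≤ |C| * (z.im ^ (r / 2) * max 1 (1 / z.im) ^ ⌈r⌉₊) := by gcongr
    _ = _ := by ring

/-! ### The disc coordinate on the upper half-plane -/

theorem im_upperOfDisc {w : ℂ} :
    (I * (1 + w) / (1 - w)).im = (1 - ‖w‖ ^ 2) / ‖1 - w‖ ^ 2 := by
  rw [← normSq_eq_norm_sq, ← normSq_eq_norm_sq, div_im]
  simp only [mul_im, mul_re, I_re, I_im, add_re, add_im, one_re, one_im, sub_re, sub_im]
  rw [← sub_div]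
  congr 1
  rw [normSq_apply]
  ring

theorem one_sub_norm_le (w : ℂ) : 1 - ‖w‖ ≤ ‖1 - w‖ := by
  simpa using norm_sub_norm_le (1 : ℂ) w

theorem im_upperOfDisc_pos {w : ℂ} (hw : ‖w‖ < 1) : 0 < (I * (1 + w) / (1 - w)).im := by
  rw [im_upperOfDisc]
  have h1 := one_sub_norm_le w
  have h2 : 0 < ‖1 - w‖ := by linarith
  have h3 : 0 < 1 - ‖w‖ ^ 2 := by nlinarith [norm_nonneg w]
  positivity

/-- The point of the upper half-plane with coordinate `w`. -/
def upperOfDisc (w : ℂ) : ℍ := UpperHalfPlane.ofComplex (I * (1 + w) / (1 - w))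

theorem coe_upperOfDisc {w : ℂ} (hw : ‖w‖ < 1) :
    (upperOfDisc w : ℂ) = I * (1 + w) / (1 - w) := by
  rw [upperOfDisc, UpperHalfPlane.ofComplex_apply_of_im_pos (im_upperOfDisc_pos hw)]

theorem upperDisc_upperOfDisc {w : ℂ} (hw : ‖w‖ < 1) : upperDisc (upperOfDisc w) = w := by
  have h := one_sub_ne_zero_of_norm_lt hw
  have hI := I_ne_zero
  rw [upperDisc, coe_upperOfDisc hw, upper_add_I h, upper_sub_I h]
  field_simp

theorem upperOfDisc_upperDisc (ζ : ℍ) : upperOfDisc (upperDisc ζ) = ζ := by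
  apply UpperHalfPlane.ext
  rw [coe_upperOfDisc (norm_upperDisc_lt_one ζ), one_sub_upperDisc]
  have h := upper_add_I_ne_zero ζ
  have hI := I_ne_zero
  rw [upperDisc]
  field_simp
  ring

/-- The imaginary part is `(1 - |w|²)/|1 - w|²`, which is at least `(1 - |w|)/4`. -/
theorem HasModerateGrowth.disc_bound {g : ℍ → ℂ} (hg : HasModerateGrowth g) :
    ∃ (C : ℝ) (k : ℕ), 0 ≤ C ∧ ∀ w : ℂ, ‖w‖ < 1 →
      ‖g (upperOfDisc w)‖ ≤ C * ((1 - ‖w‖) ^ k)⁻¹ := by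
  obtain ⟨C, k, hC, h⟩ := hg
  refine ⟨C * 4 ^ k, k, by positivity, fun w hw => (h _).trans ?_⟩
  have h1 := one_sub_norm_le w
  have h0 := norm_nonneg w
  have hs : 0 < 1 - ‖w‖ := by linarith
  have h2 : max 1 (1 / (upperOfDisc w).im) ≤ 4 / (1 - ‖w‖) := by
    refine max_le ?_ ?_
    · rw [le_div_iff₀ hs]; linarith
    · rw [← UpperHalfPlane.coe_im, coe_upperOfDisc hw, im_upperOfDisc, one_div_div]
      have h3 : ‖1 - w‖ ≤ 2 := (norm_sub_le _ _).trans (by rw [norm_one]; linarith)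
      have h4 : 1 - ‖w‖ ≤ 1 - ‖w‖ ^ 2 := by nlinarith
      have h5 : ‖1 - w‖ ^ 2 ≤ 4 := by nlinarith [norm_nonneg (1 - w)]
      gcongr
  calc C * max 1 (1 / (upperOfDisc w).im) ^ k ≤ C * (4 / (1 - ‖w‖)) ^ k := by gcongr
    _ = _ := by rw [div_pow]; ring

theorem differentiableOn_comp_upperOfDisc {g : ℍ → ℂ} (hg : MDifferentiable 𝓘(ℂ) 𝓘(ℂ) g) :
    DifferentiableOn ℂ (fun w => g (upperOfDisc w)) (ball 0 1) := by
  have h1 := UpperHalfPlane.mdifferentiable_iff.1 hg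
  have h2 : DifferentiableOn ℂ (fun w : ℂ => I * (1 + w) / (1 - w)) (ball 0 1) :=
    DifferentiableOn.div (by fun_prop) (by fun_prop) fun w hw =>
      one_sub_ne_zero_of_norm_lt (mem_ball_zero_iff.1 hw)
  exact h1.comp h2 fun w hw => im_upperOfDisc_pos (mem_ball_zero_iff.1 hw)

theorem plusDisc_eq {r : ℝ} {h : ℍ → ℂ} {w : ℂ} (hw : ‖w‖ < 1) :
    plusDisc r h w = (-2 * I / (1 - w)) ^ (r : ℂ) * h (upperOfDisc w) := by
  have h1 : -I - I * (1 + w) / (1 - w) = -2 * I / (1 - w) := by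
    have h2 := upper_add_I (one_sub_ne_zero_of_norm_lt hw)
    linear_combination -h2
  rw [plusDisc, plusFun, h1, upperOfDisc]

theorem im_neg_two_I_div_neg {w : ℂ} (hw : ‖w‖ < 1) : (-2 * I / (1 - w)).im < 0 := by
  have h2 := upper_add_I (one_sub_ne_zero_of_norm_lt hw)
  have h3 := congrArg Complex.im h2
  have h4 := im_upperOfDisc_pos hw
  rw [add_im, I_im] at h3
  rw [show -2 * I / (1 - w) = -(2 * I / (1 - w)) by ring, neg_im]
  linarith

theorem differentiableOn_plusDisc {r : ℝ} {h : ℍ → ℂ} (hh : MDifferentiable 𝓘(ℂ) 𝓘(ℂ) h) :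
    DifferentiableOn ℂ (plusDisc r h) (ball 0 1) := by
  refine DifferentiableOn.congr (f := fun w => (-2 * I / (1 - w)) ^ (r : ℂ) * h (upperOfDisc w))
    ?_ fun w hw => plusDisc_eq (mem_ball_zero_iff.1 hw)
  refine DifferentiableOn.mul (fun w hw => ?_) (differentiableOn_comp_upperOfDisc hh)
  have hw' := mem_ball_zero_iff.1 hw
  have h1 : DifferentiableAt ℂ (fun w : ℂ => -2 * I / (1 - w)) w :=
    DifferentiableAt.div (by fun_prop) (by fun_prop) (one_sub_ne_zero_of_norm_lt hw')
  exact (h1.cpow_const (Or.inr (im_neg_two_I_div_neg hw').ne)).differentiableWithinAt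

theorem isPolyBounded_taylorCoeff_plusDisc {r : ℝ} (hr : 0 ≤ r) {h : ℍ → ℂ}
    (hh : MDifferentiable 𝓘(ℂ) 𝓘(ℂ) h) (hg : HasModerateGrowth h) :
    IsPolyBounded (taylorCoeff (plusDisc r h)) := by
  obtain ⟨C, k, hC, hb⟩ := hg.disc_bound
  refine isPolyBounded_taylorCoeff (differentiableOn_plusDisc hh) (C := 2 ^ ⌈r⌉₊ * C)
    (K := ⌈r⌉₊ + k) fun w hw => ?_
  have hw' := mem_ball_zero_iff.1 hw
  have hs : 0 < 1 - ‖w‖ := by linarith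
  have h1 := one_sub_norm_le w
  rw [plusDisc_eq hw', norm_mul, norm_cpow_real, norm_div, norm_mul, norm_neg, norm_I,
    Complex.norm_ofNat, mul_one]
  have h2 : (2 / ‖1 - w‖) ^ r ≤ (2 / (1 - ‖w‖)) ^ ⌈r⌉₊ := by
    calc (2 / ‖1 - w‖) ^ r ≤ (2 / (1 - ‖w‖)) ^ r := by gcongr
      _ ≤ (2 / (1 - ‖w‖)) ^ ⌈r⌉₊ := by
        rw [← Real.rpow_natCast]
        refine Real.rpow_le_rpow_of_exponent_le ?_ (Nat.le_ceil r)
        rw [le_div_iff₀ hs]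
        linarith [norm_nonneg w]
  calc _ ≤ (2 / (1 - ‖w‖)) ^ ⌈r⌉₊ * (C * ((1 - ‖w‖) ^ k)⁻¹) := by
        gcongr; exact hb w hw'
    _ = _ := by rw [div_pow, pow_add, mul_inv]; ring

/-! ### The Eisenstein series of weight two -/

/-- The multiple of the Eisenstein series `E₂` that transforms with the cocycle `-c (c z + d)`. -/
def quasiE2 (z : ℍ) : ℂ := 2 * riemannZeta 2 / (2 * Real.pi * I) * EisensteinSeries.E2 z

/-- The constant in `quasiE2` normalises the defect of `E₂` so that it coincides with that of the
Cauchy kernels in `lowerSlash_cauchyVec`. -/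
theorem quasiE2_smul (γ : SL(2, ℤ)) (z : ℍ) :
    quasiE2 (γ • z) = autFactor γ z ^ 2 * quasiE2 z - (γ 1 0 : ℂ) * autFactor γ z := by
  have h := congrFun (EisensteinSeries.E2_slash_action γ) z
  have hj := autFactor_upper_ne_zero γ z
  have hd : UpperHalfPlane.denom γ z = autFactor γ z := by
    simp [UpperHalfPlane.denom, autFactor]
  have hz : riemannZeta 2 ≠ 0 := riemannZeta_ne_zero_of_one_lt_re (by simp)
  have hpi : (Real.pi : ℂ) ≠ 0 := by exact_mod_cast Real.pi_ne_zero
  have hI := I_ne_zero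
  rw [ModularForm.SL_slash_apply, hd, Pi.sub_apply, Pi.smul_apply, smul_eq_mul,
    EisensteinSeries.D2, hd, zpow_neg, mul_inv_eq_iff_eq_mul₀ (zpow_ne_zero _ hj)] at h
  rw [quasiE2, quasiE2, h]
  norm_cast
  field_simp

theorem mdifferentiable_quasiE2 : MDifferentiable 𝓘(ℂ) 𝓘(ℂ) quasiE2 :=
  MDifferentiable.const_smul (2 * riemannZeta 2 / (2 * Real.pi * I)) E2_mdifferentiable

theorem norm_autFactor_pos (γ : SL(2, ℤ)) (z : ℍ) : 0 < ‖autFactor γ z‖ :=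
  norm_pos_iff.2 (autFactor_upper_ne_zero γ z)

theorem abs_mul_im_le_norm_autFactor (γ : SL(2, ℤ)) (z : ℍ) :
    |(γ 1 0 : ℝ)| * z.im ≤ ‖autFactor γ z‖ := by
  have h := abs_im_le_norm (autFactor γ z)
  have h2 : (autFactor γ z).im = (γ 1 0 : ℝ) * z.im := by simp [autFactor]
  rwa [h2, abs_mul, abs_of_pos z.im_pos] at h

/-- The function is bounded on the fundamental domain. Transporting the bound back to `z` involves
`1/|cz + d|` and `|c|/|cz + d|`, both at most `1/y` when `c ≠ 0`; for `c = 0` they are `1` and `0`.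
-/
theorem hasModerateGrowth_quasiE2 : HasModerateGrowth quasiE2 := by
  have hO : quasiE2 =O[UpperHalfPlane.atImInfty] fun z => z.im ^ (0 : ℝ) := by
    have h1 : EisensteinSeries.E2 =O[UpperHalfPlane.atImInfty] (1 : ℍ → ℝ) :=
      EisensteinSeries.isBoundedAtImInfty_E2
    have h2 := h1.const_mul_left (2 * riemannZeta 2 / (2 * Real.pi * I))
    simp only [Real.rpow_zero]
    exact h2
  obtain ⟨B, hB⟩ := ModularGroup.exists_bound_fundamental_domain_of_isBigO
    mdifferentiable_quasiE2.continuous hO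
  have hB0 : 0 ≤ |B| := abs_nonneg B
  refine ⟨|B| + 1, 2, by positivity, fun z => ?_⟩
  obtain ⟨γ, hγ⟩ := ModularGroup.exists_smul_mem_fd z
  have h1 : ‖quasiE2 (γ • z)‖ ≤ |B| := by
    have := hB _ hγ
    rw [Real.rpow_zero, mul_one] at this
    exact this.trans (le_abs_self B)
  have hj := norm_autFactor_pos γ z
  have hjne := autFactor_upper_ne_zero γ z
  set M := max 1 (1 / z.im) with hM
  have hM1 : 1 ≤ M := le_max_left _ _
  have hMy : 1 / z.im ≤ M := le_max_right _ _
  have h2 : quasiE2 z = (quasiE2 (γ • z) + (γ 1 0 : ℂ) * autFactor γ z) / autFactor γ z ^ 2 := by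
    rw [quasiE2_smul]
    field_simp
    ring
  have h3 : ‖quasiE2 z‖ ≤ |B| * (1 / ‖autFactor γ z‖) ^ 2 +
      |(γ 1 0 : ℝ)| * (1 / ‖autFactor γ z‖) := by
    rw [h2, norm_div, norm_pow]
    have h4 : ‖quasiE2 (γ • z) + (γ 1 0 : ℂ) * autFactor γ z‖ ≤
        |B| + |(γ 1 0 : ℝ)| * ‖autFactor γ z‖ := by
      refine (norm_add_le _ _).trans ?_
      rw [norm_mul, Complex.norm_intCast]
      gcongr
    calc _ ≤ (|B| + |(γ 1 0 : ℝ)| * ‖autFactor γ z‖) / ‖autFactor γ z‖ ^ 2 := by gcongr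
      _ = _ := by field_simp
  have h5 : 1 / ‖autFactor γ z‖ ≤ M ∧ |(γ 1 0 : ℝ)| * (1 / ‖autFactor γ z‖) ≤ M := by
    by_cases hc : γ 1 0 = 0
    · have hdet := det_eq_one γ
      rw [hc, Int.cast_zero, mul_zero, sub_zero] at hdet
      have hd : ‖((γ 1 1 : ℤ) : ℂ)‖ = 1 := by
        have h6 : γ 0 0 * γ 1 1 = 1 := by exact_mod_cast hdet
        rcases Int.isUnit_iff.1 (IsUnit.of_mul_eq_one_right _ h6) with h | h <;> simp [h]
      have hj1 : ‖autFactor γ z‖ = 1 := by simpa [autFactor, hc] using hd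
      rw [hj1, hc]
      simp [hM1, zero_le_one.trans hM1]
    · have hc1 : (1 : ℝ) ≤ |(γ 1 0 : ℝ)| := by exact_mod_cast Int.one_le_abs hc
      have h6 := abs_mul_im_le_norm_autFactor γ z
      have hy := z.im_pos
      refine ⟨(one_div_le_one_div_of_le hy ?_).trans hMy, le_trans ?_ hMy⟩
      · nlinarith
      · rw [mul_one_div, div_le_div_iff₀ hj hy]
        linarith
  have h6 : 0 ≤ 1 / ‖autFactor γ z‖ := by positivity
  calc ‖quasiE2 z‖ ≤ |B| * (1 / ‖autFactor γ z‖) ^ 2 +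
        |(γ 1 0 : ℝ)| * (1 / ‖autFactor γ z‖) := h3
    _ ≤ |B| * M ^ 2 + M := by gcongr; exacts [h5.1, h5.2]
    _ ≤ (|B| + 1) * M ^ 2 := by nlinarith

/-! ### Forms of weight zero -/

theorem isModularForm_zero_smul {v : SL(2, ℤ) → ℂˣ} {h : ℍ → ℂ} (hh : IsModularForm 0 v h)
    (γ : SL(2, ℤ)) (z : ℍ) : h (γ • z) = (v γ : ℂ) * h z := by
  rw [hh.2, ofReal_zero, cpow_zero, mul_one]

/-- In weight zero `v` is a genuine character, and `S` and `ST` have orders dividing `12`. -/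
theorem multiplier_zero_pow_twelve {v : SL(2, ℤ) → ℂˣ} {h : ℍ → ℂ} (hh : IsModularForm 0 v h)
    {z : ℍ} (hz : h z ≠ 0) (γ : SL(2, ℤ)) : (v γ : ℂ) ^ 12 = 1 := by
  have hmul : ∀ γ δ, (v (γ * δ) : ℂ) = v γ * v δ := by
    intro γ δ
    refine mul_right_cancel₀ hz ?_
    rw [← isModularForm_zero_smul hh, mul_smul, isModularForm_zero_smul hh,
      isModularForm_zero_smul hh, mul_assoc]
  have hone : (v 1 : ℂ) = 1 := by
    refine mul_right_cancel₀ hz ?_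
    rw [← isModularForm_zero_smul hh, one_smul, one_mul]
  let χ : SL(2, ℤ) →* ℂ := { toFun := fun γ => v γ, map_one' := hone, map_mul' := hmul }
  have hS : χ ModularGroup.S ^ 12 = 1 := by
    rw [show 12 = 4 * 3 from rfl, pow_mul, ← map_pow, modular_S_pow_four, map_one, one_pow]
  have hST : χ (ModularGroup.S * ModularGroup.T) ^ 12 = 1 := by
    rw [show 12 = 6 * 2 from rfl, pow_mul, ← map_pow, modular_ST_pow_six, map_one, one_pow]
  have : (powMonoidHom 12).comp χ = 1 := by
    refine MonoidHom.eq_of_eqOn_dense SpecialLinearGroup.SL2Z_generators ?_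
    rintro δ (rfl | rfl)
    · exact hS
    · rw [map_mul, mul_pow, hS, one_mul] at hST
      exact hST
  exact DFunLike.congr_fun this γ

/-- Entire modular forms of weight zero are constant. -/
theorem exists_eq_const_of_weight_zero {v : SL(2, ℤ) → ℂˣ} {h : ℍ → ℂ}
    (hh : IsEntireModularForm 0 v h) : ∃ c, ∀ z, h z = c := by
  by_cases h0 : ∀ z, h z = 0
  · exact ⟨0, h0⟩
  push Not at h0
  obtain ⟨z, hz⟩ := h0
  -- The twelfth power removes the character, so `h ^ 12` is a level one form of weight zero and
  -- hence constant.
  have hinv : ∀ γ : SL(2, ℤ), SlashAction.map (0 : ℤ) γ (h ^ 12) = h ^ 12 := by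
    intro γ
    funext τ
    rw [ModularForm.SL_slash_apply, Pi.pow_apply, isModularForm_zero_smul hh.1, mul_pow,
      multiplier_zero_pow_twelve hh.1 hz]
    simp
  have hbdd : UpperHalfPlane.IsBoundedAtImInfty (h ^ 12) := by
    have h1 : h =O[UpperHalfPlane.atImInfty] (1 : ℍ → ℝ) := hh.2
    have h2 := h1.pow 12
    simp only [Pi.one_apply, one_pow] at h2
    exact h2
  let F : ModularForm 𝒮ℒ 0 :=
    { toFun := h ^ 12
      slash_action_eq' := by
        rintro _ ⟨γ, rfl⟩
        exact hinv γ
      holo' := hh.1.1.pow 12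
      bdd_at_cusps' := by
        intro c hc
        rw [OnePoint.isBoundedAt_iff_forall_SL2Z hc]
        intro γ _
        rw [hinv γ]
        exact hbdd }
  obtain ⟨c, hc⟩ := ModularFormClass.levelOne_weight_zero_const F
  have hc' : ∀ z, h z ^ 12 = c := fun z => congrFun hc z
  -- All values of `h` are roots of one polynomial, and a continuous function on a connected space
  -- with finitely many values is constant.
  have hfin : (Set.range h).Finite := by
    refine (Polynomial.X ^ 12 - Polynomial.C c : Polynomial ℂ).rootSet_finite ℂ |>.subset ?_
    rintro _ ⟨z, rfl⟩
    rw [Polynomial.mem_rootSet]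
    refine ⟨(Polynomial.monic_X_pow_sub_C c (by norm_num)).ne_zero, ?_⟩
    simp [hc']
  have hsub : (Set.range h).Subsingleton :=
    hfin.countable.isTotallyDisconnected _ subset_rfl (isPreconnected_range hh.1.1.continuous)
  exact ⟨h z, fun w => hsub ⟨w, rfl⟩ ⟨z, rfl⟩⟩

theorem multiplier_zero_eq_one {v : SL(2, ℤ) → ℂˣ} {h : ℍ → ℂ} (hh : IsEntireModularForm 0 v h)
    {z : ℍ} (hz : h z ≠ 0) (γ : SL(2, ℤ)) : (v γ : ℂ) = 1 := by
  obtain ⟨c, hc⟩ := exists_eq_const_of_weight_zero hh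
  refine mul_right_cancel₀ hz ?_
  rw [← isModularForm_zero_smul hh.1, hc, hc, one_mul]

/-! ### Kernel vectors of positive weight -/

/-- The vector `t ↦ (ζ - t)^(-r)`. -/
def kernelVec (r : ℝ) (ζ : ℍ) (t : LowerHalfPlane) : ℂ := ((ζ : ℂ) - t) ^ (-(r : ℂ))

/-- The case `s = -r` of `lowerPow_mul_cpow`. The scalar is the one relating `h (γ • ζ)` to `h ζ`,
which is the source of the invariance of `[h, ·]_r`. -/
theorem lowerSlash_kernelVec (r : ℝ) (v : SL(2, ℤ) → ℂˣ) (γ : SL(2, ℤ)) (ζ : ℍ) :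
    lowerSlash r v γ (kernelVec r (γ • ζ)) =
      ((v γ : ℂ) * autFactor γ ζ ^ (r : ℂ)) • kernelVec r ζ := by
  funext t
  have h := lowerPow_mul_cpow γ ζ t (-r)
  rw [ofReal_neg, neg_neg] at h
  rw [lowerSlash, kernelVec, mul_assoc, h, Pi.smul_apply, kernelVec, smul_eq_mul, mul_assoc]

theorem discFun_kernelVec (r : ℝ) (ζ : ℍ) {W : ℂ} (hW : W ∈ ball (0 : ℂ) 1) :
    discFun r (kernelVec r ζ) W =
      (1 - upperDisc ζ) ^ (r : ℂ) * (1 - upperDisc ζ * W) ^ (-(r : ℂ)) := by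
  have h := upper_sub_lower_cpow ζ ⟨_, im_lowerOfDisc_neg hW⟩ (-(r : ℂ))
  simp only [discOfLower_lowerOfDisc (sub_one_ne_zero_of_mem_ball hW)] at h
  rw [discFun_eq hW, kernelVec]
  have k1 := cpow_mul_cpow_neg (I_sub_ne_zero (im_lowerOfDisc_neg hW)) r
  have k2 := cpow_mul_cpow_neg (one_sub_ne_zero_of_norm_lt (norm_upperDisc_lt_one ζ)) r
  generalize (I - I * (W + 1) / (W - 1)) ^ (r : ℂ) = A at *
  generalize (I - I * (W + 1) / (W - 1)) ^ (-(r : ℂ)) = A' at *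
  generalize (1 - upperDisc ζ) ^ (r : ℂ) = B at *
  generalize (1 - upperDisc ζ) ^ (-(r : ℂ)) = B' at *
  generalize ((ζ : ℂ) - I * (W + 1) / (W - 1)) ^ (-(r : ℂ)) = D at *
  generalize (1 - upperDisc ζ * W) ^ (-(r : ℂ)) = E at *
  linear_combination (-A * D) * k2 + A * B * h + B * E * k1

theorem kernelVec_mem (r : ℝ) (ζ : ℍ) : kernelVec r ζ ∈ smoothSubmodule r := by
  have hU : closedBall (0 : ℂ) 1 ⊆ {W | 1 - upperDisc ζ * W ∈ slitPlane} := fun W hW =>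
    mem_slitPlane_one_sub_mul (norm_mul_lt_one (norm_upperDisc_lt_one ζ) (by simpa using hW))
  have hd := (differentiableOn_cocycle (upperDisc ζ) (-(r : ℂ))).const_mul
    ((1 - upperDisc ζ) ^ (r : ℂ))
  rw [eq_ofDisc fun W hW => discFun_kernelVec r ζ hW]
  exact ofDisc_mem_smoothSubmodule r (hd.mono (ball_subset_closedBall.trans hU))
    (((hd.contDiffOn (isOpen_cocycle_domain _)).restrict_scalars ℝ).mono hU)

/-- The binomial coefficients `(r)_n/n!` are the inverses of the coefficients of `₂F₁(1, 1; r; ·)`,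
so the pairing undoes them and reproduces `h`. -/
theorem hasSum_one_sub_cpow (r : ℝ) {y : ℂ} (hy : ‖y‖ < 1) :
    HasSum (fun n => (hyperCoeff r n)⁻¹ * y ^ n) ((1 - y) ^ (-(r : ℂ))) := by
  have h := (Complex.one_div_one_sub_cpow_hasFPowerSeriesOnBall_zero (r : ℂ)).hasSum (y := y)
    (by simpa [edist_eq_enorm_sub, ← ofReal_norm] using hy)
  rw [zero_add, one_div, ← cpow_neg] at h
  convert! h using 2 with n
  rw [FormalMultilinearSeries.ofScalars_apply_eq, smul_eq_mul]
  congr 1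
  have h1 := Ring.factorial_nsmul_multichoose_eq_ascPochhammer (r : ℂ) n
  rw [Polynomial.ascPochhammer_smeval_eq_eval, nsmul_eq_mul] at h1
  have h2 : (n.factorial : ℂ) ≠ 0 := by exact_mod_cast n.factorial_ne_zero
  rw [hyperCoeff, mul_inv, inv_inv, ← h1, Ring.choose, ← mul_assoc, inv_mul_cancel₀ h2, one_mul]
  congr 1
  ring

theorem coef_kernelVec (r : ℝ) (ζ : ℍ) (n : ℕ) : coef r (kernelVec r ζ) n =
    (1 - upperDisc ζ) ^ (r : ℂ) * ((hyperCoeff r n)⁻¹ * upperDisc ζ ^ n) := by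
  refine taylorCoeff_eq_of_hasSum
    (a := fun n => (1 - upperDisc ζ) ^ (r : ℂ) * ((hyperCoeff r n)⁻¹ * upperDisc ζ ^ n)) one_pos
    (fun W hW => ?_) n
  rw [discFun_kernelVec r ζ hW]
  have h := (hasSum_one_sub_cpow r (norm_mul_lt_one (norm_upperDisc_lt_one ζ)
    (mem_ball_zero_iff.1 hW).le)).mul_left ((1 - upperDisc ζ) ^ (r : ℂ))
  convert! h using 2 with n
  rw [mul_pow]
  ring

/-- Values on kernel vectors form a generating function, which determines `l` when `r > 0`, as the
hypergeometric coefficients are then non-zero. -/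
theorem hasSum_seqForm_kernelVec (r : ℝ) {l : ℕ → ℂ} (hl : IsPolyBounded l) (ζ : ℍ) :
    HasSum (fun n => l n * (hyperCoeff r n)⁻¹ * upperDisc ζ ^ n)
      ((1 - upperDisc ζ) ^ (-(r : ℂ)) * seqForm r l (kernelVec r ζ)) := by
  have k := cpow_mul_cpow_neg (one_sub_ne_zero_of_norm_lt (norm_upperDisc_lt_one ζ)) r
  convert! (hasSum_seqForm hl (kernelVec_mem r ζ)).mul_left
    ((1 - upperDisc ζ) ^ (-(r : ℂ))) using 2 with n
  rw [coef_kernelVec]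
  linear_combination (-l n * (hyperCoeff r n)⁻¹ * upperDisc ζ ^ n) * k

theorem neg_two_I_cpow (ζ : ℍ) (s : ℂ) :
    (1 - upperDisc ζ) ^ s * (-2 * I / (1 - upperDisc ζ)) ^ s = (-2 * I) ^ s := by
  have hx := norm_upperDisc_lt_one ζ
  have h1 := one_sub_ne_zero_of_norm_lt hx
  have h2 : (-2 * I : ℂ) ≠ 0 := by simp
  have h3 : -2 * I / (1 - upperDisc ζ) ≠ 0 := div_ne_zero h2 h1
  have key : log (1 - upperDisc ζ) + log (-2 * I / (1 - upperDisc ζ)) = log (-2 * I) := by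
    refine exp_injOn_strip ?_ ?_
    · rw [exp_add, exp_log h1, exp_log h2, exp_log h3]
      field_simp
    · have h4 := abs_lt.1 (abs_arg_lt_pi_div_two_iff.2 (Or.inl (re_one_sub_pos hx)))
      have h5 := arg_neg_iff.2 (im_neg_two_I_div_neg hx)
      have h6 := neg_pi_lt_arg (-2 * I / (1 - upperDisc ζ))
      have h7 := arg_neg_iff.2 (show (-2 * I : ℂ).im < 0 by simp)
      have h8 := neg_pi_lt_arg (-2 * I)
      simp only [add_im, log_im]
      rw [abs_lt]
      constructor <;> linarith
  rw [cpow_def_of_ne_zero h1, cpow_def_of_ne_zero h2, cpow_def_of_ne_zero h3, ← exp_add]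
  congr 1
  linear_combination s * key

/-- The form `[h, ·]_r` reproduces `h` on the kernel vectors. -/
theorem seqForm_kernelVec {r : ℝ} (hr : 0 < r) {h : ℍ → ℂ}
    (hh : DifferentiableOn ℂ (plusDisc r h) (ball 0 1))
    (hl : IsPolyBounded fun n => hyperCoeff r n * taylorCoeff (plusDisc r h) n) (ζ : ℍ) :
    seqForm r (fun n => hyperCoeff r n * taylorCoeff (plusDisc r h) n) (kernelVec r ζ) =
      (-2 * I) ^ (r : ℂ) * h ζ := by
  have hx := norm_upperDisc_lt_one ζ
  have h1 := hasSum_seqForm_kernelVec r hl ζ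
  have h2 := hasSum_taylorCoeff hh (mem_ball_zero_iff.2 hx)
  have h3 := h1.unique (h2.congr_fun fun n => by
    field_simp [hyperCoeff_ne_zero hr n])
  rw [plusDisc_eq hx, upperOfDisc_upperDisc] at h3
  have k := cpow_mul_cpow_neg (one_sub_ne_zero_of_norm_lt hx) r
  rw [← neg_two_I_cpow ζ]
  linear_combination (1 - upperDisc ζ) ^ (r : ℂ) * h3 -
    (seqForm r (fun n => hyperCoeff r n * taylorCoeff (plusDisc r h) n) (kernelVec r ζ)) * k

theorem eq_of_hasSum_upperDisc {a b : ℕ → ℂ} {S : ℍ → ℂ}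
    (ha : ∀ ζ, HasSum (fun n => a n * upperDisc ζ ^ n) (S ζ))
    (hb : ∀ ζ, HasSum (fun n => b n * upperDisc ζ ^ n) (S ζ)) : a = b := by
  have h : ∀ {c : ℕ → ℂ}, (∀ ζ, HasSum (fun n => c n * upperDisc ζ ^ n) (S ζ)) → ∀ n,
      taylorCoeff (fun x => S (upperOfDisc x)) n = c n := by
    intro c hc
    refine taylorCoeff_eq_of_hasSum one_pos fun x hx => ?_
    have := hc (upperOfDisc x)
    rwa [upperDisc_upperOfDisc (mem_ball_zero_iff.1 hx)] at this
  funext n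
  rw [← h ha, h hb]

/-- The form `[h, ·]_r` is invariant under the modular group. -/
theorem seqForm_lowerSlash {r : ℝ} (hr : 0 < r) {v : SL(2, ℤ) → ℂˣ} {h : ℍ → ℂ}
    (hh : IsModularForm r v h)
    (hl : IsPolyBounded fun n => hyperCoeff r n * taylorCoeff (plusDisc r h) n)
    (γ : SL(2, ℤ)) {f : LowerHalfPlane → ℂ} (hf : f ∈ smoothSubmodule r) :
    seqForm r (fun n => hyperCoeff r n * taylorCoeff (plusDisc r h) n) (lowerSlash r v γ f) =
      seqForm r (fun n => hyperCoeff r n * taylorCoeff (plusDisc r h) n) f := by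
  have hd := differentiableOn_plusDisc (r := r) hh.1
  obtain ⟨d, hdp, H⟩ := exists_seqForm_lowerSlash v γ hl (r := r)
  -- Only kernel vectors are compared here, where the transformation law of `h` suffices; equality
  -- of the generating functions then gives equality of the forms on all smooth vectors.
  have hker : ∀ ζ, seqForm r d (kernelVec r ζ) =
      seqForm r (fun n => hyperCoeff r n * taylorCoeff (plusDisc r h) n) (kernelVec r ζ) := by
    intro ζ
    obtain ⟨η, rfl⟩ : ∃ η, γ • η = ζ := ⟨γ⁻¹ • ζ, smul_inv_smul γ ζ⟩
    rw [← H _ (kernelVec_mem r _), lowerSlash_kernelVec, seqForm_smul hl (kernelVec_mem r η),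
      seqForm_kernelVec hr hd hl, seqForm_kernelVec hr hd hl, hh.2]
    ring
  have h1 := eq_of_hasSum_upperDisc (hasSum_seqForm_kernelVec r hdp)
    fun ζ => hker ζ ▸ hasSum_seqForm_kernelVec r hl ζ
  have h2 : d = fun n => hyperCoeff r n * taylorCoeff (plusDisc r h) n := funext fun n =>
    mul_right_cancel₀ (inv_ne_zero (hyperCoeff_ne_zero hr n)) (congrFun h1 n)
  rw [H f hf, h2]

/-! ### Kernel vectors of weight zero -/

/-- The vector `t ↦ (ζ - t)⁻¹`. -/
def cauchyVec (ζ : ℍ) (t : LowerHalfPlane) : ℂ := ((ζ : ℂ) - t)⁻¹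

theorem lowerSlash_zero {v : SL(2, ℤ) → ℂˣ} {γ : SL(2, ℤ)} (hv : (v γ : ℂ) = 1)
    (f : LowerHalfPlane → ℂ) (t : LowerHalfPlane) :
    lowerSlash 0 v γ f t = f (lowerMoebius γ t) := by
  simp [lowerSlash, lowerPow, hv]

/-- Here `(γζ - γt)⁻¹ = j(ζ) j(t)/(ζ - t)` with `j(z) = cz + d`, and `j(t) = j(ζ) - c(ζ - t)` splits
off the constant defect. -/
theorem lowerSlash_cauchyVec {v : SL(2, ℤ) → ℂˣ} {γ : SL(2, ℤ)} (hv : (v γ : ℂ) = 1) (ζ : ℍ) :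
    lowerSlash 0 v γ (cauchyVec (γ • ζ)) =
      (autFactor γ ζ ^ 2) • cauchyVec ζ - ((γ 1 0 : ℂ) * autFactor γ ζ) • 1 := by
  funext t
  have h1 := autFactor_lower_ne_zero γ t
  have h2 := upper_sub_lower_ne_zero ζ t
  have h3 : autFactor γ t = autFactor γ ζ - (γ 1 0 : ℂ) * (ζ - t) := by
    simp only [autFactor]; ring
  rw [lowerSlash_zero hv, cauchyVec, smul_sub_lowerMoebius, inv_div, Pi.sub_apply, Pi.smul_apply,
    Pi.smul_apply, Pi.one_apply, cauchyVec, h3]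
  simp only [smul_eq_mul]
  field_simp

theorem discFun_cauchyVec (ζ : ℍ) {W : ℂ} (hW : W ∈ ball (0 : ℂ) 1) :
    discFun 0 (cauchyVec ζ) W = (1 - upperDisc ζ) / (2 * I) *
      (1 - (1 - upperDisc ζ) * W * (1 - upperDisc ζ * W)⁻¹) := by
  have h1 := upper_sub_lower_ne_zero ζ ⟨_, im_lowerOfDisc_neg hW⟩
  have h2 := sub_one_ne_zero_of_mem_ball hW
  have hx := norm_upperDisc_lt_one ζ
  have h3 := one_sub_ne_zero_of_norm_lt hx
  have h4 := one_sub_ne_zero_of_norm_lt (norm_mul_lt_one hx (mem_ball_zero_iff.1 hW).le)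
  have hζ : (ζ : ℂ) = I * (1 + upperDisc ζ) / (1 - upperDisc ζ) := by
    rw [← coe_upperOfDisc hx, upperOfDisc_upperDisc]
  have hI := I_ne_zero
  have h5 : (ζ : ℂ) - I * (W + 1) / (W - 1) =
      2 * I * (1 - upperDisc ζ * W) / ((1 - upperDisc ζ) * (1 - W)) := by
    have h6 : 1 - W ≠ 0 := by rw [← neg_ne_zero, neg_sub]; exact h2
    rw [hζ, div_sub_div _ _ h3 h2, div_eq_div_iff (mul_ne_zero h3 h2) (mul_ne_zero h3 h6)]
    ring
  rw [discFun_eq hW, cauchyVec, ofReal_zero, cpow_zero, one_mul, h5, inv_div]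
  field_simp
  ring

theorem cauchyVec_mem (ζ : ℍ) : cauchyVec ζ ∈ smoothSubmodule 0 := by
  have hU : closedBall (0 : ℂ) 1 ⊆ {W | 1 - upperDisc ζ * W ∈ slitPlane} := fun W hW =>
    mem_slitPlane_one_sub_mul (norm_mul_lt_one (norm_upperDisc_lt_one ζ) (by simpa using hW))
  have hd : DifferentiableOn ℂ (fun W => (1 - upperDisc ζ) / (2 * I) *
      (1 - (1 - upperDisc ζ) * W * (1 - upperDisc ζ * W)⁻¹))
      {W | 1 - upperDisc ζ * W ∈ slitPlane} := by
    have h1 : DifferentiableOn ℂ (fun W => (1 - upperDisc ζ * W)⁻¹)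
        {W | 1 - upperDisc ζ * W ∈ slitPlane} :=
      DifferentiableOn.inv (by fun_prop) fun W hW => slitPlane_ne_zero hW
    fun_prop
  rw [eq_ofDisc fun W hW => discFun_cauchyVec ζ hW]
  exact ofDisc_mem_smoothSubmodule 0 (hd.mono (ball_subset_closedBall.trans hU))
    (((hd.contDiffOn (isOpen_cocycle_domain _)).restrict_scalars ℝ).mono hU)

theorem coef_cauchyVec (ζ : ℍ) : coef 0 (cauchyVec ζ) 0 = (1 - upperDisc ζ) / (2 * I) ∧
    ∀ n, coef 0 (cauchyVec ζ) (n + 1) = -((1 - upperDisc ζ) ^ 2 / (2 * I)) * upperDisc ζ ^ n := by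
  let a : ℕ → ℂ := fun n => Nat.casesOn n ((1 - upperDisc ζ) / (2 * I))
    fun n => -((1 - upperDisc ζ) ^ 2 / (2 * I)) * upperDisc ζ ^ n
  have h : ∀ n, coef 0 (cauchyVec ζ) n = a n := by
    refine taylorCoeff_eq_of_hasSum one_pos fun W hW => ?_
    rw [discFun_cauchyVec ζ hW]
    have h1 := (hasSum_geometric_of_norm_lt_one (norm_mul_lt_one (norm_upperDisc_lt_one ζ)
      (mem_ball_zero_iff.1 hW).le)).mul_left (-((1 - upperDisc ζ) ^ 2 / (2 * I)) * W)
    have h2 : HasSum (fun n => a (n + 1) * W ^ (n + 1))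
        (-((1 - upperDisc ζ) ^ 2 / (2 * I)) * W * (1 - upperDisc ζ * W)⁻¹) := by
      convert! h1 using 2 with n
      simp only [a, mul_pow, pow_succ]
      ring
    have h3 : a 0 * W ^ 0 + -((1 - upperDisc ζ) ^ 2 / (2 * I)) * W * (1 - upperDisc ζ * W)⁻¹ =
        (1 - upperDisc ζ) / (2 * I) *
          (1 - (1 - upperDisc ζ) * W * (1 - upperDisc ζ * W)⁻¹) := by
      have h0 : a 0 = (1 - upperDisc ζ) / (2 * I) := rfl
      rw [h0]
      ring
    rw [← h3]
    exact HasSum.zero_add (f := fun n => a n * W ^ n) h2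
  exact ⟨h 0, fun n => h (n + 1)⟩

/-- Together with `l 0`, which is the value at the constant vector, the values on Cauchy kernels
determine the form. -/
theorem hasSum_seqForm_cauchyVec {l : ℕ → ℂ} (hl : IsPolyBounded l) (ζ : ℍ) :
    HasSum (fun n => l (n + 1) * upperDisc ζ ^ n) (-(2 * I / (1 - upperDisc ζ) ^ 2) *
      (seqForm 0 l (cauchyVec ζ) - l 0 * ((1 - upperDisc ζ) / (2 * I)))) := by
  have h1 := (hasSum_nat_add_iff' 1).2 (hasSum_seqForm hl (cauchyVec_mem ζ))
  have h2 := h1.mul_left (-(2 * I / (1 - upperDisc ζ) ^ 2))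
  have h3 := one_sub_ne_zero_of_norm_lt (norm_upperDisc_lt_one ζ)
  have hI := I_ne_zero
  rw [Finset.sum_range_one, (coef_cauchyVec ζ).1] at h2
  convert! h2 using 2 with n
  rw [(coef_cauchyVec ζ).2]
  field_simp

/-- The generating function of the invariant form of weight zero. -/
def quasiGen (w : ℂ) : ℂ := (1 - w)⁻¹ - 2 * I / (1 - w) ^ 2 * quasiE2 (upperOfDisc w)

theorem differentiableOn_quasiGen : DifferentiableOn ℂ quasiGen (ball 0 1) := by
  have h : ∀ w ∈ ball (0 : ℂ) 1, 1 - w ≠ 0 := fun w hw =>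
    one_sub_ne_zero_of_norm_lt (mem_ball_zero_iff.1 hw)
  refine DifferentiableOn.sub (DifferentiableOn.inv (by fun_prop) h) (DifferentiableOn.mul
    (DifferentiableOn.div (by fun_prop) (by fun_prop) fun w hw => pow_ne_zero _ (h w hw))
    (differentiableOn_comp_upperOfDisc mdifferentiable_quasiE2))

/-- The coefficients of the invariant form of weight zero. -/
def quasiSeq (n : ℕ) : ℂ := Nat.casesOn n 1 (taylorCoeff quasiGen)

theorem quasiSeq_zero : quasiSeq 0 = 1 := rfl

theorem isPolyBounded_quasiSeq : IsPolyBounded quasiSeq := by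
  obtain ⟨C, k, hC, hb⟩ := hasModerateGrowth_quasiE2.disc_bound
  have h1 : IsPolyBounded (taylorCoeff quasiGen) := by
    refine isPolyBounded_taylorCoeff differentiableOn_quasiGen (C := 1 + 2 * C) (K := k + 2)
      fun w hw => ?_
    have hw' := mem_ball_zero_iff.1 hw
    have hs : 0 < 1 - ‖w‖ := by linarith
    have hs1 : 1 - ‖w‖ ≤ 1 := by linarith [norm_nonneg w]
    have h2 := one_sub_norm_le w
    have h3 : 0 < ‖1 - w‖ := hs.trans_le h2
    have h4 : (‖1 - w‖)⁻¹ ≤ ((1 - ‖w‖) ^ (k + 2))⁻¹ := by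
      refine inv_anti₀ (by positivity) (le_trans ?_ h2)
      exact pow_le_of_le_one hs.le hs1 (by omega)
    calc ‖quasiGen w‖ ≤ ‖1 - w‖⁻¹ + 2 / ‖1 - w‖ ^ 2 * ‖quasiE2 (upperOfDisc w)‖ := by
          refine (norm_sub_le _ _).trans (le_of_eq ?_)
          simp
      _ ≤ ((1 - ‖w‖) ^ (k + 2))⁻¹ + 2 / (1 - ‖w‖) ^ 2 * (C * ((1 - ‖w‖) ^ k)⁻¹) := by
          gcongr
          exact hb w hw'
      _ = _ := by
          field_simp
          ring
  obtain ⟨D, K, hD⟩ := h1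
  refine ⟨max 1 D, K, fun n => ?_⟩
  cases n with
  | zero => simp [quasiSeq]
  | succ n =>
    have hD0 : 0 ≤ D := by simpa using (norm_nonneg _).trans (hD 0)
    refine (hD n).trans ?_
    push_cast
    gcongr
    · exact le_max_right _ _
    · linarith

/-- `quasiGen` is the right-hand side of `hasSum_seqForm_cauchyVec` for `l 0 = 1` and prescribed
value `quasiE2 ζ`, so the claim follows by solving back. -/
theorem seqForm_quasiSeq_cauchyVec (ζ : ℍ) : seqForm 0 quasiSeq (cauchyVec ζ) = quasiE2 ζ := by
  have hx := norm_upperDisc_lt_one ζ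
  have h1 := hasSum_seqForm_cauchyVec isPolyBounded_quasiSeq ζ
  have h2 := h1.unique (hasSum_taylorCoeff differentiableOn_quasiGen (mem_ball_zero_iff.2 hx))
  rw [quasiGen, upperOfDisc_upperDisc] at h2
  have h3 := one_sub_ne_zero_of_norm_lt hx
  have hI := I_ne_zero
  rw [quasiSeq_zero] at h2
  generalize seqForm 0 quasiSeq (cauchyVec ζ) = A at *
  field_simp at h2
  linear_combination (I / 2) * h2 + (A - quasiE2 ζ) * I_sq

theorem discFun_one {W : ℂ} (hW : W ∈ ball (0 : ℂ) 1) : discFun 0 1 W = 1 := by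
  rw [discFun_eq hW]
  simp

theorem one_mem_smoothSubmodule : (1 : LowerHalfPlane → ℂ) ∈ smoothSubmodule 0 := by
  rw [eq_ofDisc (r := 0) (f := 1) (G := fun _ => 1) fun W hW => discFun_one hW]
  exact ofDisc_mem_smoothSubmodule 0 (differentiableOn_const _) contDiffOn_const

theorem seqForm_one (l : ℕ → ℂ) : seqForm 0 l 1 = l 0 := by
  have h : ∀ n, coef 0 1 n = if n = 0 then 1 else 0 := by
    refine taylorCoeff_eq_of_hasSum (a := fun n => if n = 0 then 1 else 0) one_pos fun W hW => ?_
    rw [discFun_one hW]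
    have := hasSum_single (f := fun n : ℕ => (if n = 0 then (1 : ℂ) else 0) * W ^ n) 0
      fun n hn => by rw [if_neg hn, zero_mul]
    simpa using this
  rw [seqForm, tsum_eq_single 0 fun n hn => by rw [h, if_neg hn, mul_zero], h, if_pos rfl, mul_one]

/-- The form of weight zero given by the Eisenstein series of weight two is invariant. -/
theorem seqForm_quasiSeq_lowerSlash {v : SL(2, ℤ) → ℂˣ} {γ : SL(2, ℤ)} (hv : (v γ : ℂ) = 1)
    {f : LowerHalfPlane → ℂ} (hf : f ∈ smoothSubmodule 0) :
    seqForm 0 quasiSeq (lowerSlash 0 v γ f) = seqForm 0 quasiSeq f := by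
  have hl := isPolyBounded_quasiSeq
  obtain ⟨d, hdp, H⟩ := exists_seqForm_lowerSlash v γ hl (r := 0)
  -- The coefficient at index zero is tested on the constant vector, which the action fixes when `v
  -- γ = 1`.
  have h0 : d 0 = quasiSeq 0 := by
    have h1 : lowerSlash 0 v γ 1 = 1 := funext fun t => lowerSlash_zero hv 1 t
    rw [← seqForm_one d, ← H 1 one_mem_smoothSubmodule, h1, seqForm_one]
  have hker : ∀ ζ, seqForm 0 d (cauchyVec ζ) = seqForm 0 quasiSeq (cauchyVec ζ) := by
    intro ζ
    obtain ⟨η, rfl⟩ : ∃ η, γ • η = ζ := ⟨γ⁻¹ • ζ, smul_inv_smul γ ζ⟩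
    rw [← H _ (cauchyVec_mem _), lowerSlash_cauchyVec hv,
      seqForm_sub hl (Submodule.smul_mem _ _ (cauchyVec_mem η))
        (Submodule.smul_mem _ _ one_mem_smoothSubmodule),
      seqForm_smul hl (cauchyVec_mem η), seqForm_smul hl one_mem_smoothSubmodule,
      seqForm_one, seqForm_quasiSeq_cauchyVec, seqForm_quasiSeq_cauchyVec, quasiE2_smul]
    simp [quasiSeq]
  have h1 := eq_of_hasSum_upperDisc (a := fun n => d (n + 1)) (b := fun n => quasiSeq (n + 1))
    (hasSum_seqForm_cauchyVec hdp)
    fun ζ => by rw [hker ζ, h0]; exact hasSum_seqForm_cauchyVec hl ζ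
  have h2 : d = quasiSeq := funext fun n => by
    cases n with
    | zero => exact h0
    | succ n => exact congrFun h1 n
  rw [H f hf, h2]

/-! ### Coinvariants -/

/-- An invariant form vanishes on the vectors with trivial class. -/
theorem seqForm_eq_zero_of_coinvariantClass {r : ℝ} {v : SL(2, ℤ) → ℂˣ} {l : ℕ → ℂ}
    (hl : IsPolyBounded l)
    (hinv : ∀ γ, ∀ f ∈ smoothSubmodule r, seqForm r l (lowerSlash r v γ f) = seqForm r l f)
    {c : SmoothModule r} (hc : coinvariantClass r v c = 0) : seqForm r l c.toFun = 0 := by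
  have h1 : c.toFun ∈ Submodule.span ℂ {g : LowerHalfPlane → ℂ |
      ∃ f ∈ smoothSubmodule r, ∃ γ : SL(2, ℤ), g = f - lowerSlash r v γ f} :=
    (Submodule.Quotient.mk_eq_zero (coinvariantKernel r v)).1 hc
  -- The span is taken among all functions, while `seqForm` is known to be linear only on smooth
  -- vectors, so smoothness is carried through the induction.
  have h2 : ∀ g ∈ Submodule.span ℂ {g : LowerHalfPlane → ℂ |
      ∃ f ∈ smoothSubmodule r, ∃ γ : SL(2, ℤ), g = f - lowerSlash r v γ f},
      g ∈ smoothSubmodule r ∧ seqForm r l g = 0 := by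
    intro g hg
    induction hg using Submodule.span_induction with
    | mem g hg =>
      obtain ⟨f, hf, γ, rfl⟩ := hg
      have hs := lowerSlash_mem_smoothSubmodule v γ hf
      exact ⟨Submodule.sub_mem _ hf hs, by rw [seqForm_sub hl hf hs, hinv γ f hf, sub_self]⟩
    | zero =>
      refine ⟨zero_mem _, ?_⟩
      have := seqForm_smul hl (zero_mem (smoothSubmodule r)) 0
      rwa [zero_mul, zero_smul] at this
    | add f g _ _ hf hg =>
      exact ⟨Submodule.add_mem _ hf.1 hg.1, by rw [seqForm_add hl hf.1 hg.1, hf.2, hg.2, add_zero]⟩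
    | smul a f _ hf =>
      exact ⟨Submodule.smul_mem _ _ hf.1, by rw [seqForm_smul hl hf.1, hf.2, mul_zero]⟩
  exact (h2 _ h1).2

end ModularCoinvariant

end

/-! ### Conclusion: the extended pairing and non-trivial coinvariants -/

theorem mainTheorem7 (r : ℝ) (hr : 0 ≤ r) (v : SL(2, ℤ) → ℂˣ)
    (hv : ModularCoinvariant.IsMultiplierSystem r v) :
    (0 < r → ∀ h : UpperHalfPlane → ℂ, ModularCoinvariant.IsEntireModularForm r v h →
      ∃! ℓ : ModularCoinvariant.SmoothModule r →L[ℂ] ℂ,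
        ModularCoinvariant.ExtendsAnalyticPairing r h ℓ) ∧
    ∀ c : ModularCoinvariant.SmoothModule r,
      (∃ (h : UpperHalfPlane → ℂ) (x : ℂ), ModularCoinvariant.IsEntireModularForm r v h ∧
        ModularCoinvariant.IsDualPairing r h c x ∧ x ≠ 0) →
      ModularCoinvariant.coinvariantClass r v c ≠ 0 := by
  open ModularCoinvariant in
  have hb : ∀ {h : UpperHalfPlane → ℂ}, 0 < r → IsEntireModularForm r v h →
      IsPolyBounded fun n => hyperCoeff r n * taylorCoeff (plusDisc r h) n := fun hr0 hh =>
    (isPolyBounded_hyperCoeff hr0).mul (isPolyBounded_taylorCoeff_plusDisc hr hh.1.1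
      (hasModerateGrowth_of_isEntireModularForm hr hv hh))
  refine ⟨fun hr0 h hh => ?_, ?_⟩
  · have key := extendsAnalyticPairing_iff hr0 (differentiableOn_plusDisc hh.1.1) (hb hr0 hh)
    exact ⟨_, (key _).2 rfl, fun ℓ hℓ => (key ℓ).1 hℓ⟩
  · rintro c ⟨h, x, hh, hx | hx, hx0⟩ hc
    · obtain ⟨hr0, ℓ, hℓ, rfl⟩ := hx
      rw [extendsAnalyticPairing_iff hr0 (differentiableOn_plusDisc hh.1.1) (hb hr0 hh)] at hℓ
      refine hx0 ?_
      rw [hℓ]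
      exact seqForm_eq_zero_of_coinvariantClass (hb hr0 hh)
        (fun γ f hf => seqForm_lowerSlash hr0 hh.1 (hb hr0 hh) γ hf) hc
    -- In weight zero the pairing equals `d h(i)`. Its non-vanishing gives `h(i) ≠ 0`, hence `v = 1`
    -- and the `E₂` form is invariant; that form takes the value `d` on the constant `d`, so a
    -- trivial class would force `d = 0`.
    · obtain ⟨rfl, d, hd, ρ, h0, h1, rfl⟩ := hx
      rw [contourPairing_inv h0 h1 (differentiableOn_plusDisc hh.1.1), plusDisc_eq (by simp),
        Complex.ofReal_zero, Complex.cpow_zero, one_mul] at hx0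
      have h2 := seqForm_eq_zero_of_coinvariantClass isPolyBounded_quasiSeq
        (fun γ f hf => seqForm_quasiSeq_lowerSlash
          (multiplier_zero_eq_one hh (right_ne_zero_of_mul hx0) γ) hf) hc
      have h3 : c.toFun = d • 1 := funext fun t => by simp [hd t]
      rw [h3, seqForm_smul isPolyBounded_quasiSeq one_mem_smoothSubmodule, seqForm_one] at h2
      refine left_ne_zero_of_mul hx0 ?_
      simpa [quasiSeq] using h2
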